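/- A $3$-uniform hypergraph is \emph{linear} if any two distinct edges share at most one vertex. The \emph{sail} ($3$-fan) $F^3$ is the $3$-uniform linear hypergraph with edges $f_1,f_2,f_3,g$ on $7$ vertices, where $f_1,f_2,f_3$ pairwise meet in the same single vertex $v$, and $g\not\ni v$ meets each of $f_1,f_2,f_3$ in a vertex. The linear Turán number $\mathrm{ex_{lin}}(n,F^3)$ is the maximum number of edges of a $3$-uniform linear hypergraph on $n$ vertices that contains no copy of $F^3$; such hypergraphs with exactly $\mathrm{ex_{lin}}(n,F^3)$ edges are called extremal. **Theorem.** Let $k\ge 3$ and $n=3k+1$. Then $\mathrm{ex_{lin}}(n,F^3)=k^2+1$. Moreover, a $3$-uniform hypergraph on $n$ vertices is extremal if and only if it is obtained by one of the following Constructions 1–4 (in particular, all of these are linear, sail-free and have $k^2+1$ edges). In Constructions 1 and 2 the vertex set is the disjoint union of $X=\{x_1,\dots,x_k\}$, $Y=\{y_1,\dots,y_k\}$ and $Z=\{z_1,\dots,z_{k-2},a,b,c\}$, and $B$ is the complete bipartite graph with parts $X$ and $Y$. **Construction 1** ($k\ge3$). Let $B_0$ be a $2$-factor of $B$ with a cycle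 $C$ of length at least $6$, and let $a'c',x'y'$ be disjoint edges of $C$ with $a',x'\in X$, $c',y'\in Y$ and $a'y',x'c'\notin C$. Properly colour the edges of $B_0\setminus\{a'c',x'y'\}$ with the colours $a,c$ so that the edge at $a'$ has colour $a$ and the edge at $c'$ has colour $c$; colour $x'y'$ with $b$. Decompose $B\setminus B_0$ into perfect matchings $M_1,\dots,M_{k-2}$. The edges of the hypergraph are: $\{u,v,w\}$ for each edge $uv$ of $B_0\setminus\{a'c'\}$ of colour $w\in\{a,b,c\}$; $\{u,v,z_i\}$ for each $uv\in M_i$, $1\le i\le k-2$; and $\{a',b,c\}$, $\{c',a,b\}$. **Construction 2** ($k\ge 3$, $3\mid k$). Let $B_0$ be a $2$-factor of $B$ all of whose cycles have length divisible by $6$. Colour the edges of $B_0$ with $a,b,c$ so that any three consecutive edges on a cycle have three different colours. Decompose $B\setminus B_0$ into perfect matchings $M_1,\dots,M_{k-2}$. The edges of the hypergraph are: $\{u,v,w\}$ for each edge $uv$ of $B_0$ of colour $w\in\{a,b,c\}$; $\{u,v,z_i\}$ for each $uv\in M_i$, $1\le i\le k-2$; and $\{a,b,c\}$. In Constructions 3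 and 4, $k=3$ and the vertices are the ten distinct elements $x_1,x_2,x_3,y_1,y_2,y_3,a,b,c,v$. **Construction 3.** Let $M_v=\{x_1y_1,x_2y_2,x_3y_3\}$, and decompose the union of the two triangles $x_1x_2x_3$ and $y_1y_2y_3$ into three matchings $M_a,M_b,M_c$ of size two. The edges of the hypergraph are $\{u,u',w\}$ for each $uu'\in M_w$, $w\in\{a,b,c,v\}$, and $\{a,b,c\}$. **Construction 4.** Let $M_a=\{y_1y_2,x_1x_2\}$, $M_b=\{x_2x_3\}$, $M_c=\{y_1y_3,x_1x_3\}$, and let $M_v$ be one of $\{x_1y_1,x_2y_2,x_3y_3\}$, $\{x_1y_2,x_2y_1,x_3y_3\}$, $\{x_1y_3,x_3y_1,x_2y_2\}$. The edges of the hypergraph are $\{u,u',w\}$ for each $uu'\in M_w$, $w\in\{a,b,c,v\}$, and $\{a,b,y_3\}$, $\{b,c,y_2\}$. -/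

import Mathlib

/-! A hypergraph on the vertex type `V` is given by its set of edges `H : Finset (Finset V)`. -/

namespace SailTuran

/-- Every edge has exactly `r` vertices. -/
def IsUniform {V : Type*} (r : ℕ) (H : Finset (Finset V)) : Prop :=
  ∀ e ∈ H, e.card = r

/-- Any two distinct edges share at most one vertex. -/
def IsLinear {V : Type*} [DecidableEq V] (H : Finset (Finset V)) : Prop :=
  ∀ e ∈ H, ∀ f ∈ H, e ≠ f → (e ∩ f).card ≤ 1

/-- `H` contains a copy of `F`: some injection of the vertices of `F` into those of `H`
sends every edge of `F` to an edge of `H`. -/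
def ContainsCopy {W V : Type*} (F : Finset (Finset W)) (H : Finset (Finset V)) : Prop :=
  ∃ φ : W ↪ V, ∀ e ∈ F, e.map φ ∈ H

/-- `H` is an `r`-uniform linear hypergraph without a copy of `F`. -/
def IsLinearFree {W V : Type*} [DecidableEq V] (r : ℕ) (F : Finset (Finset W))
    (H : Finset (Finset V)) : Prop :=
  IsUniform r H ∧ IsLinear H ∧ ¬ ContainsCopy F H

/-- The linear Turán number: the maximum number of edges of an `r`-uniform linear hypergraph
on `n` vertices without a copy of `F`. -/
noncomputable def linearTuranNumber {W : Type*} (r n : ℕ) (F : Finset (Finset W)) : ℕ :=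
  sSup {m | ∃ H : Finset (Finset (Fin n)), IsLinearFree r F H ∧ H.card = m}

/-- `H` attains the linear Turán number of `F` on its vertex set. -/
def IsExtremal {W V : Type*} [Fintype V] [DecidableEq V] (r : ℕ) (F : Finset (Finset W))
    (H : Finset (Finset V)) : Prop :=
  IsLinearFree r F H ∧ H.card = linearTuranNumber r (Fintype.card V) F

/-- The sail (3-fan) `F³`: three edges through the vertex `0` that are otherwise disjoint, and
an edge that meets each of them in a vertex different from `0`. -/
def sail : Finset (Finset (Fin 7)) :=
  {{0, 1, 2}, {0, 3, 4}, {0, 5, 6}, {1, 3, 5}}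

/-- The triples obtained by adding the vertex `w` to each of the graph edges in `E`, where `p`
places the vertices of the graph in `V`. -/
def addVertex {U V : Type*} [DecidableEq V] (p : U → V) (E : Set (Sym2 U)) (w : V) :
    Set (Finset V) :=
  {e | ∃ u v, s(u, v) ∈ E ∧ e = {p u, p v, w}}

/-- `K_{k,k}` with parts `X` (the left copy of `Fin k`) and `Y` (the right copy). -/
abbrev Kkk (k : ℕ) : SimpleGraph (Fin k ⊕ Fin k) :=
  completeBipartiteGraph (Fin k) (Fin k)

/-- `B₀` is a 2-factor of `K_{k,k}`, i.e. a spanning 2-regular subgraph. Its cycles are its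
connected components, and the length of a cycle is the number of vertices of the component. -/
def IsTwoFactor {k : ℕ} (B₀ : SimpleGraph (Fin k ⊕ Fin k)) : Prop :=
  B₀ ≤ Kkk k ∧ ∀ u, (B₀.neighborSet u).ncard = 2

/-- `M` decomposes the edges of `G` into perfect matchings. -/
def IsMatchingDecomposition {U ι : Type*} (G : SimpleGraph U) (M : ι → G.Subgraph) : Prop :=
  (∀ i, (M i).IsPerfectMatching) ∧ ∀ e ∈ G.edgeSet, ∃! i, e ∈ (M i).edgeSet

/-- The vertex set `V` is the disjoint union of `X ∪ Y` (enumerated by `p`), the vertices `z i`,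
and the three further vertices `a`, `b`, `c`. -/
def IsVertexPartition {V : Type*} {k : ℕ} (p : Fin k ⊕ Fin k → V) (z : Fin (k - 2) → V)
    (a b c : V) : Prop :=
  Function.Bijective (Sum.elim p (Sum.elim z ![a, b, c]))

/-- `col` properly colours the edges of `G` with the two colours `α` and `γ`, in such a way that
the edges of `G` at the vertex `u₀` have colour `α` and those at the vertex `w₀` have colour `γ`. -/
def IsProperTwoColouring {U V : Type*} (G : SimpleGraph U) (col : Sym2 U → V) (α γ : V)
    (u₀ w₀ : U) : Prop :=
  (∀ e ∈ G.edgeSet, col e = α ∨ col e = γ) ∧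
  (∀ u v w, G.Adj u v → G.Adj u w → v ≠ w → col s(u, v) ≠ col s(u, w)) ∧
  (∀ u, G.Adj u₀ u → col s(u₀, u) = α) ∧
  (∀ u, G.Adj w₀ u → col s(w₀, u) = γ)

/-- First construction. The colours of the edges of `B₀` are the vertices `a`, `b`, `c`; the
edge `a'c'` of `B₀` receives no colour (the value of `col` there is irrelevant). -/
def IsConstruction₁ {V : Type*} [DecidableEq V] (k : ℕ) (H : Finset (Finset V)) : Prop :=
  3 ≤ k ∧
  ∃ (p : Fin k ⊕ Fin k → V) (z : Fin (k - 2) → V) (a b c : V)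
    (B₀ : SimpleGraph (Fin k ⊕ Fin k)) (C : B₀.ConnectedComponent) (a' x' c' y' : Fin k)
    (col : Sym2 (Fin k ⊕ Fin k) → V) (M : Fin (k - 2) → (Kkk k \ B₀).Subgraph),
    IsVertexPartition p z a b c ∧
    IsTwoFactor B₀ ∧
    -- the cycle `C` has length at least 6 and contains the disjoint edges `a'c'` and `x'y'`
    6 ≤ C.supp.ncard ∧
    Sum.inl a' ∈ C.supp ∧ B₀.Adj (Sum.inl a') (Sum.inr c') ∧
    Sum.inl x' ∈ C.supp ∧ B₀.Adj (Sum.inl x') (Sum.inr y') ∧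
    a' ≠ x' ∧ c' ≠ y' ∧
    ¬ B₀.Adj (Sum.inl a') (Sum.inr y') ∧ ¬ B₀.Adj (Sum.inl x') (Sum.inr c') ∧
    -- `col` properly colours `B₀ \ {a'c', x'y'}` with `a` and `c`, and `x'y'` has colour `b`
    IsProperTwoColouring (B₀.deleteEdges {s(Sum.inl a', Sum.inr c'), s(Sum.inl x', Sum.inr y')})
      col a c (Sum.inl a') (Sum.inr c') ∧
    col s(Sum.inl x', Sum.inr y') = b ∧
    IsMatchingDecomposition (Kkk k \ B₀) M ∧
    (H : Set (Finset V)) =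
      (⋃ w ∈ ({a, b, c} : Set V), addVertex p
        {e | e ∈ B₀.edgeSet ∧ e ≠ s(Sum.inl a', Sum.inr c') ∧ col e = w} w) ∪
      (⋃ i, addVertex p (M i).edgeSet (z i)) ∪
      {{p (Sum.inl a'), b, c}, {p (Sum.inr c'), a, b}}

/-- Second construction. The colours of the edges of `B₀` are the vertices `a`, `b`, `c`. -/
def IsConstruction₂ {V : Type*} [DecidableEq V] (k : ℕ) (H : Finset (Finset V)) : Prop :=
  3 ≤ k ∧ 3 ∣ k ∧
  ∃ (p : Fin k ⊕ Fin k → V) (z : Fin (k - 2) → V) (a b c : V)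
    (B₀ : SimpleGraph (Fin k ⊕ Fin k)) (col : Sym2 (Fin k ⊕ Fin k) → V)
    (M : Fin (k - 2) → (Kkk k \ B₀).Subgraph),
    IsVertexPartition p z a b c ∧
    IsTwoFactor B₀ ∧
    (∀ C : B₀.ConnectedComponent, 6 ∣ C.supp.ncard) ∧
    (∀ e ∈ B₀.edgeSet, col e = a ∨ col e = b ∨ col e = c) ∧
    -- any three consecutive edges have three different colours
    (∀ u₀ u₁ u₂ u₃, B₀.Adj u₀ u₁ → B₀.Adj u₁ u₂ → B₀.Adj u₂ u₃ → u₀ ≠ u₂ → u₁ ≠ u₃ →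
      col s(u₀, u₁) ≠ col s(u₁, u₂) ∧ col s(u₁, u₂) ≠ col s(u₂, u₃) ∧
      col s(u₀, u₁) ≠ col s(u₂, u₃)) ∧
    IsMatchingDecomposition (Kkk k \ B₀) M ∧
    (H : Set (Finset V)) =
      (⋃ w ∈ ({a, b, c} : Set V), addVertex p {e | e ∈ B₀.edgeSet ∧ col e = w} w) ∪
      (⋃ i, addVertex p (M i).edgeSet (z i)) ∪
      {{a, b, c}}

/-- The vertices `x₁, x₂, x₃` (left copy of `Fin 3`) and `y₁, y₂, y₃` (right copy). -/
abbrev SixVertices : Type := Fin 3 ⊕ Fin 3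

/-- The vertex `x_{i+1}`. -/
abbrev x (i : Fin 3) : SixVertices := Sum.inl i

/-- The vertex `y_{i+1}`. -/
abbrev y (i : Fin 3) : SixVertices := Sum.inr i

/-- The graph consisting of the triangles `x₁x₂x₃` and `y₁y₂y₃` and a matching between them. -/
def prism : SimpleGraph SixVertices :=
  SimpleGraph.fromEdgeSet
    {s(x 0, x 1), s(x 1, x 2), s(x 2, x 0), s(y 0, y 1), s(y 1, y 2), s(y 2, y 0),
      s(x 0, y 0), s(x 1, y 1), s(x 2, y 2)}

/-- The matching between the two triangles of `prism`. -/
def prismMatching : Set (Sym2 SixVertices) :=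
  {s(x 0, y 0), s(x 1, y 1), s(x 2, y 2)}

/-- Third construction (for `k = 3`). -/
def IsConstruction₃ {V : Type*} [DecidableEq V] (H : Finset (Finset V)) : Prop :=
  ∃ (p : SixVertices → V) (a b c v : V) (Ma Mb Mc : (prism.deleteEdges prismMatching).Subgraph),
    Function.Bijective (Sum.elim p ![a, b, c, v]) ∧
    -- the rest of the prism decomposes into the matchings `Ma`, `Mb`, `Mc` of size two
    Ma.IsMatching ∧ Mb.IsMatching ∧ Mc.IsMatching ∧
    Ma.edgeSet.ncard = 2 ∧ Mb.edgeSet.ncard = 2 ∧ Mc.edgeSet.ncard = 2 ∧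
    Disjoint Ma.edgeSet Mb.edgeSet ∧ Disjoint Ma.edgeSet Mc.edgeSet ∧
    Disjoint Mb.edgeSet Mc.edgeSet ∧
    Ma.edgeSet ∪ Mb.edgeSet ∪ Mc.edgeSet = (prism.deleteEdges prismMatching).edgeSet ∧
    (H : Set (Finset V)) =
      addVertex p prismMatching v ∪
      addVertex p Ma.edgeSet a ∪ addVertex p Mb.edgeSet b ∪ addVertex p Mc.edgeSet c ∪
      {{a, b, c}}

/-- Fourth construction (for `k = 3`). -/
def IsConstruction₄ {V : Type*} [DecidableEq V] (H : Finset (Finset V)) : Prop :=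
  ∃ (p : SixVertices → V) (a b c v : V) (Mv : Set (Sym2 SixVertices)),
    Function.Bijective (Sum.elim p ![a, b, c, v]) ∧
    (Mv = {s(x 0, y 0), s(x 1, y 1), s(x 2, y 2)} ∨
      Mv = {s(x 0, y 1), s(x 1, y 0), s(x 2, y 2)} ∨
      Mv = {s(x 0, y 2), s(x 2, y 0), s(x 1, y 1)}) ∧
    (H : Set (Finset V)) =
      addVertex p {s(y 0, y 1), s(x 0, x 1)} a ∪
      addVertex p {s(x 1, x 2)} b ∪
      addVertex p {s(y 0, y 2), s(x 0, x 2)} c ∪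
      addVertex p Mv v ∪
      {{a, b, p (y 2)}, {b, c, p (y 1)}}

end SailTuran

/-! For a vertex `v` let `far H v` consist of `v` and its non-neighbours. In a linear triple system
an edge `g` disjoint from `far H v` consists of three neighbours of `v`; by linearity they lie on
three different edges through `v`, and these form a sail with `g`. So a linear triple system is
sail-free iff every edge meets every far set (`not_containsCopy_sail`, `inter_far_nonempty`).
Everything else is double counting with far sets, whose size is `3k + 1 - 2 deg v`.

Let `H` have `k² + m` edges, `m ≥ 1`. Since `|H| ≤ ∑ deg` over `far H v`, a vertex of maximum degree
shows that all degrees are at most `k`; the defects `k - deg` add up to `k - 3m`. At a vertex `v` of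
full degree the count is exact (`sum_excess`): the surplus intersections of edges with `far H v`,
the number `m` and the defects in `far H v` share a budget of `k`. Comparing two far sets
(`excess_of_adj`) forces `m = 1` as soon as `far H v` contains two adjacent vertices, one of them of
full degree; for `k ≥ 4` the excess edges then form a star (`exists_isStar`). Applied to the three
far sets of an edge of full-degree vertices, this gives `exists_centre`: `m = 1`, which is the upper
bound, and some `v` has full degree together with all its neighbours.

At such a `v` the surplus is exactly 2, so some edge `{v, w, w'}` has `w` and `w'` on no excess
edge, and the far sets of `w` and `w'` split the `2k` neighbours of `v` into halves `X` and `Y`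
(`exists_isSplit`). If `k ≥ 4`, no edge has two vertices in one half (`card_inter_right_le`). If `k
= 3` and some edge does, the hypergraph contains a prism (`exists_isPrismSystem`), which can be
completed only to Constructions 3 and 4.

In the remaining case a degree count leaves exactly one edge avoiding `X` and exactly one avoiding
`Y`. All other edges are triples `{x, y, t}` with `t` in `far H v`, that is, a colouring of the
cells of a `k × k` square by `k + 1` colours, of which all but three occur in every row and column.
If the two avoiding edges coincide, the colouring is closed (Construction 2); otherwise they share a
vertex and there is a corner (Construction 1). The cells of the three special colours form the
2-factor, and its cycle conditions come from counting rows and columns that miss a colour.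
Conversely, each colouring supplies for every vertex and edge a common vertex of the edge and the
far set, so the constructions are sail-free; a cyclic Latin square shows that they exist for every
`k ≥ 3`. -/

namespace SailTuran
open Finset

/-! ### Far sets and the reformulation of sail-freeness. -/

section Basic

variable {V : Type*} [DecidableEq V]

/-- The degree of a vertex. -/
def deg (H : Finset (Finset V)) (v : V) : ℕ := (H.filter (v ∈ ·)).card

/-- The vertex `v` together with the vertices that share no edge with `v`. -/
def far [Fintype V] (H : Finset (Finset V)) (v : V) : Finset V :=
  univ.filter fun u => ∀ e ∈ H, v ∈ e → u ∈ e → u = v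

lemma sum_deg (H : Finset (Finset V)) (A : Finset V) :
    ∑ u ∈ A, deg H u = ∑ g ∈ H, (g ∩ A).card := by
  simp only [deg, card_filter]
  rw [sum_comm]
  refine sum_congr rfl fun g _ => ?_
  rw [← card_filter, filter_mem_eq_inter, inter_comm]

variable {H : Finset (Finset V)} {u v w : V}

lemma isLinear_iff : IsLinear H ↔ ∀ e ∈ H, ∀ f ∈ H, ∀ u w, u ≠ w → u ∈ e → w ∈ e → u ∈ f → w ∈ f →
    e = f := by
  refine ⟨fun h e he f hf u w huw ue we uf wf => ?_, fun h e he f hf hef => ?_⟩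
  · by_contra hne
    have := card_le_one.1 (h e he f hf hne) u (by simp [ue, uf]) w (by simp [we, wf])
    exact huw this
  · rw [card_le_one]
    intro u hu w hw
    by_contra huw
    simp only [mem_inter] at hu hw
    exact hef (h e he f hf u w huw hu.1 hw.1 hu.2 hw.2)

lemma exists_third {e : Finset V} (he : e.card = 3) (hu : u ∈ e) (hv : v ∈ e) (huv : u ≠ v) :
    ∃ w, w ≠ u ∧ w ≠ v ∧ e = {u, v, w} := by
  have h1 : ((e.erase u).erase v).card = 1 := by
    rw [card_erase_of_mem (by simp [hv, huv.symm]), card_erase_of_mem hu, he]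
  obtain ⟨w, hw⟩ := card_eq_one.1 h1
  have hw' : w ∈ (e.erase u).erase v := by simp [hw]
  simp only [mem_erase] at hw'
  refine ⟨w, hw'.2.1, hw'.1, ?_⟩
  rw [← hw, insert_erase (by simp [hv, huv.symm]), insert_erase hu]

variable [Fintype V]

lemma mem_far : u ∈ far H v ↔ ∀ e ∈ H, v ∈ e → u ∈ e → u = v := by simp [far]

lemma mem_far_self (H : Finset (Finset V)) (v : V) : v ∈ far H v := by simp [far]

lemma mem_far_comm : u ∈ far H v ↔ v ∈ far H u := by
  simp only [mem_far]
  exact ⟨fun h e he hu hv => (h e he hv hu).symm, fun h e he hv hu => (h e he hu hv).symm⟩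

lemma not_mem_far : u ∉ far H v ↔ u ≠ v ∧ ∃ e ∈ H, v ∈ e ∧ u ∈ e := by
  simp only [mem_far]; push Not
  exact ⟨fun ⟨e, he, hv, hu, h⟩ => ⟨h, e, he, hv, hu⟩, fun ⟨h, e, he, hv, hu⟩ => ⟨e, he, hv, hu, h⟩⟩

lemma not_mem_far_of_mem {e : Finset V} (he : e ∈ H) (hv : v ∈ e) (hu : u ∈ e) (h : u ≠ v) :
    u ∉ far H v := not_mem_far.2 ⟨h, e, he, hv, hu⟩

/-- If every edge meets every `far` set then there is no sail. -/
lemma not_containsCopy_sail (h : ∀ v, ∀ g ∈ H, (g ∩ far H v).Nonempty) :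
    ¬ ContainsCopy sail H := by
  rintro ⟨φ, hφ⟩
  have e1 := hφ {0, 1, 2} (by simp [sail])
  have e2 := hφ {0, 3, 4} (by simp [sail])
  have e3 := hφ {0, 5, 6} (by simp [sail])
  have e4 := hφ {1, 3, 5} (by simp [sail])
  -- Every vertex of the fourth edge is a neighbour of the apex `φ 0`, so that edge cannot meet the
  -- far set of the apex.
  obtain ⟨u, hu⟩ := h (φ 0) _ e4
  simp only [mem_inter, map_insert, map_singleton, mem_insert, mem_singleton] at hu
  obtain ⟨rfl | rfl | rfl, hu⟩ := hu
  · exact not_mem_far_of_mem (v := φ 0) e1 (by simp) (by simp) (by simp) hu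
  · exact not_mem_far_of_mem (v := φ 0) e2 (by simp) (by simp) (by simp) hu
  · exact not_mem_far_of_mem (v := φ 0) e3 (by simp) (by simp) (by simp) hu

/-- In a linear sail-free hypergraph every edge meets every `far` set. -/
lemma inter_far_nonempty (hu : IsUniform 3 H) (hl : IsLinear H) (hs : ¬ ContainsCopy sail H)
    (v : V) (g : Finset V) (hg : g ∈ H) : (g ∩ far H v).Nonempty := by
  rw [isLinear_iff] at hl
  by_contra hne
  have hout : ∀ w ∈ g, w ∉ far H v := fun w hw hw' => hne ⟨w, by simp [hw, hw']⟩
  have hv : v ∉ g := fun h => hout v h (mem_far_self H v)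
  obtain ⟨p, q, r, hpq, hpr, hqr, rfl⟩ := card_eq_three.1 (hu g hg)
  simp only [mem_insert, mem_singleton, not_or, forall_eq_or_imp, forall_eq] at hv hout
  obtain ⟨hp, hq, hr⟩ := hout
  obtain ⟨hpv, e1, he1, hv1, hp1⟩ := not_mem_far.1 hp
  obtain ⟨hqv, e2, he2, hv2, hq2⟩ := not_mem_far.1 hq
  obtain ⟨hrv, e3, he3, hv3, hr3⟩ := not_mem_far.1 hr
  obtain ⟨p', hp'v, hp'p, rfl⟩ := exists_third (hu e1 he1) hv1 hp1 hpv.symm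
  obtain ⟨q', hq'v, hq'q, rfl⟩ := exists_third (hu e2 he2) hv2 hq2 hqv.symm
  obtain ⟨r', hr'v, hr'r, rfl⟩ := exists_third (hu e3 he3) hv3 hr3 hrv.symm
  -- An edge through `v` with two vertices of `g` would equal `g`, which does not contain `v`. Hence
  -- the three edges through `v` are distinct and meet `g` once each, and `key2` makes their third
  -- vertices distinct.
  have key : ∀ a b a', a ≠ b → a ∈ ({p, q, r} : Finset V) → b ∈ ({p, q, r} : Finset V) →
      {v, a, a'} ∈ H → a' ≠ b := by
    rintro a b a' hab ha hb h rfl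
    have := hl _ h _ hg a a' hab (by simp) (by simp) ha hb
    have hv' : v ∈ ({p, q, r} : Finset V) := by rw [← this]; simp
    simp [hv] at hv'
  have key2 : ∀ a b a' b', a ≠ b → a ∈ ({p, q, r} : Finset V) → b ∈ ({p, q, r} : Finset V) →
      {v, a, a'} ∈ H → {v, b, b'} ∈ H → a' ≠ v → b ≠ v → a' ≠ b' := by
    rintro a b a' b' hab ha hb h h' ha' hb' rfl
    have := hl _ h _ h' v a' ha'.symm (by simp) (by simp) (by simp) (by simp)
    have hb2 : b ∈ ({v, a, a'} : Finset V) := by rw [this]; simp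
    simp only [mem_insert, mem_singleton, hb', hab.symm, false_or] at hb2
    exact key a b a' hab ha hb h hb2.symm
  apply hs
  have h1 := key p q p' hpq (by simp) (by simp) he1
  have h2 := key p r p' hpr (by simp) (by simp) he1
  have h3 := key q p q' hpq.symm (by simp) (by simp) he2
  have h4 := key q r q' hqr (by simp) (by simp) he2
  have h5 := key r p r' hpr.symm (by simp) (by simp) he3
  have h6 := key r q r' hqr.symm (by simp) (by simp) he3
  have h7 := key2 p q p' q' hpq (by simp) (by simp) he1 he2 hp'v hqv
  have h8 := key2 p r p' r' hpr (by simp) (by simp) he1 he3 hp'v hrv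
  have h9 := key2 q r q' r' hqr (by simp) (by simp) he2 he3 hq'v hrv
  refine ⟨⟨![v, p, p', q, q', r, r'], ?_⟩, ?_⟩
  · rw [← List.nodup_ofFn]
    simp only [List.ofFn_succ, List.ofFn_zero, List.nodup_cons, List.mem_cons, List.not_mem_nil,
      or_false, not_or, List.nodup_nil, and_true, Matrix.cons_val_zero, Matrix.cons_val_succ,
      not_false_eq_true]
    exact ⟨⟨hpv.symm, hp'v.symm, hqv.symm, hq'v.symm, hrv.symm, hr'v.symm⟩,
      ⟨hp'p.symm, hpq, h3.symm, hpr, h5.symm⟩, ⟨h1, h7, h2, h8⟩, ⟨hq'q.symm, hqr, h6.symm⟩,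
      ⟨h4, h9⟩, hr'r.symm⟩
  · intro e he
    simp only [sail, mem_insert, mem_singleton] at he
    obtain rfl | rfl | rfl | rfl := he
    · rw [map_insert, map_insert, map_singleton]; exact he1
    · rw [map_insert, map_insert, map_singleton]; exact he2
    · rw [map_insert, map_insert, map_singleton]; exact he3
    · rw [map_insert, map_insert, map_singleton]; exact hg

end Basic

/-! ### Double counting over far sets. -/

section Double

variable {V : Type*} [DecidableEq V] [Fintype V] {H : Finset (Finset V)}

lemma compl_far_eq (H : Finset (Finset V)) (v : V) :
    univ \ far H v = (H.filter (v ∈ ·)).biUnion (·.erase v) := by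
  ext u
  simp only [mem_sdiff, mem_univ, true_and, not_mem_far, mem_biUnion, mem_filter, mem_erase]
  exact ⟨fun ⟨h, e, he, hv, hu⟩ => ⟨e, ⟨he, hv⟩, h, hu⟩,
    fun ⟨e, ⟨he, hv⟩, h, hu⟩ => ⟨h, e, he, hv, hu⟩⟩

/-- A sum over the neighbours of `v` is a sum over the edges at `v`. -/
lemma sum_compl_far (hl : IsLinear H) (v : V) (f : V → ℕ) :
    ∑ u ∈ univ \ far H v, f u = ∑ g ∈ H.filter (v ∈ ·), ∑ u ∈ g.erase v, f u := by
  rw [compl_far_eq, sum_biUnion]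
  intro e he f hf hef
  simp only [coe_filter, Set.mem_ofPred_eq] at he hf
  rw [Function.onFun, disjoint_left]
  intro u hu hu'
  rw [mem_erase] at hu hu'
  exact hef (isLinear_iff.1 hl e he.1 f hf.1 u v hu.1 hu.2 he.2 hu'.2 hf.2)

/-- By linearity each neighbour of `v` lies on exactly one edge through `v`. The `erase` discards
`v`, which belongs to its own far set. -/
lemma card_sdiff_far (hl : IsLinear H) (v : V) (A : Finset V) :
    (A \ far H v).card = ∑ g ∈ H.filter (v ∈ ·), ((g ∩ A).erase v).card := by
  have h := sum_compl_far hl v (fun u => if u ∈ A then 1 else 0)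
  rw [← card_filter] at h
  have e1 : (univ \ far H v).filter (· ∈ A) = A \ far H v := by ext; simp [and_comm]
  rw [e1] at h
  rw [h]
  refine sum_congr rfl fun g _ => ?_
  rw [← card_filter, filter_mem_eq_inter, erase_inter]

lemma card_far (hu : IsUniform 3 H) (hl : IsLinear H) (v : V) :
    (far H v).card + 2 * deg H v = Fintype.card V := by
  have h := card_sdiff_far hl v univ
  have h2 : ∑ g ∈ H.filter (v ∈ ·), ((g ∩ univ).erase v).card = 2 * deg H v := by
    rw [sum_const_nat (m := 2), deg, mul_comm]
    intro g hg
    rw [mem_filter] at hg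
    rw [inter_univ, card_erase_of_mem hg.2, hu g hg.1]
  rw [h2, card_sdiff_of_subset (subset_univ _), card_univ] at h
  have := card_le_univ (far H v)
  omega

lemma card_le_sum_far (h : ∀ v, ∀ g ∈ H, (g ∩ far H v).Nonempty) (v : V) :
    H.card ≤ ∑ u ∈ far H v, deg H u := by
  rw [sum_deg, card_eq_sum_ones]
  exact sum_le_sum fun g hg => (h v g hg).card_pos

end Double
end SailTuran

namespace SailTuran
open Finset

/-! ### Degree defects and excess edges. -/

section Dense

variable {V : Type*} [DecidableEq V] [Fintype V]

/-- A linear sail-free triple system on `3k + 1` vertices with `k² + m` edges, where `m ≥ 1`. -/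
structure IsDense (k m : ℕ) (H : Finset (Finset V)) : Prop where
  three_le : 3 ≤ k
  one_le : 1 ≤ m
  card_vertices : Fintype.card V = 3 * k + 1
  card_edges : H.card = k ^ 2 + m
  uniform : IsUniform 3 H
  linear : IsLinear H
  inter_far : ∀ v, ∀ g ∈ H, (g ∩ far H v).Nonempty

/-- The amount by which the degree of `u` falls short of `k`. -/
def defect (k : ℕ) (H : Finset (Finset V)) (u : V) : ℕ := k - deg H u

/-- The edges with at least two vertices in `far H v`. -/
def excessEdges (H : Finset (Finset V)) (v : V) : Finset (Finset V) :=
  H.filter fun g => 2 ≤ (g ∩ far H v).card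

variable {k m : ℕ} {H : Finset (Finset V)} {u v s : V}

lemma mem_excessEdges {g : Finset V} :
    g ∈ excessEdges H v ↔ g ∈ H ∧ 2 ≤ (g ∩ far H v).card := mem_filter

namespace IsDense

lemma eq_of_mem (hH : IsDense k m H) {e f : Finset V} {u w : V} (he : e ∈ H)
    (hf : f ∈ H) (huw : u ≠ w) (hu : u ∈ e) (hw : w ∈ e) (hu' : u ∈ f) (hw' : w ∈ f) : e = f :=
  isLinear_iff.1 hH.linear e he f hf u w huw hu hw hu' hw'

/-- At a vertex of maximum degree `d` the double count gives `k² + m ≤ (3k + 1 - 2d) d`, and the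
right side drops below `k²` once `d > k`. -/
lemma deg_le (hH : IsDense k m H) (u : V) : deg H u ≤ k := by
  obtain ⟨v, -, hv⟩ := exists_max_image univ (deg H) ⟨u, mem_univ u⟩
  refine (hv u (mem_univ u)).trans ?_
  have h1 := card_le_sum_far hH.inter_far v
  have h2 : ∑ u ∈ far H v, deg H u ≤ (far H v).card * deg H v :=
    sum_le_card_nsmul _ _ _ fun w _ => hv w (mem_univ w)
  have h3 := card_far hH.uniform hH.linear v
  have h4 := h1.trans h2
  rw [hH.card_vertices] at h3
  rw [hH.card_edges] at h4
  have := hH.one_le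
  by_contra! hlt
  obtain ⟨t, ht⟩ := Nat.exists_eq_add_of_lt hlt
  rw [ht] at h3 h4
  nlinarith

lemma deg_add_defect (hH : IsDense k m H) (u : V) : deg H u + defect k H u = k := by
  have := hH.deg_le u
  unfold defect; omega

lemma sum_deg_add_defect (hH : IsDense k m H) (A : Finset V) :
    ∑ u ∈ A, deg H u + ∑ u ∈ A, defect k H u = A.card * k := by
  rw [← sum_add_distrib, sum_const_nat fun u _ => hH.deg_add_defect u]

/-- The degree sum `3(k² + m)` is compared with `(3k + 1) k`. In particular `3m ≤ k`, and at most `k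
- 3` units of degree are missing altogether. -/
lemma sum_defect (hH : IsDense k m H) : ∑ u, defect k H u + 3 * m = k := by
  have h := hH.sum_deg_add_defect univ
  rw [sum_deg, sum_const_nat (m := 3), hH.card_edges, card_univ, hH.card_vertices] at h
  · nlinarith
  · intro g hg
    rw [inter_univ, hH.uniform g hg]

lemma deg_eq_of_defect (hH : IsDense k m H) (h : defect k H v = 0) : deg H v = k := by
  have := hH.deg_add_defect v; omega

lemma card_far_of_defect (hH : IsDense k m H) (h : defect k H v = 0) : (far H v).card = k + 1 := by
  have h3 := card_far hH.uniform hH.linear v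
  rw [hH.card_vertices, hH.deg_eq_of_defect h] at h3
  omega

lemma one_le_inter_far (hH : IsDense k m H) {g : Finset V} (v : V) (hg : g ∈ H) :
    1 ≤ (g ∩ far H v).card :=
  (hH.inter_far v g hg).card_pos

/-- The sum of the degrees over the `k + 1` vertices of `far H v`, computed by edges: each edge
contributes one, which makes `k² + m`, plus its surplus. This is the budget on which all later
estimates draw. -/
lemma sum_excess (hH : IsDense k m H) (h : defect k H v = 0) :
    ∑ g ∈ excessEdges H v, ((g ∩ far H v).card - 1) + m + ∑ u ∈ far H v, defect k H u = k := by
  have h1 := hH.sum_deg_add_defect (far H v)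
  rw [sum_deg, hH.card_far_of_defect h] at h1
  have h2 : ∑ g ∈ H, (g ∩ far H v).card = ∑ g ∈ H, ((g ∩ far H v).card - 1) + H.card := by
    rw [card_eq_sum_ones, ← sum_add_distrib]
    refine sum_congr rfl fun g hg => ?_
    have := hH.one_le_inter_far v hg
    omega
  have h3 : ∑ g ∈ excessEdges H v, ((g ∩ far H v).card - 1) =
      ∑ g ∈ H, ((g ∩ far H v).card - 1) := by
    refine sum_subset (filter_subset _ _) fun g hg hg' => ?_
    rw [mem_excessEdges] at hg'
    have : ¬ 2 ≤ (g ∩ far H v).card := fun h => hg' ⟨hg, h⟩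
    omega
  rw [h2, ← h3, hH.card_edges] at h1
  nlinarith

/-- A neighbour of `u` inside `far H v` is joined to `u` by an edge with two vertices in `far H v`,
so only excess edges contribute. -/
lemma card_inter_far_filter (hH : IsDense k m H) (hu : u ∈ far H v) :
    (far H v \ far H u).card =
      ∑ g ∈ (excessEdges H v).filter (u ∈ ·), ((g ∩ far H v).card - 1) := by
  rw [card_sdiff_far hH.linear, eq_comm]
  refine (sum_congr rfl fun g hg => ?_).trans (sum_subset ?_ fun g hg hg' => ?_)
  · rw [card_erase_of_mem]
    simp only [mem_filter] at hg
    simp [hg.2, hu]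
  · exact filter_subset_filter _ (filter_subset _ _)
  · simp only [mem_filter, mem_excessEdges] at hg hg'
    rw [card_erase_of_mem (by simp [hg.2, hu])]
    have : ¬ 2 ≤ (g ∩ far H v).card := fun h => hg' ⟨⟨hg.1, h⟩, hg.2⟩
    omega

/-- A bound on the edges at `s` that meet `far H v` in `s` only. -/
lemma deg_le_excess (hH : IsDense k m H) (hv : defect k H v = 0) (hu : defect k H u = 0)
    (hsv : s ∈ far H v) (hsu : s ∉ far H u) :
    deg H s ≤ ((excessEdges H v).filter (s ∈ ·)).card + (far H v \ far H u).card := by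
  -- Both far sets have `k + 1` elements.
  have hc : (far H v \ far H u).card = (far H u \ far H v).card :=
    card_sdiff_comm (by rw [hH.card_far_of_defect hv, hH.card_far_of_defect hu])
  have hsplit : deg H s = ((excessEdges H v).filter (s ∈ ·)).card +
      ((H.filter (s ∈ ·)).filter fun g => ¬ 2 ≤ (g ∩ far H v).card).card := by
    rw [deg, ← card_filter_add_card_filter_not (p := fun g => 2 ≤ (g ∩ far H v).card),
      excessEdges, filter_comm]
  rw [hsplit, hc]
  gcongr
  have : Nonempty V := ⟨s⟩
  -- An edge at `s` that is not an excess edge meets `far H v` in `s` alone, and `s` is not in `far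
  -- H u`. So its vertex in `far H u` lies outside `far H v`, and different edges at `s` have
  -- different such vertices.
  choose! f hf using fun g (hg : g ∈ H) => hH.inter_far u g hg
  have hf' : ∀ g ∈ (H.filter (s ∈ ·)).filter (fun g => ¬ 2 ≤ (g ∩ far H v).card),
      g ∈ H ∧ s ∈ g ∧ f g ∈ g ∧ f g ∈ far H u ∧ f g ∉ far H v ∧ f g ≠ s := by
    intro g hg
    simp only [mem_filter] at hg
    obtain ⟨⟨hg, hs⟩, h2⟩ := hg
    have h := mem_inter.1 (hf g hg)
    have hne : f g ≠ s := fun h' => hsu (h' ▸ h.2)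
    refine ⟨hg, hs, h.1, h.2, fun h' => h2 ?_, hne⟩
    exact one_lt_card.2 ⟨f g, by simp [h.1, h'], s, by simp [hs, hsv], hne⟩
  refine card_le_card_of_injOn f (fun g hg => ?_) fun g hg g' hg' hgg' => ?_
  · obtain ⟨-, -, -, h1, h2, -⟩ := hf' g hg
    exact mem_coe.2 (mem_sdiff.2 ⟨h1, h2⟩)
  · obtain ⟨h1, h2, h3, -, -, h6⟩ := hf' g hg
    obtain ⟨hgH, hsg, hfg, -⟩ := hf' g' hg'
    exact hH.eq_of_mem h1 hgH h6 h3 h2 (hgg' ▸ hfg) hsg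

/-- Two adjacent vertices of `far H v`, one of them of full degree, control all excess edges. -/
lemma excess_of_adj (hH : IsDense k m H) (hv : defect k H v = 0) (hu : defect k H u = 0)
    (huv : u ∈ far H v) (hsv : s ∈ far H v) (hsu : s ∉ far H u) :
    m = 1 ∧ ∑ w ∈ far H v, defect k H w = defect k H s ∧
      ∀ g ∈ excessEdges H v, u ∉ g → s ∈ g ∧ (g ∩ far H v).card = 2 := by
  have h1 := hH.deg_le_excess hv hu hsv hsu
  rw [hH.card_inter_far_filter huv] at h1
  have h2 := hH.sum_excess hv
  have h3 := hH.deg_add_defect s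
  obtain ⟨hne, g₀, hg₀, hu₀, hs₀⟩ := not_mem_far.1 hsu
  have hg₀' : g₀ ∈ excessEdges H v := mem_excessEdges.2
    ⟨hg₀, one_lt_card.2 ⟨u, by simp [hu₀, huv], s, by simp [hs₀, hsv], hne.symm⟩⟩
  have h4 : defect k H s ≤ ∑ w ∈ far H v, defect k H w :=
    single_le_sum (f := defect k H) (fun _ _ => Nat.zero_le _) hsv
  rw [card_filter, sum_filter, ← sum_add_distrib] at h1
  -- An excess edge has surplus at least one, which pays for its contribution to the bound on `deg H
  -- s`. Only the edge `g₀` joining `u` to `s` contributes one unit more.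
  have hle : ∀ g ∈ excessEdges H v,
      (if s ∈ g then 1 else 0) + (if u ∈ g then (g ∩ far H v).card - 1 else 0) ≤
        ((g ∩ far H v).card - 1) + if g = g₀ then 1 else 0 := by
    intro g hg
    rw [mem_excessEdges] at hg
    by_cases hu' : u ∈ g <;> by_cases hs' : s ∈ g
    · rw [if_pos hu', if_pos hs', if_pos (hH.eq_of_mem hg.1 hg₀ hne.symm hu' hs' hu₀ hs₀)]; omega
    · rw [if_pos hu', if_neg hs']; omega
    · rw [if_neg hu', if_pos hs']; omega
    · rw [if_neg hu', if_neg hs']; omega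
  have htot : ∑ g ∈ excessEdges H v, (((g ∩ far H v).card - 1) + if g = g₀ then 1 else 0) =
      ∑ g ∈ excessEdges H v, ((g ∩ far H v).card - 1) + 1 := by
    rw [sum_add_distrib, sum_ite_eq' (excessEdges H v) g₀, if_pos hg₀']
  have hsum := sum_le_sum hle
  have hm := hH.one_le
  -- Together with `sum_excess` the bound reads `m + ∑ defect ≤ defect s + 1`. As `m ≥ 1` and
  -- `defect s` is one of the summands, there is equality everywhere, in particular in `hle` for
  -- each edge.
  refine ⟨by omega, by omega, fun g hg hug => ?_⟩
  have heq := (sum_eq_sum_iff_of_le hle).1 (by omega) g hg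
  have hgg : g ≠ g₀ := fun h => hug (h ▸ hu₀)
  rw [mem_excessEdges] at hg
  rw [if_neg hug, if_neg hgg] at heq
  by_cases hs' : s ∈ g
  · rw [if_pos hs'] at heq
    exact ⟨hs', by omega⟩
  · rw [if_neg hs'] at heq
    omega

end IsDense
end Dense
end SailTuran

namespace SailTuran
open Finset

/-! ### The excess edges of a full-degree vertex form a star. -/

section Star

variable {V : Type*} [DecidableEq V] [Fintype V] {k m : ℕ} {H : Finset (Finset V)} {u v : V}

/-- All excess edges of `v` have exactly two vertices in `far H v`, one of which is `s`, and all
other vertices of `far H v` have full degree. -/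
structure IsStar (k : ℕ) (H : Finset (Finset V)) (v s : V) : Prop where
  mem_far : s ∈ far H v
  mem : ∀ g ∈ excessEdges H v, s ∈ g
  card_inter : ∀ g ∈ excessEdges H v, (g ∩ far H v).card = 2
  defect_eq : ∀ u ∈ far H v, u ≠ s → defect k H u = 0

lemma excess_of_mem {g : Finset V} {p q : V} (hg : g ∈ H) (hpq : p ≠ q) (hp : p ∈ g) (hq : q ∈ g)
    (hpv : p ∈ far H v) (hqv : q ∈ far H v) : g ∈ excessEdges H v :=
  mem_excessEdges.2 ⟨hg, one_lt_card.2 ⟨p, by simp [hp, hpv], q, by simp [hq, hqv], hpq⟩⟩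

namespace IsDense

/-- If `v` and `w` have full degree and `w` lies in no excess edge of `v`, then `v` and `w` have
the same `far` set. -/
lemma far_eq_far {w : V} (hH : IsDense k m H) (hv : defect k H v = 0) (hw : defect k H w = 0)
    (hwv : w ∈ far H v) (h : ∀ g ∈ excessEdges H v, w ∉ g) : far H v = far H w := by
  refine eq_of_subset_of_card_le (fun t ht => ?_)
    (by rw [hH.card_far_of_defect hv, hH.card_far_of_defect hw])
  by_contra htw
  obtain ⟨hne, g, hg, hwg, htg⟩ := not_mem_far.1 htw
  exact h g (excess_of_mem hg hne htg hwg ht hwv) hwg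

/-- Three excess edges of `v` cannot form a triangle inside `far H v`. -/
lemma no_triangle {p q s w : V} (hH : IsDense k m H) (hv : defect k H v = 0)
    (hs : defect k H s = 0) (hw : defect k H w = 0) (hwv : w ∈ far H v) (hwne : w ≠ v)
    (hsv : s ∈ far H v) (hp : p ∈ far H v) (hq : q ∈ far H v) (hpq : p ≠ q)
    (hps : p ∉ far H s) (hqs : q ∉ far H s)
    (hwx : ∀ g ∈ excessEdges H v, w ∉ g) : False := by
  have hvw := hH.far_eq_far hv hw hwv hwx
  have hc : (far H v \ far H s).card = (far H s \ far H v).card :=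
    card_sdiff_comm (by rw [hH.card_far_of_defect hv, hH.card_far_of_defect hs])
  have h2 : 1 < (far H s \ far H v).card := by
    rw [← hc]
    exact one_lt_card.2 ⟨p, by simp [hp, hps], q, by simp [hq, hqs], hpq⟩
  obtain ⟨t, ht, t', ht', htt'⟩ := one_lt_card.1 h2
  rw [mem_sdiff] at ht ht'
  have hvs : v ∈ far H s := mem_far_comm.1 hsv
  have hws : w ∈ far H s := by rw [hvw] at hsv; exact mem_far_comm.1 hsv
  -- Now `s` plays the part of `v`, with the adjacent vertices `v` and `t` in its far set: an excess
  -- edge of `s` avoiding `v` contains `t` and only one further vertex of `far H s`. The edge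
  -- joining `w` to `t'` violates this.
  obtain ⟨-, -, h3⟩ := hH.excess_of_adj hs hv hvs ht.1 ht.2
  have htw' : t' ∉ far H w := hvw ▸ ht'.2
  obtain ⟨hne, h, hh, hwh, ht'h⟩ := not_mem_far.1 htw'
  have hvh : v ∉ h := fun hvh => not_mem_far_of_mem hh hvh hwh hwne hwv
  obtain ⟨hth, hcard⟩ := h3 h (excess_of_mem hh hne ht'h hwh ht'.1 hws) hvh
  have htw : t ≠ w := fun h' => ht.2 (h' ▸ hwv)
  have : 2 < (h ∩ far H s).card := by
    rw [two_lt_card]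
    exact ⟨t, by simp [hth, ht.1], t', by simp [ht'h, ht'.1], w, by simp [hwh, hws], htt', htw, hne⟩
  omega

/-- The excess edges of `v` form a star as soon as one of them contains a vertex of full degree
in `far H v`. -/
lemma exists_isStar (hH : IsDense k m H) (hk : 4 ≤ k) (hv : defect k H v = 0) {g : Finset V}
    (hg : g ∈ excessEdges H v) (hug : u ∈ g) (huv : u ∈ far H v) (hu : defect k H u = 0) :
    m = 1 ∧ ∃ s, IsStar k H v s := by
  obtain ⟨hgH, hg2⟩ := mem_excessEdges.1 hg
  obtain ⟨s, hs, hsu⟩ := exists_mem_ne (one_lt_two.trans_le hg2) u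
  rw [mem_inter] at hs
  obtain ⟨hm, hsum, -⟩ := hH.excess_of_adj hv hu huv hs.2 (not_mem_far_of_mem hgH hug hs.1 hsu)
  have hfull : ∀ w ∈ far H v, w ≠ s → defect k H w = 0 := by
    intro w hw hws
    have : defect k H w + defect k H s ≤ ∑ w ∈ far H v, defect k H w := by
      rw [← sum_pair hws]
      exact sum_le_sum_of_subset (by simp [insert_subset_iff, hw, hs.2])
    omega
  refine ⟨hm, ?_⟩
  -- Either `s` carries all the defect of `far H v`, and then no excess edge joins two other
  -- vertices, since `excess_of_adj` would put the whole defect on one of those; or `far H v` has no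
  -- defect at all.
  by_cases hs0 : defect k H s = 0
  swap
  · have key : ∀ h ∈ excessEdges H v, ∀ p ∈ h ∩ far H v, ∀ q ∈ h ∩ far H v, p ≠ q →
        q ≠ s → p = s := by
      intro h hh p hp q hq hpq hqs
      by_contra hps
      rw [mem_inter] at hp hq
      obtain ⟨-, h', -⟩ := hH.excess_of_adj hv (hfull p hp.2 hps) hp.2 hq.2
        (not_mem_far_of_mem (mem_excessEdges.1 hh).1 hp.1 hq.1 hpq.symm)
      rw [hsum, hfull q hq.2 hqs] at h'
      exact hs0 h'
    refine ⟨s, hs.2, fun h hh => ?_, fun h hh => ?_, hfull⟩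
    · obtain ⟨p, hp, q, hq, hpq⟩ := one_lt_card.1 (mem_excessEdges.1 hh).2
      by_cases hqs : q = s
      · exact hqs ▸ (mem_inter.1 hq).1
      · exact key h hh p hp q hq hpq hqs ▸ (mem_inter.1 hp).1
    · refine le_antisymm ?_ (mem_excessEdges.1 hh).2
      by_contra! h3
      obtain ⟨p, q, r, hp, hq, hr, hpq, hpr, hqr⟩ := two_lt_card_iff.1 h3
      have hps : ¬ (p ≠ s ∧ q ≠ s) := fun h' => h'.1 (key h hh p hp q hq hpq h'.2)
      have hqs : ¬ (q ≠ s ∧ r ≠ s) := fun h' => h'.1 (key h hh q hq r hr hqr h'.2)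
      have hrs : ¬ (p ≠ s ∧ r ≠ s) := fun h' => h'.1 (key h hh p hp r hr hpr h'.2)
      grind
  have hall : ∀ w ∈ far H v, defect k H w = 0 := fun w hw => by
    by_cases h : w = s
    · rw [h, hs0]
    · exact hfull w hw h
  have hex := hH.sum_excess hv
  rw [hsum, hs0, hm] at hex
  -- Without defects `excess_of_adj` applies to every adjacent pair in `far H v`, so the excess
  -- edges intersect each other inside `far H v`.
  have hmeet : ∀ h ∈ excessEdges H v, ∀ p ∈ h ∩ far H v, ∀ q ∈ h ∩ far H v, p ≠ q →
      ∀ h' ∈ excessEdges H v, p ∉ h' → q ∈ h' := by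
    intro h hh p hp q hq hpq h' hh' hph'
    rw [mem_inter] at hp hq
    exact ((hH.excess_of_adj hv (hall p hp.2) hp.2 hq.2
      (not_mem_far_of_mem (mem_excessEdges.1 hh).1 hp.1 hq.1 hpq.symm)).2.2 h' hh' hph').1
  -- Three vertices of `far H v` on one excess edge would give every other excess edge two vertices
  -- in common with it. It would be the only one, with surplus 2, whereas the surplus is `k - 1 ≥
  -- 3`.
  have htwo : ∀ h ∈ excessEdges H v, (h ∩ far H v).card = 2 := by
    intro h hh
    refine le_antisymm ?_ (mem_excessEdges.1 hh).2
    by_contra! h3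
    obtain ⟨p, q, r, hp, hq, hr, hpq, hpr, hqr⟩ := two_lt_card_iff.1 h3
    have honly : excessEdges H v = {h} := by
      refine eq_singleton_iff_unique_mem.2 ⟨hh, fun h' hh' => ?_⟩
      have h1 := hmeet h hh p hp q hq hpq h' hh'
      have h2 := hmeet h hh p hp r hr hpr h' hh'
      have h3 := hmeet h hh q hq r hr hqr h' hh'
      rw [mem_inter] at hp hq hr
      have hhH := (mem_excessEdges.1 hh).1
      have hh'H := (mem_excessEdges.1 hh').1
      by_cases hp' : p ∈ h'
      · by_cases hq' : q ∈ h'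
        · exact hH.eq_of_mem hh'H hhH hpq hp' hq' hp.1 hq.1
        · exact hH.eq_of_mem hh'H hhH hpr hp' (h3 hq') hp.1 hr.1
      · exact hH.eq_of_mem hh'H hhH hqr (h1 hp') (h2 hp') hq.1 hr.1
    rw [honly, sum_singleton] at hex
    have := card_le_card (inter_subset_left (s₁ := h) (s₂ := far H v))
    rw [hH.uniform h (mem_excessEdges.1 hh).1] at this
    omega
  have hcard : (excessEdges H v).card + 1 = k := by
    rw [sum_congr rfl fun h hh => by rw [htwo h hh]] at hex
    simpa using hex
  -- The traces on `far H v` are pairwise intersecting pairs, hence form a star or a triangle `pqr`.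
  -- The triangle is excluded by `no_triangle`, with `w` a vertex of `far H v` outside `{v, p, q,
  -- r}`; it exists because `far H v` has `k + 1 ≥ 5` elements.
  by_contra hstar
  -- a vertex of `far H v` lies outside some excess edge
  have havoid : ∀ w ∈ far H v, ∃ h ∈ excessEdges H v, w ∉ h := by
    intro w hw
    by_contra! h
    exact hstar ⟨w, hw, h, htwo, fun x hx _ => hall x hx⟩
  obtain ⟨p, q, hpq, hgpq⟩ := card_eq_two.1 (htwo g hg)
  have hp : p ∈ g ∩ far H v := by simp [hgpq]
  have hq : q ∈ g ∩ far H v := by simp [hgpq]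
  obtain ⟨h₁, hh₁, hp₁⟩ := havoid p (mem_inter.1 hp).2
  obtain ⟨h₂, hh₂, hq₂⟩ := havoid q (mem_inter.1 hq).2
  have hq₁ := hmeet g hg p hp q hq hpq h₁ hh₁ hp₁
  have hp₂ := hmeet g hg q hq p hp hpq.symm h₂ hh₂ hq₂
  obtain ⟨r, hr, hrq⟩ := exists_mem_ne (by rw [htwo h₁ hh₁]; norm_num : 1 < (h₁ ∩ far H v).card) q
  have hr₂ : r ∈ h₂ := hmeet h₁ hh₁ q (by simp [hq₁, (mem_inter.1 hq).2]) r hr hrq.symm h₂ hh₂ hq₂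
  have hrp : r ≠ p := fun h => hp₁ (h ▸ (mem_inter.1 hr).1)
  have hpqr : ∀ h ∈ excessEdges H v, ∀ x ∈ h ∩ far H v, x = p ∨ x = q ∨ x = r := by
    intro h hh x hx
    by_contra! hne
    have hmeet2 : ∀ a ∈ far H v, ∀ b ∈ far H v, a ≠ b → x ≠ a → x ≠ b → ¬ (a ∈ h ∧ b ∈ h) := by
      rintro a ha b hb hab hxa hxb ⟨ha', hb'⟩
      have : 2 < (h ∩ far H v).card := two_lt_card.2
        ⟨a, by simp [ha, ha'], b, by simp [hb, hb'], x, hx, hab, hxa.symm, hxb.symm⟩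
      rw [htwo h hh] at this
      omega
    rw [mem_inter] at hp hq hr
    have m1 := hmeet g hg p (by simp [hp]) q (by simp [hq]) hpq h hh
    have m2 := hmeet h₁ hh₁ q (by simp [hq, hq₁]) r (by simp [hr]) hrq.symm h hh
    have m3 := hmeet h₂ hh₂ r (by simp [hr₂, hr]) p (by simp [hp, hp₂]) hrp h hh
    have n1 := hmeet2 p hp.2 q hq.2 hpq hne.1 hne.2.1
    have n2 := hmeet2 q hq.2 r hr.2 hrq.symm hne.2.1 hne.2.2
    have n3 := hmeet2 r hr.2 p hp.2 hrp hne.2.2 hne.1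
    tauto
  rw [mem_inter] at hp hq hr
  have hvne : ∀ h ∈ excessEdges H v, v ∉ h := by
    intro h hh hvh
    obtain ⟨x, hx, hxv⟩ := exists_mem_ne (one_lt_two.trans_le (mem_excessEdges.1 hh).2) v
    rw [mem_inter] at hx
    exact not_mem_far_of_mem (mem_excessEdges.1 hh).1 hvh hx.1 hxv hx.2
  obtain ⟨w, hw, hw'⟩ : ∃ w ∈ far H v, w ∉ ({v, p, q, r} : Finset V) := by
    by_contra! hsub
    have := (card_le_card hsub).trans card_le_four
    rw [hH.card_far_of_defect hv] at this
    omega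
  simp only [mem_insert, mem_singleton, not_or] at hw'
  refine hH.no_triangle hv (hall p hp.2) (hall w hw) hw hw'.1 hp.2 hq.2 hr.2 hrq.symm
    (not_mem_far_of_mem hgH hp.1 hq.1 hpq.symm)
    (not_mem_far_of_mem (mem_excessEdges.1 hh₂).1 hp₂ hr₂ hrp) fun h hh hwh => ?_
  have := hpqr h hh w (by simp [hw, hwh])
  tauto

end IsDense
end Star
end SailTuran

namespace SailTuran
open Finset

/-! ### A full-degree vertex all of whose neighbours have full degree. -/

section Centre

variable {V : Type*} [DecidableEq V] [Fintype V] {k m : ℕ} {H : Finset (Finset V)} {u v : V}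

namespace IsDense

/-- If every edge had a vertex of positive defect, the number of edges would be at most `∑ deg ·
defect ≤ k (k - 3m) < k²`. -/
lemma exists_full_edge (hH : IsDense k m H) : ∃ e ∈ H, ∀ u ∈ e, defect k H u = 0 := by
  by_contra! hne
  have h1 : H.card ≤ ∑ g ∈ H, ∑ u ∈ g, defect k H u := by
    rw [card_eq_sum_ones]
    refine sum_le_sum fun g hg => ?_
    obtain ⟨u, hu, hu'⟩ := hne g hg
    exact (Nat.one_le_iff_ne_zero.2 hu').trans
      (single_le_sum (f := defect k H) (fun _ _ => Nat.zero_le _) hu)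
  have h2 : ∑ g ∈ H, ∑ u ∈ g, defect k H u = ∑ u, deg H u * defect k H u := by
    rw [sum_comm' (t' := univ) (s' := fun u => H.filter (u ∈ ·)) (by simp)]
    exact sum_congr rfl fun u _ => by rw [sum_const, smul_eq_mul, deg]
  have h3 : ∑ u, deg H u * defect k H u ≤ k * ∑ u, defect k H u := by
    rw [mul_sum]
    exact sum_le_sum fun u _ => Nat.mul_le_mul_right _ (hH.deg_le u)
  have h4 := hH.sum_defect
  have h5 := hH.card_edges
  have h6 := hH.one_le
  have h7 : k * ∑ u, defect k H u ≤ k * k := Nat.mul_le_mul_left _ (by omega)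
  have h8 : k ^ 2 = k * k := sq k
  omega

/-- A bad edge at `o` uses up a unit of defect at a neighbour of `o`, so there are at most `k - 3m -
defect o` of them among the `k - defect o` edges at `o`. This leaves at least `3m` good ones. -/
lemma three_le_good_edges (hH : IsDense k m H) (o : V) :
    3 ≤ ((H.filter (o ∈ ·)).filter fun g => ∀ u ∈ g, u ≠ o → defect k H u = 0).card := by
  have h1 := card_filter_add_card_filter_not (s := H.filter (o ∈ ·))
    (p := fun g => ∀ u ∈ g, u ≠ o → defect k H u = 0)
  have h2 : ((H.filter (o ∈ ·)).filter fun g => ¬ ∀ u ∈ g, u ≠ o → defect k H u = 0).card ≤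
      ∑ u ∈ univ \ far H o, defect k H u := by
    rw [sum_compl_far hH.linear, card_filter]
    refine sum_le_sum fun g _ => ?_
    split_ifs with h
    · exact Nat.zero_le _
    · push Not at h
      obtain ⟨u, hu, huo, hu'⟩ := h
      exact (Nat.one_le_iff_ne_zero.2 hu').trans
        (single_le_sum (f := defect k H) (fun _ _ => Nat.zero_le _) (mem_erase.2 ⟨huo, hu⟩))
  have h3 : ∑ u ∈ univ \ far H o, defect k H u + defect k H o ≤ ∑ u, defect k H u := by
    rw [← sum_sdiff (subset_univ (far H o))]
    gcongr
    exact single_le_sum (f := defect k H) (fun _ _ => Nat.zero_le _) (mem_far_self H o)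
  have h4 := hH.deg_add_defect o
  have h5 := hH.sum_defect
  have h6 := hH.one_le
  change _ = deg H o at h1
  omega

/-- A unit of defect outside `far H v` leaves at most `k - 3m - 1` inside, so the budget `k` retains
a surplus of at least `2m + 1`. -/
lemma three_le_excess (hH : IsDense k m H) (hv : defect k H v = 0) (hu : u ∉ far H v)
    (hu0 : defect k H u ≠ 0) : 3 ≤ ∑ g ∈ excessEdges H v, ((g ∩ far H v).card - 1) := by
  have h1 := hH.sum_excess hv
  have h2 := hH.sum_defect
  have h3 : defect k H u + ∑ w ∈ far H v, defect k H w ≤ ∑ u, defect k H u := by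
    rw [← sum_insert hu]
    exact sum_le_sum_of_subset (subset_univ _)
  have := hH.one_le
  omega

lemma three_le_card_excess (hH : IsDense k m H) (hv : defect k H v = 0) (hu : u ∉ far H v)
    (hu0 : defect k H u ≠ 0) {s : V} (hs : IsStar k H v s) : 3 ≤ (excessEdges H v).card := by
  have h := hH.three_le_excess hv hu hu0
  rw [sum_congr rfl fun g hg => by rw [hs.card_inter g hg]] at h
  simpa using h

/-- Some vertex `v` of full degree is such that all neighbours of `v` have full degree. -/
lemma exists_centre (hH : IsDense k m H) :
    m = 1 ∧ ∃ v, defect k H v = 0 ∧ ∀ u, u ∉ far H v → defect k H u = 0 := by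
  have hm := hH.one_le
  have hd := hH.sum_defect
  -- For `k = 3` the total defect `k - 3m` vanishes, so every vertex is a centre.
  by_cases hk : k = 3
  · have h0 : ∑ u, defect k H u = 0 := by omega
    rw [sum_eq_zero_iff] at h0
    obtain ⟨v⟩ : Nonempty V := Fintype.card_pos_iff.1 (by rw [hH.card_vertices]; omega)
    exact ⟨by omega, v, h0 v (mem_univ v), fun u _ => h0 u (mem_univ u)⟩
  have hk4 : 4 ≤ k := by have := hH.three_le; omega
  obtain ⟨e, he, hfull⟩ := hH.exists_full_edge
  obtain ⟨x, hx⟩ : ∃ x : Fin 3 → V, ∀ u, u ∈ e ↔ ∃ i, u = x i := by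
    obtain ⟨a, b, c, -, -, -, rfl⟩ := card_eq_three.1 (hH.uniform e he)
    exact ⟨![a, b, c], fun u => by simp [Fin.exists_fin_succ]⟩
  have hxf : ∀ i, defect k H (x i) = 0 := fun i => hfull _ ((hx _).2 ⟨i, rfl⟩)
  have hcover : ∀ u, ∃ i, u ∈ far H (x i) := by
    intro u
    obtain ⟨w, hw⟩ := hH.inter_far u e he
    rw [mem_inter, hx] at hw
    obtain ⟨⟨i, rfl⟩, hw⟩ := hw
    exact ⟨i, mem_far_comm.1 hw⟩
  -- `μ u` is the number of the far sets of the three vertices of `e` that contain `u`. These sets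
  -- cover `V`, because `e` meets `far H u`, and their sizes add up to `3(k + 1)` on `3k + 1`
  -- vertices: the overlap is exactly 2, and it sits on at most two vertices, the set `O`.
  set μ : V → ℕ := fun u => ∑ i, if u ∈ far H (x i) then 1 else 0 with hμ
  have hμ1 : ∀ u, 1 ≤ μ u := by
    intro u
    obtain ⟨i, hi⟩ := hcover u
    calc 1 = if u ∈ far H (x i) then 1 else 0 := by rw [if_pos hi]
      _ ≤ μ u := single_le_sum (f := fun i => if u ∈ far H (x i) then 1 else 0)
        (fun _ _ => Nat.zero_le _) (mem_univ i)
  have hμg : ∀ A : Finset V, ∑ u ∈ A, μ u = ∑ i, (A ∩ far H (x i)).card := by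
    intro A
    rw [hμ, sum_comm]
    exact sum_congr rfl fun i _ => by rw [← card_filter, filter_mem_eq_inter]
  set O : Finset V := univ.filter fun u => 2 ≤ μ u with hO
  have htot : ∑ u, (μ u - 1) = 2 := by
    have h1 : ∑ u, μ u = 3 * (k + 1) := by
      rw [hμg, sum_const_nat (m := k + 1) fun i _ => by
        rw [univ_inter, hH.card_far_of_defect (hxf i)], card_univ, Fintype.card_fin]
    have h2 : ∑ u, μ u = ∑ u, (μ u - 1) + Fintype.card V := by
      rw [← card_univ, card_eq_sum_ones, ← sum_add_distrib]
      exact sum_congr rfl fun u _ => by have := hμ1 u; omega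
    rw [hH.card_vertices, h1] at h2
    omega
  have hOtot : ∑ u ∈ O, (μ u - 1) = 2 := by
    rw [← htot]
    refine sum_subset (subset_univ _) fun u _ hu => ?_
    simp only [hO, mem_filter, mem_univ, true_and] at hu
    omega
  have hOmem : ∀ u, u ∈ O ↔ 2 ≤ μ u := by simp [hO]
  have hO2 : O.card ≤ 2 := by
    rw [← hOtot, card_eq_sum_ones]
    exact sum_le_sum fun u hu => by rw [hOmem] at hu; omega
  have hsum3 : ∀ g ∈ H, ∑ u ∈ g, μ u = ∑ u ∈ g, (μ u - 1) + 3 := by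
    intro g hg
    rw [← hH.uniform g hg, card_eq_sum_ones, ← sum_add_distrib]
    exact sum_congr rfl fun u _ => by have := hμ1 u; omega
  -- An edge without vertices in `O` has total weight 3 and so meets each of the three far sets
  -- exactly once. An edge through a vertex of `O` has weight at least 4 and so is an excess edge of
  -- some `x i`.
  have hEO : ∀ i, ∀ g ∈ excessEdges H (x i), ∃ o ∈ O, o ∈ g := by
    intro i g hg
    rw [mem_excessEdges] at hg
    by_contra! hno
    have h1 := hsum3 g hg.1
    rw [sum_eq_zero (s := g) (f := fun u => μ u - 1), hμg] at h1
    · have h2 : ∑ j : Fin 3, 1 < ∑ j, (g ∩ far H (x j)).card :=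
        sum_lt_sum (fun j _ => hH.one_le_inter_far (x j) hg.1) ⟨i, mem_univ i, by omega⟩
      simp only [sum_const, card_univ, Fintype.card_fin, smul_eq_mul] at h2
      omega
    · intro u hu
      have : u ∉ O := fun h => hno u h hu
      rw [hOmem] at this
      omega
  have hOE : ∀ o ∈ O, ∀ g ∈ H, o ∈ g → ∃ i, g ∈ excessEdges H (x i) := by
    intro o ho g hg hog
    by_contra! hno
    have h1 := hsum3 g hg
    have h2 : μ o - 1 ≤ ∑ u ∈ g, (μ u - 1) :=
      single_le_sum (f := fun u => μ u - 1) (fun _ _ => Nat.zero_le _) hog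
    have h3 : ∑ i, (g ∩ far H (x i)).card ≤ ∑ i : Fin 3, 1 :=
      sum_le_sum fun i _ => by
        have := hno i
        rw [mem_excessEdges, not_and] at this
        have := this hg
        omega
    rw [hOmem] at ho
    rw [hμg] at h1
    simp only [sum_const, card_univ, Fintype.card_fin, smul_eq_mul] at h3
    omega
  -- That `m = 1` needs only one good edge through a vertex of `O`: it is an excess edge of some `x
  -- i`, and `exists_isStar` applies to it.
  suffices hQ : m = 1 → ∃ v, defect k H v = 0 ∧ ∀ u, u ∉ far H v → defect k H u = 0 by
    by_cases hm1 : m = 1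
    · exact ⟨hm1, hQ hm1⟩
    exfalso
    have hOne : O.Nonempty := by
      rw [nonempty_iff_ne_empty]
      intro h
      simp [h] at hOtot
    obtain ⟨o, ho⟩ := hOne
    obtain ⟨g, hg⟩ := card_pos.1 (lt_of_lt_of_le (by norm_num) (hH.three_le_good_edges o))
    simp only [mem_filter] at hg
    obtain ⟨i, hi⟩ := hOE o ho g hg.1.1 hg.1.2
    obtain ⟨w, hw, hwo⟩ := exists_mem_ne (one_lt_two.trans_le (mem_excessEdges.1 hi).2) o
    rw [mem_inter] at hw
    exact hm1 (hH.exists_isStar hk4 (hxf i) hi hw.1 hw.2 (hg.2 w hw.1 hwo)).1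
  intro hm1
  by_contra! hQ
  have hthree : ∀ i s, IsStar k H (x i) s → 3 ≤ (excessEdges H (x i)).card := by
    intro i s hs
    obtain ⟨u, hu, hu0⟩ := hQ (x i) (hxf i)
    exact hH.three_le_card_excess (hxf i) hu hu0 hs
  -- At least three edges share `s`. If `s` were not in `O`, they would contain different elements
  -- of `O`, which has at most two.
  have hcentre : ∀ i s, IsStar k H (x i) s → s ∈ O := by
    intro i s hs
    by_contra hsO
    have := hthree i s hs
    have : Nonempty V := ⟨s⟩
    choose! f hf using hEO i
    have hle := card_le_card_of_injOn (s := excessEdges H (x i)) (t := O) f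
      (fun g hg => (hf g hg).1) fun g hg g' hg' hgg' => by
        refine hH.eq_of_mem (mem_excessEdges.1 hg).1 (mem_excessEdges.1 hg').1
          (u := s) (w := f g) ?_ (hs.mem g hg) (hf g hg).2 (hs.mem g' hg') (hgg' ▸ (hf g' hg').2)
        rintro h
        exact hsO (h ▸ (hf g hg).1)
    omega
  have hstar : ∀ o ∈ O, ∀ i, ∀ g ∈ excessEdges H (x i), o ∈ g →
      (∀ u ∈ g, u ≠ o → defect k H u = 0) → ∃ s ∈ g, IsStar k H (x i) s := by
    intro o ho i g hg hog hgood
    obtain ⟨w, hw, hwo⟩ := exists_mem_ne (one_lt_two.trans_le (mem_excessEdges.1 hg).2) o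
    rw [mem_inter] at hw
    obtain ⟨-, s, hs⟩ := hH.exists_isStar hk4 (hxf i) hg hw.1 hw.2 (hgood w hw.1 hwo)
    exact ⟨s, hs.mem g hg, hs⟩
  have hthird : ∀ i j : Fin 3, i ≠ j → ∃ l, l ≠ i ∧ l ≠ j ∧ ∀ t, t = i ∨ t = j ∨ t = l := by decide
  have hμsum : ∀ i j l : Fin 3, i ≠ j → l ≠ i → l ≠ j → ∀ f : Fin 3 → ℕ,
      ∑ t, f t = f i + f j + f l := by
    intro i j l hij hli hlj f
    rw [Fin.sum_univ_three]
    fin_cases i <;> fin_cases j <;> fin_cases l <;> simp at hij hli hlj ⊢ <;> omega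
  -- two stars with centres `o₁`, `o₂` that are not both outside the third `far` set
  have hfinish : ∀ i j o₁ o₂, i ≠ j → IsStar k H (x i) o₁ → IsStar k H (x j) o₂ →
      (o₁ ≠ o₂ ∨ μ o₁ = 3) → False := by
    intro i j o₁ o₂ hij h₁ h₂ h
    obtain ⟨l, hli, hlj, hl⟩ := hthird i j hij
    -- A neighbour `u` of `x l` with positive defect is far from `x i` or `x j`, where only the
    -- centre of the star can have defect. So `u` is a centre, hence in `O`, hence in both far sets:
    -- `u = o₁ = o₂` and `μ u = 2`.
    obtain ⟨u, hul, hu0⟩ := hQ (x l) (hxf l)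
    have e1 : u ∈ far H (x i) → u = o₁ := fun hu => by
      by_contra hne; exact hu0 (h₁.defect_eq u hu hne)
    have e2 : u ∈ far H (x j) → u = o₂ := fun hu => by
      by_contra hne; exact hu0 (h₂.defect_eq u hu hne)
    have hμu : μ u = _ := hμsum i j l hij hli hlj _
    rw [if_neg hul] at hμu
    obtain ⟨t, ht⟩ := hcover u
    have h1 := (hOmem _).1 (hcentre i _ h₁)
    have h2 := (hOmem _).1 (hcentre j _ h₂)
    have hor : u = o₁ ∨ u = o₂ := by
      obtain rfl | rfl | rfl := hl t
      · exact .inl (e1 ht)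
      · exact .inr (e2 ht)
      · exact absurd ht hul
    have hu2 : 2 ≤ μ u := by
      obtain h' | h' := hor <;> rw [h'] <;> assumption
    have hui : u ∈ far H (x i) := by
      by_contra hn; rw [if_neg hn] at hμu; split_ifs at hμu <;> omega
    have huj : u ∈ far H (x j) := by
      by_contra hn; rw [if_neg hn] at hμu; split_ifs at hμu; omega
    rw [if_pos hui, if_pos huj] at hμu
    obtain h | h := h
    · exact h ((e1 hui).symm.trans (e2 huj))
    · rw [← e1 hui] at h
      omega
  -- At most one of the three or more good edges at `o` passes through the other vertex of `O`.
  have hgood : ∀ o ∈ O, ∃ g ∈ H, o ∈ g ∧ (∀ u ∈ g, u ≠ o → defect k H u = 0) ∧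
      ∀ o' ∈ O, o' ∈ g → o' = o := by
    intro o ho
    by_contra! hno
    have h3 := hH.three_le_good_edges o
    have hex : ∀ g ∈ (H.filter (o ∈ ·)).filter (fun g => ∀ u ∈ g, u ≠ o → defect k H u = 0),
        ∃ o' ∈ O.erase o, o' ∈ g := by
      intro g hg
      simp only [mem_filter] at hg
      obtain ⟨o', ho', ho'g, hne⟩ := hno g hg.1.1 hg.1.2 hg.2
      exact ⟨o', mem_erase.2 ⟨hne, ho'⟩, ho'g⟩
    have : Nonempty V := ⟨o⟩
    choose! f hf using hex
    have hle := card_le_card_of_injOn f (fun g hg => (hf g hg).1) fun g hg g' hg' hgg' => by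
      have h1 := hf g hg
      have h2 := hf g' hg'
      simp only [coe_filter, mem_filter, Set.mem_ofPred_eq] at hg hg'
      exact hH.eq_of_mem hg.1.1 hg'.1.1 (mem_erase.1 h1.1).1 h1.2 hg.1.2 (hgg' ▸ h2.2) hg'.1.2
    rw [card_erase_of_mem ho] at hle
    omega
  have hstar' : ∀ o ∈ O, ∃ i, IsStar k H (x i) o := by
    intro o ho
    obtain ⟨g, hg, hog, hgood, honly⟩ := hgood o ho
    obtain ⟨i, hi⟩ := hOE o ho g hg hog
    obtain ⟨s, hsg, hs⟩ := hstar o ho i g hi hog hgood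
    obtain rfl := honly s (hcentre i s hs) hsg
    exact ⟨i, hs⟩
  have hOne : O.Nonempty := by
    rw [nonempty_iff_ne_empty]
    intro h
    simp [h] at hOtot
  -- If `O = {o}`, then `μ o = 3` and a good edge through `o` has weight at least 5, so it is an
  -- excess edge of two of the `x i`, giving two stars with centre `o`. If `O = {o₁, o₂}`, the stars
  -- of `o₁` and `o₂` belong to different `x i`, since two edges cannot both contain `o₁` and `o₂`.
  by_cases hO1 : O.card = 1
  · obtain ⟨o, ho⟩ := card_eq_one.1 hO1
    have hoO : o ∈ O := by simp [ho]
    rw [ho, sum_singleton] at hOtot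
    obtain ⟨g, hg, hog, hgood, honly⟩ := hgood o hoO
    have hsum := hsum3 g hg
    have hge : μ o - 1 ≤ ∑ u ∈ g, (μ u - 1) :=
      single_le_sum (f := fun u => μ u - 1) (fun _ _ => Nat.zero_le _) hog
    have hst : ∀ i, 2 ≤ (g ∩ far H (x i)).card →
        (g ∩ far H (x i)).card = 2 ∧ IsStar k H (x i) o := by
      intro i hi
      have hex := mem_excessEdges.2 ⟨hg, hi⟩
      obtain ⟨s, hsg, hs⟩ := hstar o hoO i g hex hog hgood
      obtain rfl := honly s (hcentre i s hs) hsg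
      exact ⟨hs.card_inter g hex, hs⟩
    rw [hμg, Fin.sum_univ_three] at hsum
    have h0 := hst 0
    have h1 := hst 1
    have h2 := hst 2
    by_cases c0 : 2 ≤ (g ∩ far H (x 0)).card <;> by_cases c1 : 2 ≤ (g ∩ far H (x 1)).card
    · exact hfinish 0 1 o o (by decide) (h0 c0).2 (h1 c1).2 (.inr (by omega))
    · have := (h0 c0).1
      have c2 : 2 ≤ (g ∩ far H (x 2)).card := by omega
      exact hfinish 0 2 o o (by decide) (h0 c0).2 (h2 c2).2 (.inr (by omega))
    · have := (h1 c1).1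
      have c2 : 2 ≤ (g ∩ far H (x 2)).card := by omega
      exact hfinish 1 2 o o (by decide) (h1 c1).2 (h2 c2).2 (.inr (by omega))
    · by_cases c2 : 2 ≤ (g ∩ far H (x 2)).card
      · have := (h2 c2).1
        omega
      · omega
  · obtain ⟨o₁, ho₁, o₂, ho₂, hne⟩ := one_lt_card.1
      (lt_of_le_of_ne (Nat.one_le_iff_ne_zero.2 (card_pos.2 hOne).ne') (Ne.symm hO1))
    obtain ⟨i, hi⟩ := hstar' o₁ ho₁
    obtain ⟨j, hj⟩ := hstar' o₂ ho₂
    refine hfinish i j o₁ o₂ ?_ hi hj (.inl hne)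
    rintro rfl
    obtain ⟨g, hg, g', hg', hgg'⟩ := one_lt_card.1
      (lt_of_lt_of_le (by norm_num) (hthree i o₁ hi))
    exact hgg' (hH.eq_of_mem (mem_excessEdges.1 hg).1 (mem_excessEdges.1 hg').1 hne
      (hi.mem g hg) (hj.mem g hg) (hi.mem g' hg') (hj.mem g' hg'))

end IsDense
end Centre
end SailTuran

namespace SailTuran
open Finset

/-! ### Splitting the neighbours of a centre into two halves. -/

section Split

variable {V : Type*} [DecidableEq V] [Fintype V] {k : ℕ} {H : Finset (Finset V)}

/-- An edge `{v, w, w'}` such that the neighbours of `v` have full degree and are partitioned into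
`X` and `Y`, where `far H w` is `X` with a vertex `t` of `far H v` added, and `far H w'` is `Y`
with a vertex `t'` of `far H v` added. -/
structure IsSplit (k : ℕ) (H : Finset (Finset V)) (v w w' t t' : V) (X Y : Finset V) : Prop where
  defect_centre : defect k H v = 0
  defect_compl : ∀ u, u ∉ far H v → defect k H u = 0
  edge : {v, w, w'} ∈ H
  far_left : far H w = insert t X
  far_right : far H w' = insert t' Y
  mem_left : t ∈ far H v
  mem_right : t' ∈ far H v
  not_mem_left : ∀ u ∈ X, u ∉ far H v
  not_mem_right : ∀ u ∈ Y, u ∉ far H v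
  cover : ∀ u, u ∉ far H v → u ∈ X ∨ u ∈ Y
  disj : Disjoint X Y
  card_left : X.card = k
  card_right : Y.card = k

lemma IsSplit.symm {v w w' t t' : V} {X Y : Finset V} (h : IsSplit k H v w w' t t' X Y) :
    IsSplit k H v w' w t' t Y X where
  defect_centre := h.defect_centre
  defect_compl := h.defect_compl
  edge := by rw [pair_comm]; exact h.edge
  far_left := h.far_right
  far_right := h.far_left
  mem_left := h.mem_right
  mem_right := h.mem_left
  not_mem_left := h.not_mem_right
  not_mem_right := h.not_mem_left
  cover := fun u hu => (h.cover u hu).symm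
  disj := h.disj.symm
  card_left := h.card_right
  card_right := h.card_left

namespace IsDense

/-- All of the defect, `k - 3` in total, lies in `far H v`; with `m = 1` the budget leaves 2. -/
lemma sum_excess_of_centre {v : V} (hH : IsDense k 1 H) (hv : defect k H v = 0)
    (hQ : ∀ u, u ∉ far H v → defect k H u = 0) :
    ∑ g ∈ excessEdges H v, ((g ∩ far H v).card - 1) = 2 := by
  have h1 := hH.sum_excess hv
  have h2 := hH.sum_defect
  have h3 : ∑ u ∈ far H v, defect k H u = ∑ u, defect k H u :=
    sum_subset (subset_univ _) fun u _ hu => hQ u hu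
  omega

lemma exists_isSplit {v : V} (hH : IsDense k 1 H) (hv : defect k H v = 0)
    (hQ : ∀ u, u ∉ far H v → defect k H u = 0) :
    ∃ w w' t t' X Y, IsSplit k H v w w' t t' X Y := by
  have hk := hH.three_le
  have hex := hH.sum_excess_of_centre hv hQ
  have hexc : (excessEdges H v).card ≤ 2 := by
    rw [← hex, card_eq_sum_ones]
    refine sum_le_sum fun g hg => ?_
    have := (mem_excessEdges.1 hg).2
    omega
  -- some edge at `v` avoids all excess edges
  obtain ⟨e, he, hve, hclean⟩ : ∃ e ∈ H, v ∈ e ∧ ∀ u ∈ e, u ≠ v → ∀ g ∈ excessEdges H v, u ∉ g := by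
    by_contra! hno
    have : ∀ e ∈ H.filter (v ∈ ·), ∃ g, g ∈ excessEdges H v ∧ ∃ u ∈ e, u ≠ v ∧ u ∈ g := by
      intro e he
      rw [mem_filter] at he
      obtain ⟨u, hu, huv, g, hg, hug⟩ := hno e he.1 he.2
      exact ⟨g, hg, u, hu, huv, hug⟩
    choose! f hf using this
    -- An excess edge has at most one vertex outside `far H v`, so it spoils at most one edge at
    -- `v`. There are at most two excess edges, but `k ≥ 3` edges at `v`.
    have hle := card_le_card_of_injOn f (fun e he => (hf e he).1) fun e he e' he' hee' => by
      obtain ⟨hg, u, hu, huv, hug⟩ := hf e he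
      obtain ⟨-, u', hu', huv', hug'⟩ := hf e' he'
      rw [← hee'] at hug'
      simp only [coe_filter, Set.mem_ofPred_eq] at he he'
      have hufar := not_mem_far_of_mem he.1 he.2 hu huv
      have hufar' := not_mem_far_of_mem he'.1 he'.2 hu' huv'
      rw [mem_excessEdges] at hg
      have huu' : u = u' := by
        by_contra hne
        have h1 : ({u, u'} : Finset V) ⊆ f e \ far H v := by
          simp [insert_subset_iff, hug, hug', hufar, hufar']
        have h2 := card_le_card h1
        have h3 := card_sdiff_add_card_inter (f e) (far H v)
        rw [card_pair hne] at h2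
        rw [hH.uniform _ hg.1] at h3
        omega
      exact hH.eq_of_mem he.1 he'.1 huv hu he.2 (huu' ▸ hu') he'.2
    have hd : (H.filter (v ∈ ·)).card = k := hH.deg_eq_of_defect hv
    omega
  -- Each of the `k` edges at `u` meets `far H v` exactly once, so `u` has `k` neighbours among the
  -- `k + 1` vertices of `far H v`. The remaining vertex is `t`.
  have hone : ∀ u ∈ e, u ≠ v → ∃ t, t ∈ far H v ∧ far H u = insert t (far H u \ far H v) ∧
      (far H u \ far H v).card = k := by
    intro u hu huv
    have hufar := not_mem_far_of_mem he hve hu huv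
    have h1 : (far H v \ far H u).card = k := by
      rw [card_sdiff_far hH.linear, sum_const_nat (m := 1)]
      · rw [mul_one]
        exact hH.deg_eq_of_defect (hQ u hufar)
      · intro g hg
        rw [mem_filter] at hg
        rw [erase_eq_of_notMem (by simp [hufar])]
        have h1 := hH.one_le_inter_far v hg.1
        have h2 : ¬ 2 ≤ (g ∩ far H v).card := fun h =>
          hclean u hu huv g (mem_excessEdges.2 ⟨hg.1, h⟩) hg.2
        omega
    have h2 := card_sdiff_add_card_inter (far H v) (far H u)
    have h3 := hH.card_far_of_defect hv
    have h4 := hH.card_far_of_defect (hQ u hufar)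
    have h5 := card_sdiff_add_card_inter (far H u) (far H v)
    rw [inter_comm] at h5
    obtain ⟨t, ht⟩ := card_eq_one.1 (show (far H v ∩ far H u).card = 1 by omega)
    have htmem : t ∈ far H v ∩ far H u := by simp [ht]
    refine ⟨t, (mem_inter.1 htmem).1, ?_, by omega⟩
    conv_lhs => rw [← sdiff_union_inter (far H u) (far H v), inter_comm, ht]
    rw [insert_eq, union_comm]
  obtain ⟨w, w', hvw, hvw', hww', rfl⟩ : ∃ w w', v ≠ w ∧ v ≠ w' ∧ w ≠ w' ∧ e = {v, w, w'} := by
    obtain ⟨w, hw, hwv⟩ := exists_mem_ne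
      (by rw [hH.uniform e he]; norm_num : 1 < e.card) v
    obtain ⟨w', h1, h2, h3⟩ := exists_third (hH.uniform e he) hve hw hwv.symm
    exact ⟨w, w', hwv.symm, h1.symm, h2.symm, h3⟩
  obtain ⟨t, ht, hfw, hXc⟩ := hone w (by simp) hvw.symm
  obtain ⟨t', ht', hfw', hYc⟩ := hone w' (by simp) hvw'.symm
  have hcover : ∀ u, u ∉ far H v → u ∈ far H w \ far H v ∨ u ∈ far H w' \ far H v := by
    intro u hu
    obtain ⟨z, hz⟩ := hH.inter_far u _ he
    simp only [mem_inter, mem_insert, mem_singleton] at hz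
    obtain ⟨rfl | rfl | rfl, hz⟩ := hz
    · exact absurd (mem_far_comm.1 hz) hu
    · exact .inl (mem_sdiff.2 ⟨mem_far_comm.1 hz, hu⟩)
    · exact .inr (mem_sdiff.2 ⟨mem_far_comm.1 hz, hu⟩)
  refine ⟨w, w', t, t', far H w \ far H v, far H w' \ far H v, hv, hQ, he, hfw, hfw', ht, ht',
    fun u hu => (mem_sdiff.1 hu).2, fun u hu => (mem_sdiff.1 hu).2, hcover, ?_, hXc, hYc⟩
  -- Two sets of size `k` that cover the `2k` neighbours of `v` are disjoint.
  rw [← card_union_eq_card_add_card]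
  have hun : (far H w \ far H v) ∪ (far H w' \ far H v) = univ \ far H v := by
    ext u
    refine ⟨fun hu => ?_, fun hu => mem_union.2 (hcover u (mem_sdiff.1 hu).2)⟩
    rw [mem_union, mem_sdiff, mem_sdiff] at hu
    exact mem_sdiff.2 ⟨mem_univ u, by tauto⟩
  rw [hun, hXc, hYc, card_sdiff_of_subset (subset_univ _), card_univ, hH.card_vertices,
    hH.card_far_of_defect hv]
  omega

/-- Such an edge would be an excess edge of `w'` with full-degree vertices, so `w'` has a star,
centred at a vertex `s` of `Y`; then `far H w'` has no defect and the star has `k - 1 ≥ 3` edges.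
But each of them contains `t` or `t'`: otherwise it has two vertices in `Y`, one in `X` and one in
`far H v`. As these edges already share `s`, there are at most two. -/
lemma card_inter_right_le {v w w' t t' : V} {X Y : Finset V} (hH : IsDense k 1 H) (hk : 4 ≤ k)
    (hS : IsSplit k H v w w' t t' X Y) {g : Finset V} (hg : g ∈ H) : (g ∩ Y).card ≤ 1 := by
  by_contra! h2
  obtain ⟨p, hp, q, hq, hpq⟩ := one_lt_card.1 h2
  rw [mem_inter] at hp hq
  have hYfar : ∀ u ∈ Y, u ∈ far H w' := fun u hu => by rw [hS.far_right]; exact mem_insert_of_mem hu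
  have hw' : defect k H w' = 0 := by
    refine hS.defect_compl w' (not_mem_far_of_mem hS.edge (by simp) (by simp) ?_)
    rintro rfl
    have := hH.uniform _ hS.edge
    have h3 : ({w', w, w'} : Finset V).card ≤ 2 := by
      rw [insert_eq_of_mem (by simp)]; exact card_le_two
    omega
  have hgex := excess_of_mem hg hpq hp.1 hq.1 (hYfar p hp.2) (hYfar q hq.2)
  obtain ⟨-, s, hs⟩ := hH.exists_isStar hk hw' hgex hp.1 (hYfar p hp.2)
    (hS.defect_compl p (hS.not_mem_right p hp.2))
  have hgpq : g ∩ far H w' = {p, q} := by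
    refine (eq_of_subset_of_card_le ?_ ?_).symm
    · simp [insert_subset_iff, hp.1, hq.1, hYfar p hp.2, hYfar q hq.2]
    · rw [hs.card_inter g hgex, card_pair hpq]
  have hsY : s ∈ Y := by
    have : s ∈ g ∩ far H w' := mem_inter.2 ⟨hs.mem g hgex, hs.mem_far⟩
    rw [hgpq, mem_insert, mem_singleton] at this
    obtain rfl | rfl := this
    exacts [hp.2, hq.2]
  have hsum : ∑ u ∈ far H w', defect k H u = 0 := by
    refine sum_eq_zero fun u hu => ?_
    by_cases hus : u = s
    · rw [hus]; exact hS.defect_compl s (hS.not_mem_right s hsY)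
    · exact hs.defect_eq u hu hus
  have hex := hH.sum_excess hw'
  rw [hsum, sum_congr rfl fun h hh => by rw [hs.card_inter h hh]] at hex
  simp only [Nat.add_one_sub_one, sum_const, smul_eq_mul, mul_one, add_zero] at hex
  have htt' : ∀ h ∈ excessEdges H w', ∃ x ∈ ({t, t'} : Finset V), x ∈ h := by
    intro h hh
    by_contra! hno
    simp only [mem_insert, mem_singleton, forall_eq_or_imp, forall_eq] at hno
    have hhH := (mem_excessEdges.1 hh).1
    obtain ⟨a, ha, b, hb, hab⟩ := one_lt_card.1 (mem_excessEdges.1 hh).2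
    rw [mem_inter, hS.far_right, mem_insert] at ha hb
    have haY : a ∈ Y := ha.2.resolve_left fun h' => hno.2 (h' ▸ ha.1)
    have hbY : b ∈ Y := hb.2.resolve_left fun h' => hno.2 (h' ▸ hb.1)
    obtain ⟨z, hz⟩ := hH.inter_far v h hhH
    obtain ⟨y, hy⟩ := hH.inter_far w h hhH
    rw [mem_inter] at hz hy
    rw [hS.far_left, mem_insert] at hy
    have hyX : y ∈ X := hy.2.resolve_left fun h' => hno.1 (h' ▸ hy.1)
    have h1 : ({a, b, z, y} : Finset V) ⊆ h := by simp [insert_subset_iff, ha.1, hb.1, hz.1, hy.1]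
    have h2 := card_le_card h1
    have hdisj : ∀ c ∈ Y, c ≠ y := fun c hc h' => disjoint_left.1 hS.disj hyX (h' ▸ hc)
    have hza : ∀ c ∈ Y, c ≠ z := fun c hc h' => hS.not_mem_right c hc (h' ▸ hz.2)
    have hzy : z ≠ y := fun h' => hS.not_mem_left y hyX (h' ▸ hz.2)
    rw [hH.uniform h hhH, card_insert_of_notMem, card_insert_of_notMem, card_pair hzy] at h2
    · omega
    · simp [hza b hbY, hdisj b hbY]
    · simp [hab, hza a haY, hdisj a haY]
  have : Nonempty V := ⟨s⟩
  choose! f hf using htt'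
  have hle := card_le_card_of_injOn f (fun h hh => (hf h hh).1) fun h hh h' hh' hhh' => by
    have h1 := hf h hh
    have h2 := hf h' hh'
    refine hH.eq_of_mem (mem_excessEdges.1 hh).1 (mem_excessEdges.1 hh').1 (u := s) (w := f h)
      ?_ (hs.mem h hh) h1.2 (hs.mem h' hh') (hhh' ▸ h2.2)
    intro h'
    have h3 := h1.1
    rw [← h', mem_insert, mem_singleton] at h3
    obtain rfl | rfl := h3
    · exact hS.not_mem_right _ hsY hS.mem_left
    · exact hS.not_mem_right _ hsY hS.mem_right
  have := card_le_two (a := t) (b := t')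
  omega

end IsDense
end Split
end SailTuran

namespace SailTuran
open Finset

/-! ### The exceptional case `k = 3`: finding a prism. -/

section Prism

variable {V : Type*} [DecidableEq V] [Fintype V] {H : Finset (Finset V)}

lemma injective_vec_three {α : Type*} {a b c : α} (hab : a ≠ b) (hac : a ≠ c) (hbc : b ≠ c) :
    Function.Injective ![a, b, c] := by
  intro i j h
  fin_cases i <;> fin_cases j <;> simp_all

lemma injective_vec_four {α : Type*} {a b c d : α} (hab : a ≠ b) (hac : a ≠ c) (had : a ≠ d)
    (hbc : b ≠ c) (hbd : b ≠ d) (hcd : c ≠ d) : Function.Injective ![a, b, c, d] := by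
  intro i j h
  fin_cases i <;> fin_cases j <;> simp_all

/-- The edges `{P i, Q i, v}` together with three edges that extend the sides of the triangle `P`
by the vertices `R i`, which are not neighbours of `v`. -/
structure IsPrismSystem (H : Finset (Finset V)) (P Q R : Fin 3 → V) (v : V) : Prop where
  bij : Function.Bijective (Sum.elim (Sum.elim P Q) ![R 0, R 1, R 2, v])
  spoke : ∀ i, {P i, Q i, v} ∈ H
  side : ∀ i j l, i ≠ j → i ≠ l → j ≠ l → {P i, P j, R l} ∈ H
  mem_far : ∀ i, R i ∈ far H v

set_option maxHeartbeats 1000000 in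
/-- An edge with two vertices in `Y` gives rise to a prism. -/
lemma IsDense.exists_isPrismSystem {v w w' t t' : V} {X Y : Finset V} (hH : IsDense 3 1 H)
    (hS : IsSplit 3 H v w w' t t' X Y) {g : Finset V} (hg : g ∈ H) (hgY : 1 < (g ∩ Y).card) :
    ∃ P Q R, IsPrismSystem H P Q R v := by
  obtain ⟨p, hp, q, hq, hpq⟩ := one_lt_card.1 hgY
  rw [mem_inter] at hp hq
  have hY : ∀ u ∈ Y, u ∈ far H w' := fun u hu => by rw [hS.far_right]; exact mem_insert_of_mem hu
  have hX : ∀ u ∈ X, u ∈ far H w := fun u hu => by rw [hS.far_left]; exact mem_insert_of_mem hu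
  have hdist : v ≠ w ∧ v ≠ w' ∧ w ≠ w' := by
    have h3 := hH.uniform _ hS.edge
    refine ⟨?_, ?_, ?_⟩ <;> rintro rfl
    · rw [insert_eq_of_mem (by simp)] at h3
      have := card_le_two (a := v) (b := w'); omega
    · rw [insert_eq_of_mem (by simp)] at h3
      have := card_le_two (a := w) (b := v); omega
    · rw [pair_eq_singleton] at h3
      have := card_le_two (a := v) (b := w); omega
  obtain ⟨hvw, hvw', hww'⟩ := hdist
  have hwv : w ∉ far H v := not_mem_far_of_mem hS.edge (by simp) (by simp) hvw.symm
  have hw'v : w' ∉ far H v := not_mem_far_of_mem hS.edge (by simp) (by simp) hvw'.symm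
  have hpv := hS.not_mem_right p hp.2
  have hqv := hS.not_mem_right q hq.2
  have hXY : ∀ a ∈ X, ∀ b ∈ Y, a ≠ b := fun a ha b hb h => disjoint_left.1 hS.disj ha (h ▸ hb)
  have hw'Y : w' ∈ Y := by
    have := mem_far_self H w'
    rw [hS.far_right, mem_insert] at this
    exact this.resolve_left fun h => hw'v (h ▸ hS.mem_right)
  have hwX : w ∈ X := by
    have := mem_far_self H w
    rw [hS.far_left, mem_insert] at this
    exact this.resolve_left fun h => hwv (h ▸ hS.mem_left)
  have hpw : w ≠ p := hXY w hwX p hp.2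
  have hqw : w ≠ q := hXY w hwX q hq.2
  have hpw' : p ≠ w' := by
    rintro rfl; exact not_mem_far_of_mem hg hp.1 hq.1 hpq.symm (hY q hq.2)
  have hqw' : q ≠ w' := by
    rintro rfl; exact not_mem_far_of_mem hg hq.1 hp.1 hpq (hY p hp.2)
  have hvnot : ∀ u, u ∉ far H v → v ≠ u := fun u hu h => hu (h ▸ mem_far_self H v)
  -- a vertex of an edge with two vertices outside `far H v` lies in `far H v`
  have hthird : ∀ a b c, {a, b, c} ∈ H → a ∉ far H v → b ∉ far H v → c ∈ far H v := by
    intro a b c h ha hb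
    obtain ⟨z, hz⟩ := hH.inter_far v _ h
    simp only [mem_inter, mem_insert, mem_singleton] at hz
    obtain ⟨rfl | rfl | rfl, hz⟩ := hz
    exacts [absurd hz ha, absurd hz hb, hz]
  -- The third vertex of `g` is in `far H v` because `p` and `q` are not, and `g` has to meet `far H
  -- w = X ∪ {t}`.
  have hgt : {p, q, t} ∈ H := by
    obtain ⟨r, hrp, hrq, rfl⟩ := exists_third (hH.uniform g hg) hp.1 hq.1 hpq
    have hr := hthird p q r hg hpv hqv
    obtain ⟨z, hz⟩ := hH.inter_far w _ hg
    rw [mem_inter, hS.far_left, mem_insert (s := X)] at hz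
    have : r = t := by
      obtain ⟨hz, hzt | hzX⟩ := hz
      · simp only [mem_insert, mem_singleton] at hz
        obtain rfl | rfl | rfl := hz
        · exact absurd (hzt ▸ hS.mem_left) hpv
        · exact absurd (hzt ▸ hS.mem_left) hqv
        · exact hzt
      · simp only [mem_insert, mem_singleton] at hz
        obtain rfl | rfl | rfl := hz
        · exact absurd rfl (hXY z hzX z hp.2)
        · exact absurd rfl (hXY z hzX z hq.2)
        · exact absurd hr (hS.not_mem_left z hzX)
    exact this ▸ hg
  have htw : t ∈ far H w := by rw [hS.far_left]; exact mem_insert_self _ _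
  have hvt : v ≠ t := by
    rintro rfl
    exact not_mem_far_of_mem hS.edge (by simp) (by simp) hvw htw
  -- an edge through `w` and a vertex of `Y` other than `w'`
  have hside : ∀ y ∈ Y, y ≠ w' → ∃ s, {w, y, s} ∈ H ∧ s ∈ far H v ∧ s ≠ t ∧ v ≠ s := by
    intro y hy hyw'
    have hyv := hS.not_mem_right y hy
    have hyw : y ∉ far H w := by
      rw [hS.far_left, mem_insert, not_or]
      exact ⟨fun h => hyv (h ▸ hS.mem_left), fun h => hXY y h y hy rfl⟩
    obtain ⟨hne, e, he, hwe, hye⟩ := not_mem_far.1 hyw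
    obtain ⟨s, hsw, hsy, rfl⟩ := exists_third (hH.uniform e he) hwe hye hne.symm
    refine ⟨s, he, hthird w y s he hwv hyv, ?_, ?_⟩
    · rintro rfl
      exact not_mem_far_of_mem he (by simp) (by simp) hsw htw
    · rintro rfl
      have := hH.eq_of_mem he hS.edge hvw.symm (by simp) (by simp) (by simp) (by simp)
      have hy' : y ∈ ({v, w, w'} : Finset V) := by rw [← this]; simp
      simp only [mem_insert, mem_singleton] at hy'
      obtain h | h | h := hy'
      exacts [hsy h.symm, hne h, hyw' h]
  obtain ⟨t₁, ht₁, ht₁v, ht₁t, hvt₁⟩ := hside p hp.2 hpw'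
  obtain ⟨t₂, ht₂, ht₂v, ht₂t, hvt₂⟩ := hside q hq.2 hqw'
  have ht₁₂ : t₁ ≠ t₂ := by
    rintro rfl
    have hwt : w ≠ t₁ := fun h => hwv (h ▸ ht₁v)
    have := hH.eq_of_mem ht₁ ht₂ hwt (by simp) (by simp) (by simp) (by simp)
    have hp' : p ∈ ({w, q, t₁} : Finset V) := by rw [← this]; simp
    simp only [mem_insert, mem_singleton] at hp'
    obtain h | h | h := hp'
    exacts [hpw h.symm, hpq h, hpv (h ▸ ht₁v)]
  -- the edge through `v` and a vertex of `Y` other than `w'`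
  have hspoke : ∀ y z, y ∉ far H v → {y, z, t} ∈ H → y ≠ z → y ≠ w → y ≠ w' → z ∉ far H v →
      ∃ x, {y, x, v} ∈ H ∧ x ∉ far H v ∧ x ≠ w ∧ x ≠ w' ∧ x ≠ y ∧ x ≠ z := by
    intro y z hyv hyz hne hyw hyw' hzv
    obtain ⟨hne', e, he, hve, hye⟩ := not_mem_far.1 hyv
    obtain ⟨x, hxy, hxv, rfl⟩ := exists_third (hH.uniform e he) hye hve hne'
    have hxnot : x ∉ far H v := not_mem_far_of_mem he (by simp) (by simp) hxv
    have key : ∀ a, a = w ∨ a = w' → x ≠ a := by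
      rintro a ha rfl
      have := hH.eq_of_mem he hS.edge hxv.symm (by simp) (by simp) (by simp)
        (by obtain rfl | rfl := ha <;> simp)
      have hy' : y ∈ ({v, w, w'} : Finset V) := by rw [← this]; simp
      simp only [mem_insert, mem_singleton] at hy'
      obtain h | h | h := hy'
      exacts [hne' h, hyw h, hyw' h]
    refine ⟨x, by rwa [pair_comm x v], hxnot, key w (.inl rfl), key w' (.inr rfl), hxy, ?_⟩
    rintro rfl
    have := hH.eq_of_mem he hyz hne (by simp) (by simp) (by simp) (by simp)
    have hv' : v ∈ ({y, x, t} : Finset V) := by rw [← this]; simp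
    simp only [mem_insert, mem_singleton] at hv'
    obtain h | h | h := hv'
    exacts [hne' h.symm, hxv h.symm, hvt h]
  obtain ⟨x₁, hx₁, hx₁v, hx₁w, hx₁w', hx₁p, hx₁q⟩ := hspoke p q hpv hgt hpq hpw.symm hpw' hqv
  obtain ⟨x₂, hx₂, hx₂v, hx₂w, hx₂w', hx₂q, hx₂p⟩ :=
    hspoke q p hqv (by rwa [insert_comm]) hpq.symm hqw.symm hqw' hpv
  have hx₁₂ : x₁ ≠ x₂ := by
    rintro rfl
    have := hH.eq_of_mem hx₁ hx₂ (hvnot x₁ hx₁v) (by simp) (by simp) (by simp) (by simp)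
    have hp' : p ∈ ({q, x₁, v} : Finset V) := by rw [← this]; simp
    simp only [mem_insert, mem_singleton] at hp'
    obtain h | h | h := hp'
    exacts [hpq h, hx₁p h.symm, hvnot p hpv h.symm]
  have hfar : ∀ i, ![t, t₂, t₁, v] i ∈ far H v := by
    intro i; fin_cases i
    exacts [hS.mem_left, ht₂v, ht₁v, mem_far_self H v]
  have hnfar : ∀ i, Sum.elim ![w, p, q] ![w', x₁, x₂] i ∉ far H v := by
    rintro (i | i) <;> fin_cases i
    exacts [hwv, hpv, hqv, hw'v, hx₁v, hx₂v]
  have hinj : Function.Injective (Sum.elim (Sum.elim ![w, p, q] ![w', x₁, x₂]) ![t, t₂, t₁, v]) := by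
    refine Function.Injective.sumElim (Function.Injective.sumElim ?_ ?_ ?_) ?_ ?_
    · exact injective_vec_three hpw hqw hpq
    · exact injective_vec_three hx₁w'.symm hx₂w'.symm hx₁₂
    · intro i j
      fin_cases i <;> fin_cases j
      exacts [hww', hx₁w.symm, hx₂w.symm, hpw', hx₁p.symm, hx₂p.symm, hqw', hx₁q.symm, hx₂q.symm]
    · exact injective_vec_four ht₂t.symm ht₁t.symm hvt.symm ht₁₂.symm hvt₂.symm hvt₁.symm
    · intro i j h
      exact hnfar i (h ▸ hfar j)
  -- `R i` extends the side opposite to `P i`: the sides `pq`, `wq`, `wp` are extended by `t`, `t₂`,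
  -- `t₁`.
  refine ⟨![w, p, q], ![w', x₁, x₂], ![t, t₂, t₁], ?_, ?_, ?_, ?_⟩
  · rw [Fintype.bijective_iff_injective_and_card]
    refine ⟨hinj, ?_⟩
    rw [hH.card_vertices]; simp
  · intro i; fin_cases i
    · show {w, w', v} ∈ H
      rw [pair_comm, insert_comm]; exact hS.edge
    · exact hx₁
    · exact hx₂
  · intro i j l
    fin_cases i <;> fin_cases j <;> fin_cases l <;> simp [hgt, ht₁, ht₂, insert_comm p w,
      insert_comm q w, insert_comm q p]
  · intro i; fin_cases i
    exacts [hS.mem_left, ht₂v, ht₁v]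

end Prism
end SailTuran

namespace SailTuran
open Finset

/-! ### Transport of hypergraphs along bijections. -/

section Relabel

variable {U V W : Type*}

/-- The hypergraph `H` with its vertices renamed along `E`. -/
def relabel (E : U ≃ V) (H : Finset (Finset U)) : Finset (Finset V) :=
  H.map (mapEmbedding E.toEmbedding).toEmbedding

lemma mem_relabel {E : U ≃ V} {H : Finset (Finset U)} {e : Finset V} :
    e ∈ relabel E H ↔ ∃ f ∈ H, f.map E.toEmbedding = e := by
  simp [relabel, mapEmbedding_apply]

lemma card_relabel (E : U ≃ V) (H : Finset (Finset U)) : (relabel E H).card = H.card := card_map _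

lemma IsLinearFree.relabel [DecidableEq U] [DecidableEq V] {r : ℕ} {F : Finset (Finset W)}
    {H : Finset (Finset U)} (h : IsLinearFree r F H) (E : U ≃ V) :
    IsLinearFree r F (relabel E H) := by
  refine ⟨fun e he => ?_, fun e he f hf hef => ?_, ?_⟩
  · obtain ⟨e', he', rfl⟩ := mem_relabel.1 he
    rw [card_map]; exact h.1 e' he'
  · obtain ⟨e', he', rfl⟩ := mem_relabel.1 he
    obtain ⟨f', hf', rfl⟩ := mem_relabel.1 hf
    rw [← map_inter, card_map]
    exact h.2.1 e' he' f' hf' fun h' => hef (h' ▸ rfl)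
  · rintro ⟨φ, hφ⟩
    refine h.2.2 ⟨φ.trans E.symm.toEmbedding, fun e he => ?_⟩
    obtain ⟨f, hf, hfe⟩ := mem_relabel.1 (hφ e he)
    have : e.map (φ.trans E.symm.toEmbedding) = f := by
      rw [← map_map, ← hfe, map_map]
      convert map_refl
      ext u; simp
    rwa [this]

end Relabel

/-! ### Ten-vertex models of Constructions 3 and 4. -/

section Models

/-- The vertices `x₁, x₂, x₃, y₁, y₂, y₃` and `a, b, c, v`. -/
abbrev TenVertices : Type := SixVertices ⊕ Fin 4

/-- The third construction, where the side of the triangle of the `x i` opposite to `x i` is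
extended by the `i`-th of the vertices `a, b, c`, and the side of the other triangle opposite to
`y i` by the `s i`-th of them. -/
def modelThree (s : Fin 3 → Fin 3) : Finset (Finset TenVertices) :=
  (univ.image fun i => {.inl (x i), .inl (y i), .inr 3}) ∪
  (univ.image fun i => {.inl (x (i + 1)), .inl (x (i + 2)), .inr i.castSucc}) ∪
  (univ.image fun i => {.inl (y (i + 1)), .inl (y (i + 2)), .inr (s i).castSucc}) ∪
  {{.inr 0, .inr 1, .inr 2}}

/-- The fourth construction, where `v` extends the pairs `x i, y (s i)`. -/
def modelFour (s : Fin 3 → Fin 3) : Finset (Finset TenVertices) :=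
  (univ.image fun i => {.inl (x i), .inl (y (s i)), .inr 3}) ∪
  {{.inl (y 0), .inl (y 1), .inr 0}, {.inl (x 0), .inl (x 1), .inr 0},
    {.inl (x 1), .inl (x 2), .inr 1}, {.inl (y 0), .inl (y 2), .inr 2},
    {.inl (x 0), .inl (x 2), .inr 2}, {.inr 0, .inr 1, .inl (y 2)},
    {.inr 1, .inr 2, .inl (y 1)}}

/-- A form of linearity and sail-freeness that `decide` can evaluate on the ten-vertex models. -/
lemma isLinearFree_of_forall {V : Type*} [DecidableEq V] [Fintype V] {H : Finset (Finset V)}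
    (h₁ : ∀ e ∈ H, e.card = 3) (h₂ : ∀ u w, u ≠ w → (H.filter fun e => u ∈ e ∧ w ∈ e).card ≤ 1)
    (h₃ : ∀ v, ∀ g ∈ H, ∃ u ∈ g, ∀ e ∈ H, v ∈ e → u ∈ e → u = v) : IsLinearFree 3 sail H := by
  refine ⟨h₁, isLinear_iff.2 fun e he f hf u w huw hue hwe huf hwf => ?_,
    not_containsCopy_sail fun v g hg => ?_⟩
  · exact card_le_one.1 (h₂ u w huw) e (by simp [he, hue, hwe]) f (by simp [hf, huf, hwf])
  · obtain ⟨u, hu, hu'⟩ := h₃ v g hg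
    exact ⟨u, mem_inter.2 ⟨hu, mem_far.2 hu'⟩⟩

lemma card_eq_of_mem_modelThree (s : Fin 3 → Fin 3) : ∀ e ∈ modelThree s, e.card = 3 := by
  intro e he
  simp only [modelThree, mem_union, mem_image, mem_univ, true_and, mem_singleton] at he
  obtain ((⟨i, rfl⟩ | ⟨i, rfl⟩) | ⟨i, rfl⟩) | rfl := he
  · rfl
  · fin_cases i <;> rfl
  · fin_cases i <;> rfl
  · rfl

lemma card_eq_of_mem_modelFour (s : Fin 3 → Fin 3) : ∀ e ∈ modelFour s, e.card = 3 := by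
  intro e he
  simp only [modelFour, mem_union, mem_image, mem_univ, true_and, mem_insert, mem_singleton] at he
  obtain ⟨i, rfl⟩ | rfl | rfl | rfl | rfl | rfl | rfl | rfl := he <;> rfl

lemma injective_fin_three (s : Fin 3 → Fin 3) (hs : Function.Injective s) :
    s = ![0, 1, 2] ∨ s = ![0, 2, 1] ∨ s = ![1, 0, 2] ∨ s = ![1, 2, 0] ∨ s = ![2, 0, 1] ∨
      s = ![2, 1, 0] := by
  revert s; decide

set_option maxRecDepth 10000 in
set_option maxHeartbeats 1000000 in
lemma isLinearFree_modelThree (s : Fin 3 → Fin 3) (hs : Function.Injective s) :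
    IsLinearFree 3 sail (modelThree s) ∧ (modelThree s).card = 10 := by
  obtain rfl | rfl | rfl | rfl | rfl | rfl := injective_fin_three s hs <;>
    exact ⟨isLinearFree_of_forall (card_eq_of_mem_modelThree _) (by decide) (by decide), by decide⟩

set_option maxRecDepth 10000 in
set_option maxHeartbeats 1000000 in
lemma isLinearFree_modelFour (s : Fin 3 → Fin 3)
    (hs : s = ![0, 1, 2] ∨ s = ![1, 0, 2] ∨ s = ![2, 1, 0]) :
    IsLinearFree 3 sail (modelFour s) ∧ (modelFour s).card = 10 := by
  obtain rfl | rfl | rfl := hs <;>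
    exact ⟨isLinearFree_of_forall (card_eq_of_mem_modelFour _) (by decide) (by decide), by decide⟩

end Models

section AddVertex

variable {U V : Type*} [DecidableEq V] {p : U → V} {w : V} {e : Finset V}

lemma mem_addVertex {E : Set (Sym2 U)} :
    e ∈ addVertex p E w ↔ ∃ u v, s(u, v) ∈ E ∧ e = {p u, p v, w} := Iff.rfl

lemma addVertex_singleton (u v : U) : addVertex p {s(u, v)} w = {{p u, p v, w}} := by
  ext e
  simp only [mem_addVertex, Set.mem_singleton_iff, Sym2.eq_iff]
  constructor
  · rintro ⟨a, b, ⟨rfl, rfl⟩ | ⟨rfl, rfl⟩, rfl⟩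
    · rfl
    · rw [insert_comm]
  · rintro rfl
    exact ⟨u, v, .inl ⟨rfl, rfl⟩, rfl⟩

lemma addVertex_insert (u v : U) (E : Set (Sym2 U)) :
    addVertex p (insert s(u, v) E) w = insert {p u, p v, w} (addVertex p E w) := by
  have : addVertex p (insert s(u, v) E) w = addVertex p {s(u, v)} w ∪ addVertex p E w := by
    ext e
    simp only [mem_addVertex, Set.mem_insert_iff, Set.mem_union, Set.mem_singleton_iff, or_and_right,
      exists_or]
  rw [this, addVertex_singleton, Set.insert_eq]

end AddVertex

/-! ### Construction 4 and its model. -/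

section ConstructionFour

variable {V : Type*} [DecidableEq V] {H : Finset (Finset V)}

/-- The three choices of the matching `Mv` pair `x i` with `y (s i)`, where `s` is the identity or
one of the transpositions moving `0`. -/
lemma isConstruction₄_iff : IsConstruction₄ H ↔ ∃ (E : TenVertices ≃ V) (s : Fin 3 → Fin 3),
    (s = ![0, 1, 2] ∨ s = ![1, 0, 2] ∨ s = ![2, 1, 0]) ∧ H = relabel E (modelFour s) := by
  have key : ∀ (E : TenVertices ≃ V) (s : Fin 3 → Fin 3) (p : SixVertices → V) (a b c v : V)
      (Mv : Set (Sym2 SixVertices)), Sum.elim p ![a, b, c, v] = E →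
      Mv = {s(x 0, y (s 0)), s(x 1, y (s 1)), s(x 2, y (s 2))} →
      (H = relabel E (modelFour s) ↔ (H : Set (Finset V)) =
        addVertex p {s(y 0, y 1), s(x 0, x 1)} a ∪ addVertex p {s(x 1, x 2)} b ∪
        addVertex p {s(y 0, y 2), s(x 0, x 2)} c ∪ addVertex p Mv v ∪
        {{a, b, p (y 2)}, {b, c, p (y 1)}}) := by
    rintro E s p a b c v Mv hE rfl
    have h1 : ∀ u, p u = E (.inl u) := fun u => by rw [← hE]; rfl
    have ha : a = E (.inr 0) := by rw [← hE]; rfl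
    have hb : b = E (.inr 1) := by rw [← hE]; rfl
    have hc : c = E (.inr 2) := by rw [← hE]; rfl
    have hv : v = E (.inr 3) := by rw [← hE]; rfl
    rw [← coe_inj]
    refine Eq.congr_right (Set.ext fun e => ?_)
    simp only [addVertex_insert, addVertex_singleton, h1, ha, hb, hc, hv, mem_coe, mem_relabel,
      modelFour, mem_union, mem_image, mem_univ, true_and, mem_insert, mem_singleton,
      Set.mem_union, Set.mem_insert_iff, Set.mem_singleton_iff, or_and_right, exists_or,
      exists_eq_left, exists_exists_eq_and, Fin.exists_fin_succ, map_insert, map_singleton,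
      Equiv.toEmbedding_apply, eq_comm (a := e)]
    simp only [Fin.isValue, Fin.succ_zero_eq_one, Fin.succ_one_eq_two, IsEmpty.exists_iff, or_false,
      exists_eq_left', map_insert, map_singleton, Equiv.toEmbedding_apply]
    tauto
  constructor
  · rintro ⟨p, a, b, c, v, Mv, hbij, hMv, hH⟩
    obtain rfl | rfl | rfl := hMv
    · exact ⟨Equiv.ofBijective _ hbij, ![0, 1, 2], .inl rfl,
        (key _ _ p a b c v _ rfl rfl).2 hH⟩
    · exact ⟨Equiv.ofBijective _ hbij, ![1, 0, 2], .inr (.inl rfl),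
        (key _ _ p a b c v _ rfl rfl).2 hH⟩
    · refine ⟨Equiv.ofBijective _ hbij, ![2, 1, 0], .inr (.inr rfl),
        (key _ _ p a b c v _ rfl ?_).2 hH⟩
      simp [Set.insert_comm, Set.pair_comm]
  · rintro ⟨E, s, hs, hH⟩
    have hE : Sum.elim (fun u => E (.inl u)) ![E (.inr 0), E (.inr 1), E (.inr 2), E (.inr 3)] = E := by
      funext u
      obtain u | i := u
      · rfl
      · fin_cases i <;> rfl
    refine ⟨fun u => E (.inl u), E (.inr 0), E (.inr 1), E (.inr 2), E (.inr 3),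
      {s(x 0, y (s 0)), s(x 1, y (s 1)), s(x 2, y (s 2))}, by rw [hE]; exact E.bijective, ?_,
      (key E s _ _ _ _ _ _ hE rfl).1 hH⟩
    obtain rfl | rfl | rfl := hs
    · exact .inl rfl
    · exact .inr (.inl rfl)
    · refine .inr (.inr ?_)
      simp [Set.insert_comm, Set.pair_comm]

end ConstructionFour
end SailTuran

namespace SailTuran
open Finset

/-! ### Construction 3 and its model. -/

section ConstructionThree

/-- The disjoint triangles `x₁x₂x₃` and `y₁y₂y₃`. -/
abbrev twoTriangles : SimpleGraph SixVertices := prism.deleteEdges prismMatching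

/-- The side opposite to `x i` of the triangle `x₁x₂x₃`. -/
def xSide (i : Fin 3) : Sym2 SixVertices := s(x (i + 1), x (i + 2))

/-- The side opposite to `y i` of the triangle `y₁y₂y₃`. -/
def ySide (i : Fin 3) : Sym2 SixVertices := s(y (i + 1), y (i + 2))

lemma mem_edgeSet_twoTriangles (e : Sym2 SixVertices) :
    e ∈ twoTriangles.edgeSet ↔ ∃ i, e = xSide i ∨ e = ySide i := by
  rw [SimpleGraph.edgeSet_deleteEdges, prism, SimpleGraph.edgeSet_fromEdgeSet, prismMatching]
  simp only [Set.mem_sdiff, Set.mem_insert_iff, Set.mem_singleton_iff, Sym2.mem_diagSet]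
  induction e with | h u w
  revert u w
  decide

lemma xSide_ne_ySide : ∀ i j, xSide i ≠ ySide j := by decide

lemma xSide_injective : Function.Injective xSide := by decide

lemma ySide_injective : Function.Injective ySide := by decide

/-- The graph with one side of each of the two triangles. -/
def twoSides (i j : Fin 3) : twoTriangles.Subgraph where
  verts := {u | ∃ w, s(u, w) = xSide i ∨ s(u, w) = ySide j}
  Adj u w := s(u, w) = xSide i ∨ s(u, w) = ySide j
  adj_sub {u w} h := by
    rw [← SimpleGraph.mem_edgeSet, mem_edgeSet_twoTriangles]
    obtain h | h := h
    exacts [⟨i, .inl h⟩, ⟨j, .inr h⟩]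
  edge_vert {u w} h := ⟨w, h⟩
  symm := ⟨fun u w h => by rwa [Sym2.eq_swap]⟩

lemma edgeSet_twoSides (i j : Fin 3) : (twoSides i j).edgeSet = {xSide i, ySide j} := by
  ext e
  induction e with | h u w
  rw [SimpleGraph.Subgraph.mem_edgeSet]
  rfl

lemma isMatching_twoSides (i j : Fin 3) : (twoSides i j).IsMatching := by
  rintro u ⟨w, hw⟩
  refine ⟨w, hw, fun w' hw' => ?_⟩
  have : ∀ i j u w w', (s(u, w) = xSide i ∨ s(u, w) = ySide j) →
      (s(u, w') = xSide i ∨ s(u, w') = ySide j) → w' = w := by decide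
  exact this i j u w w' hw hw'

variable {V : Type*} [DecidableEq V] {H : Finset (Finset V)}

lemma mem_relabel_modelThree {E : TenVertices ≃ V} {s : Fin 3 → Fin 3} {e : Finset V} :
    e ∈ relabel E (modelThree s) ↔
      (∃ i, e = {E (.inl (x i)), E (.inl (y i)), E (.inr 3)}) ∨
      (∃ i : Fin 3, e = {E (.inl (x (i + 1))), E (.inl (x (i + 2))), E (.inr i.castSucc)}) ∨
      (∃ i, e = {E (.inl (y (i + 1))), E (.inl (y (i + 2))), E (.inr (s i).castSucc)}) ∨
      e = {E (.inr 0), E (.inr 1), E (.inr 2)} := by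
  simp only [mem_relabel, modelThree, mem_union, mem_image, mem_univ, true_and, mem_singleton,
    or_and_right, exists_or, exists_exists_eq_and, exists_eq_left, map_insert, map_singleton,
    Equiv.toEmbedding_apply, eq_comm (a := e), or_assoc]

lemma mem_addVertex_prismMatching {p : SixVertices → V} {v : V} {e : Finset V} :
    e ∈ addVertex p prismMatching v ↔ ∃ i, e = {p (x i), p (y i), v} := by
  rw [prismMatching, addVertex_insert, addVertex_insert, addVertex_singleton]
  simp [Fin.exists_fin_succ]

/-- With `r` the inverse of `s`, the `i`-th of `a, b, c` extends `xSide i` and `ySide (r i)`; these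
two sides are the `i`-th matching. -/
lemma isConstruction₃_of_model (E : TenVertices ≃ V) (s : Fin 3 → Fin 3)
    (hs : Function.Injective s) : IsConstruction₃ (relabel E (modelThree s)) := by
  set r := (Equiv.ofBijective s (Finite.injective_iff_bijective.1 hs)).symm with hr
  have hsr : ∀ i, s (r i) = i := (Equiv.ofBijective s _).apply_symm_apply
  have hrs : ∀ i, r (s i) = i := (Equiv.ofBijective s _).symm_apply_apply
  have hE : Sum.elim (fun u => E (.inl u)) ![E (.inr 0), E (.inr 1), E (.inr 2), E (.inr 3)] = E := by
    funext u
    obtain u | i := u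
    · rfl
    · fin_cases i <;> rfl
  have hdisj : ∀ i j, i ≠ j → Disjoint (twoSides i (r i)).edgeSet (twoSides j (r j)).edgeSet := by
    intro i j hij
    simp only [edgeSet_twoSides, Set.disjoint_insert_left, Set.disjoint_singleton_left,
      Set.mem_insert_iff, Set.mem_singleton_iff, not_or]
    exact ⟨⟨xSide_injective.ne hij, xSide_ne_ySide _ _⟩, (xSide_ne_ySide _ _).symm,
      ySide_injective.ne (r.injective.ne hij)⟩
  have hcard : ∀ i, (twoSides i (r i)).edgeSet.ncard = 2 := fun i => by
    rw [edgeSet_twoSides, Set.ncard_pair (xSide_ne_ySide _ _)]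
  refine ⟨fun u => E (.inl u), E (.inr 0), E (.inr 1), E (.inr 2), E (.inr 3), twoSides 0 (r 0),
    twoSides 1 (r 1), twoSides 2 (r 2), by rw [hE]; exact E.bijective, isMatching_twoSides _ _,
    isMatching_twoSides _ _, isMatching_twoSides _ _, hcard 0, hcard 1, hcard 2,
    hdisj 0 1 (by decide), hdisj 0 2 (by decide), hdisj 1 2 (by decide), ?_, ?_⟩
  · ext e
    rw [mem_edgeSet_twoTriangles]
    simp only [edgeSet_twoSides, Set.mem_union, Set.mem_insert_iff, Set.mem_singleton_iff]
    constructor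
    · rintro (((h | h) | (h | h)) | (h | h))
      exacts [⟨_, .inl h⟩, ⟨_, .inr h⟩, ⟨_, .inl h⟩, ⟨_, .inr h⟩, ⟨_, .inl h⟩, ⟨_, .inr h⟩]
    · rintro ⟨i, h | h⟩
      · fin_cases i <;> simp_all
      · rw [← hrs i] at h
        generalize s i = j at h
        fin_cases j <;> simp_all
  · ext e
    rw [mem_coe, mem_relabel_modelThree]
    simp only [edgeSet_twoSides, xSide, ySide, addVertex_insert, addVertex_singleton,
      Set.mem_union, Set.mem_insert_iff, Set.mem_singleton_iff, mem_addVertex_prismMatching]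
    have h3 : (∃ i, e = {E (.inl (y (i + 1))), E (.inl (y (i + 2))), E (.inr (s i).castSucc)}) ↔
        ∃ j : Fin 3, e = {E (.inl (y (r j + 1))), E (.inl (y (r j + 2))), E (.inr j.castSucc)} := by
      constructor
      · rintro ⟨i, h⟩
        exact ⟨s i, by rw [hrs]; exact h⟩
      · rintro ⟨j, h⟩
        exact ⟨r j, by rw [hsr]; exact h⟩
    rw [h3]
    simp only [Fin.exists_fin_succ, IsEmpty.exists_iff, or_false]
    simp only [Fin.isValue, Fin.succ_zero_eq_one, Fin.succ_one_eq_two, Fin.castSucc_zero,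
      Fin.castSucc_one, show (Fin.castSucc 2 : Fin 4) = 2 from rfl]
    tauto

/-- Two sides of a triangle share a vertex, so they belong to different matchings. Hence the maps
`f` and `g`, sending a side of either triangle to the index of its matching, are permutations.
Renaming `a, b, c` along `f` puts the `x`-triangle in standard position and leaves `f⁻¹ ∘ g` for the
other one. -/
lemma IsConstruction₃.exists_model (h : IsConstruction₃ H) :
    ∃ (E : TenVertices ≃ V) (s : Fin 3 → Fin 3), Function.Injective s ∧
      H = relabel E (modelThree s) := by
  obtain ⟨p, a, b, c, v, Ma, Mb, Mc, hbij, hMa, hMb, hMc, -, -, -, hab, hac, hbc, hun, hH⟩ := h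
  set M : Fin 3 → twoTriangles.Subgraph := ![Ma, Mb, Mc] with hM
  set d : Fin 3 → V := ![a, b, c] with hd
  have hmatch : ∀ w, (M w).IsMatching := by
    intro w; fin_cases w
    exacts [hMa, hMb, hMc]
  have hdisj : ∀ w w', w ≠ w' → Disjoint (M w).edgeSet (M w').edgeSet := by
    intro w w' hww'
    fin_cases w <;> fin_cases w'
    exacts [absurd rfl hww', hab, hac, hab.symm, absurd rfl hww', hbc, hac.symm, hbc.symm,
      absurd rfl hww']
  have hcov : ∀ e ∈ twoTriangles.edgeSet, ∃ w, e ∈ (M w).edgeSet := by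
    intro e he
    rw [← hun] at he
    obtain (he | he) | he := he
    exacts [⟨0, he⟩, ⟨1, he⟩, ⟨2, he⟩]
  choose f hf using fun i => hcov (xSide i) ((mem_edgeSet_twoTriangles _).2 ⟨i, .inl rfl⟩)
  choose g hg using fun i => hcov (ySide i) ((mem_edgeSet_twoTriangles _).2 ⟨i, .inr rfl⟩)
  have huniq : ∀ e w w', e ∈ (M w).edgeSet → e ∈ (M w').edgeSet → w = w' := by
    intro e w w' h h'
    by_contra hne
    exact Set.disjoint_left.1 (hdisj w w' hne) h h'
  have hfinj : Function.Injective f := by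
    intro i j hij
    by_contra hne
    have : ∀ i j, i ≠ j → ∃ u w w', xSide i = s(u, w) ∧ xSide j = s(u, w') ∧ w ≠ w' := by decide
    obtain ⟨u, w, w', h1, h2, h3⟩ := this i j hne
    have h4 := hf i
    have h5 := hf j
    rw [← hij, h2, SimpleGraph.Subgraph.mem_edgeSet] at h5
    rw [h1, SimpleGraph.Subgraph.mem_edgeSet] at h4
    exact h3 ((hmatch _ (h4.fst_mem)).unique h4 h5)
  have hginj : Function.Injective g := by
    intro i j hij
    by_contra hne
    have : ∀ i j, i ≠ j → ∃ u w w', ySide i = s(u, w) ∧ ySide j = s(u, w') ∧ w ≠ w' := by decide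
    obtain ⟨u, w, w', h1, h2, h3⟩ := this i j hne
    have h4 := hg i
    have h5 := hg j
    rw [← hij, h2, SimpleGraph.Subgraph.mem_edgeSet] at h5
    rw [h1, SimpleGraph.Subgraph.mem_edgeSet] at h4
    exact h3 ((hmatch _ (h4.fst_mem)).unique h4 h5)
  set fe := Equiv.ofBijective f (Finite.injective_iff_bijective.1 hfinj) with hfe
  have hffe : ∀ i, f (fe.symm i) = i := (Equiv.ofBijective f _).apply_symm_apply
  have hbij' : Function.Bijective (Sum.elim p ![d (f 0), d (f 1), d (f 2), v]) := by
    have h1 : Sum.elim p ![d (f 0), d (f 1), d (f 2), v] = Sum.elim p ![a, b, c, v] ∘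
        Sum.map id ![(f 0).castSucc, (f 1).castSucc, (f 2).castSucc, 3] := by
      have hdc : ∀ i : Fin 3, d i = ![a, b, c, v] i.castSucc := by
        intro i; fin_cases i <;> rfl
      funext u
      obtain u | i := u
      · rfl
      · fin_cases i
        exacts [hdc _, hdc _, hdc _, rfl]
    rw [h1]
    refine hbij.comp (Sum.map_bijective.2 ⟨Function.bijective_id, ?_⟩)
    refine Finite.injective_iff_bijective.1 ?_
    obtain h | h | h | h | h | h := injective_fin_three f hfinj <;> rw [h] <;> decide
  refine ⟨Equiv.ofBijective _ hbij', fe.symm ∘ g, fe.symm.injective.comp hginj, ?_⟩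
  have hmem : ∀ w e, e ∈ addVertex p (M w).edgeSet (d w) ↔
      ∃ i, (f i = w ∧ e = {p (x (i + 1)), p (x (i + 2)), d (f i)}) ∨
        (g i = w ∧ e = {p (y (i + 1)), p (y (i + 2)), d (g i)}) := by
    intro w e
    have hx : ∀ i u u', s(u, u') = xSide i → ∀ z, ({p u, p u', z} : Finset V) =
        {p (x (i + 1)), p (x (i + 2)), z} := by
      intro i u u' h z
      obtain ⟨rfl, rfl⟩ | ⟨rfl, rfl⟩ := Sym2.eq_iff.1 h
      · rfl
      · rw [insert_comm]
    have hy : ∀ i u u', s(u, u') = ySide i → ∀ z, ({p u, p u', z} : Finset V) =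
        {p (y (i + 1)), p (y (i + 2)), z} := by
      intro i u u' h z
      obtain ⟨rfl, rfl⟩ | ⟨rfl, rfl⟩ := Sym2.eq_iff.1 h
      · rfl
      · rw [insert_comm]
    constructor
    · rintro ⟨u, u', huu', rfl⟩
      obtain ⟨i, h | h⟩ := (mem_edgeSet_twoTriangles _).1 ((M w).edgeSet_subset huu')
      · have hw : f i = w := huniq (xSide i) _ _ (hf i) (h ▸ huu')
        exact ⟨i, .inl ⟨hw, by rw [hw]; exact hx i u u' h _⟩⟩
      · have hw : g i = w := huniq (ySide i) _ _ (hg i) (h ▸ huu')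
        exact ⟨i, .inr ⟨hw, by rw [hw]; exact hy i u u' h _⟩⟩
    · rintro ⟨i, ⟨rfl, rfl⟩ | ⟨rfl, rfl⟩⟩
      · exact ⟨_, _, hf i, rfl⟩
      · exact ⟨_, _, hg i, rfl⟩
  have hE : ∀ i : Fin 3, Equiv.ofBijective _ hbij' (.inr i.castSucc) = d (f i) := by
    intro i; fin_cases i <;> rfl
  rw [← coe_inj, hH]
  ext e
  rw [mem_coe, mem_relabel_modelThree]
  simp only [hE, Function.comp_apply, hffe]
  have h0 := hmem 0 e
  have h1 := hmem 1 e
  have h2 := hmem 2 e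
  change e ∈ addVertex p Ma.edgeSet a ↔ _ at h0
  change e ∈ addVertex p Mb.edgeSet b ↔ _ at h1
  change e ∈ addVertex p Mc.edgeSet c ↔ _ at h2
  have htri : ({Equiv.ofBijective _ hbij' (.inr 0), Equiv.ofBijective _ hbij' (.inr 1),
      Equiv.ofBijective _ hbij' (.inr 2)} : Finset V) = {a, b, c} := by
    change ({d (f 0), d (f 1), d (f 2)} : Finset V) = {d 0, d 1, d 2}
    have h1 : ({d (f 0), d (f 1), d (f 2)} : Finset V) = univ.image (d ∘ f) := by
      ext; simp [Fin.exists_fin_succ, eq_comm]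
    have h2 : ({d 0, d 1, d 2} : Finset V) = univ.image d := by
      ext; simp [Fin.exists_fin_succ, eq_comm]
    rw [h1, h2, ← image_image, image_univ_of_surjective (Finite.injective_iff_surjective.1 hfinj)]
  rw [htri]
  simp only [Set.mem_union, Set.mem_singleton_iff, mem_addVertex_prismMatching, h0, h1, h2]
  have hall : ∀ w : Fin 3, w = 0 ∨ w = 1 ∨ w = 2 := by decide
  constructor
  · rintro ((((h | ⟨i, h | h⟩) | ⟨i, h | h⟩) | ⟨i, h | h⟩) | h)
    · exact .inl h
    all_goals first
      | exact .inr (.inl ⟨i, h.2⟩)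
      | exact .inr (.inr (.inl ⟨i, h.2⟩))
      | exact .inr (.inr (.inr h))
  · rintro (h | ⟨i, h⟩ | ⟨i, h⟩ | h)
    · exact .inl (.inl (.inl (.inl h)))
    · obtain hw | hw | hw := hall (f i)
      · exact .inl (.inl (.inl (.inr ⟨i, .inl ⟨hw, h⟩⟩)))
      · exact .inl (.inl (.inr ⟨i, .inl ⟨hw, h⟩⟩))
      · exact .inl (.inr ⟨i, .inl ⟨hw, h⟩⟩)
    · obtain hw | hw | hw := hall (g i)
      · exact .inl (.inl (.inl (.inr ⟨i, .inr ⟨hw, h⟩⟩)))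
      · exact .inl (.inl (.inr ⟨i, .inr ⟨hw, h⟩⟩))
      · exact .inl (.inr ⟨i, .inr ⟨hw, h⟩⟩)
    · exact .inr h

end ConstructionThree
end SailTuran

namespace SailTuran
open Finset

/-! ### Completing a prism to Construction 3 or 4. -/

section PrismCompletion

variable {V : Type*} [DecidableEq V] {H : Finset (Finset V)}

lemma exists_other_edge {u : V} {e₁ e₂ : Finset V} (hd : deg H u = 3) :
    ∃ e ∈ H, u ∈ e ∧ e ≠ e₁ ∧ e ≠ e₂ := by
  have h : ({e₁, e₂} : Finset (Finset V)).card < (H.filter (u ∈ ·)).card := by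
    have := card_le_two (a := e₁) (b := e₂)
    change _ < deg H u
    omega
  obtain ⟨e, he, hne⟩ := exists_mem_notMem_of_card_lt_card h
  rw [mem_filter] at he
  simp only [mem_insert, mem_singleton, not_or] at hne
  exact ⟨e, he.1, he.2, hne⟩

lemma eq_of_deg_eq_three {u : V} {e₁ e₂ e₃ g : Finset V} (hd : deg H u = 3) (h₁ : e₁ ∈ H)
    (h₂ : e₂ ∈ H) (h₃ : e₃ ∈ H) (hu₁ : u ∈ e₁) (hu₂ : u ∈ e₂) (hu₃ : u ∈ e₃) (h₁₂ : e₁ ≠ e₂)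
    (h₁₃ : e₁ ≠ e₃) (h₂₃ : e₂ ≠ e₃) (hg : g ∈ H) (hug : u ∈ g) : g = e₁ ∨ g = e₂ ∨ g = e₃ := by
  have h : ({e₁, e₂, e₃} : Finset (Finset V)) = H.filter (u ∈ ·) := by
    refine eq_of_subset_of_card_le ?_ ?_
    · simp [insert_subset_iff, *]
    · rw [card_eq_three.2 ⟨e₁, e₂, e₃, h₁₂, h₁₃, h₂₃, rfl⟩]
      exact hd.le
  have : g ∈ H.filter (u ∈ ·) := mem_filter.2 ⟨hg, hug⟩
  rw [← h] at this
  simpa using this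

variable [Fintype V] {P Q R : Fin 3 → V} {v : V}

namespace IsPrismSystem

lemma inj (h : IsPrismSystem H P Q R v) :
    Function.Injective P ∧ Function.Injective Q ∧ Function.Injective R ∧ (∀ i j, P i ≠ Q j) ∧
      (∀ i j, P i ≠ R j) ∧ (∀ i j, Q i ≠ R j) ∧ (∀ i, P i ≠ v) ∧ (∀ i, Q i ≠ v) ∧
      ∀ i, R i ≠ v := by
  have hi := h.bij.injective
  have hR : ∀ i : Fin 3, R i = ![R 0, R 1, R 2, v] i.castSucc := by
    intro i; fin_cases i <;> rfl
  refine ⟨fun i j hij => ?_, fun i j hij => ?_, fun i j hij => ?_, fun i j hij => ?_,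
    fun i j hij => ?_, fun i j hij => ?_, fun i hi' => ?_, fun i hi' => ?_, fun i hi' => ?_⟩
  · simpa using @hi (.inl (.inl i)) (.inl (.inl j)) hij
  · simpa using @hi (.inl (.inr i)) (.inl (.inr j)) hij
  · rw [hR i, hR j] at hij
    simpa using @hi (.inr i.castSucc) (.inr j.castSucc) hij
  · simpa using @hi (.inl (.inl i)) (.inl (.inr j)) hij
  · rw [hR j] at hij
    simpa using @hi (.inl (.inl i)) (.inr j.castSucc) hij
  · rw [hR j] at hij
    simpa using @hi (.inl (.inr i)) (.inr j.castSucc) hij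
  · simpa using @hi (.inl (.inl i)) (.inr 3) hi'
  · simpa using @hi (.inl (.inr i)) (.inr 3) hi'
  · rw [hR i] at hi'
    have := @hi (.inr i.castSucc) (.inr 3) hi'
    fin_cases i <;> simp at this

lemma cases (h : IsPrismSystem H P Q R v) (u : V) :
    (∃ i, u = P i) ∨ (∃ i, u = Q i) ∨ (∃ i, u = R i) ∨ u = v := by
  obtain ⟨(i | i) | i, rfl⟩ := h.bij.surjective u
  · exact .inl ⟨i, rfl⟩
  · exact .inr (.inl ⟨i, rfl⟩)
  · fin_cases i
    exacts [.inr (.inr (.inl ⟨0, rfl⟩)), .inr (.inr (.inl ⟨1, rfl⟩)), .inr (.inr (.inl ⟨2, rfl⟩)),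
      .inr (.inr (.inr rfl))]

lemma perm (h : IsPrismSystem H P Q R v) (π : Fin 3 → Fin 3) (hπ : Function.Injective π) :
    IsPrismSystem H (P ∘ π) (Q ∘ π) (R ∘ π) v where
  bij := by
    have h1 : Sum.elim (Sum.elim (P ∘ π) (Q ∘ π)) ![(R ∘ π) 0, (R ∘ π) 1, (R ∘ π) 2, v] =
        Sum.elim (Sum.elim P Q) ![R 0, R 1, R 2, v] ∘
        Sum.map (Sum.map π π) ![(π 0).castSucc, (π 1).castSucc, (π 2).castSucc, 3] := by
      have hR : ∀ i : Fin 3, R i = ![R 0, R 1, R 2, v] i.castSucc := by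
        intro i; fin_cases i <;> rfl
      funext u
      obtain (u | u) | i := u
      · rfl
      · rfl
      · fin_cases i
        exacts [hR _, hR _, hR _, rfl]
    have hb := Finite.injective_iff_bijective.1 hπ
    rw [h1]
    refine h.bij.comp (Sum.map_bijective.2 ⟨Sum.map_bijective.2 ⟨hb, hb⟩, ?_⟩)
    refine Finite.injective_iff_bijective.1 ?_
    obtain h | h | h | h | h | h := injective_fin_three π hπ <;> rw [h] <;> decide
  spoke i := h.spoke _
  side i j l hij hil hjl := h.side _ _ _ (hπ.ne hij) (hπ.ne hil) (hπ.ne hjl)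
  mem_far i := h.mem_far _

/-- One spoke and two sides already exhaust the degree 3 of `P i`. In the same way the spokes
exhaust the degree of `v`, so all remaining edges consist of vertices `Q j` and `R j`. -/
lemma eq_spoke_or_side (h : IsPrismSystem H P Q R v) (hd : ∀ u, deg H u = 3) {g : Finset V}
    (hg : g ∈ H) {i : Fin 3} (hi : P i ∈ g) :
    g = {P i, Q i, v} ∨ ∃ j l, i ≠ j ∧ i ≠ l ∧ j ≠ l ∧ g = {P i, P j, R l} := by
  obtain ⟨hP, -, hR, hPQ, hPR, hQR, hPv, hQv, hRv⟩ := h.inj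
  have : ∀ i : Fin 3, ∃ j l, i ≠ j ∧ i ≠ l ∧ j ≠ l := by decide
  obtain ⟨j, l, hij, hil, hjl⟩ := this i
  have hv : ∀ j l, v ∉ ({P i, P j, R l} : Finset V) := fun j l => by
    simp [(hPv _).symm, (hRv _).symm]
  have hvs : v ∈ ({P i, Q i, v} : Finset V) := by simp
  have hne : ({P i, P j, R l} : Finset V) ≠ {P i, P l, R j} := fun h => by
    have : P j ∈ ({P i, P l, R j} : Finset V) := by rw [← h]; simp
    simp [hP.eq_iff, hPR, hij.symm, hjl] at this
  obtain h | h | h := eq_of_deg_eq_three (hd (P i)) (h.spoke i) (h.side i j l hij hil hjl)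
    (h.side i l j hil hij hjl.symm) (by simp) (by simp) (by simp)
    (fun h => hv j l (h ▸ hvs)) (fun h => hv l j (h ▸ hvs)) hne hg hi
  · exact .inl h
  · exact .inr ⟨j, l, hij, hil, hjl, h⟩
  · exact .inr ⟨l, j, hil, hij, hjl.symm, h⟩

lemma eq_spoke (h : IsPrismSystem H P Q R v) (hd : ∀ u, deg H u = 3) {g : Finset V}
    (hg : g ∈ H) (hv : v ∈ g) : ∃ i, g = {P i, Q i, v} := by
  obtain ⟨hP, -, -, hPQ, -, -, hPv, -, -⟩ := h.inj
  have hne : ∀ i j, i ≠ j → ({P i, Q i, v} : Finset V) ≠ {P j, Q j, v} := by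
    intro i j hij h
    have : P i ∈ ({P j, Q j, v} : Finset V) := by rw [← h]; simp
    simp [hP.eq_iff, hPQ, hPv, hij] at this
  obtain h | h | h := eq_of_deg_eq_three (hd v) (h.spoke 0) (h.spoke 1) (h.spoke 2) (by simp)
    (by simp) (by simp) (hne 0 1 (by decide)) (hne 0 2 (by decide)) (hne 1 2 (by decide)) hg hv
  exacts [⟨0, h⟩, ⟨1, h⟩, ⟨2, h⟩]

/-- An edge through `R i` that does not extend a side consists of vertices `Q j` and `R j`. -/
lemma mem_cases (h : IsPrismSystem H P Q R v) (hd : ∀ u, deg H u = 3) {g : Finset V}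
    (hg : g ∈ H) {i : Fin 3} (hi : R i ∈ g)
    (hne : ∀ j l, i ≠ j → i ≠ l → j ≠ l → g ≠ {P j, P l, R i})
    {u : V} (hu : u ∈ g) : (∃ j, u = Q j) ∨ ∃ j, u = R j := by
  obtain ⟨hP, -, hR, hPQ, hPR, hQR, hPv, hQv, hRv⟩ := h.inj
  obtain ⟨j, rfl⟩ | hu' | hu' | rfl := h.cases u
  · obtain rfl | ⟨l, m, hjl, hjm, hlm, rfl⟩ := h.eq_spoke_or_side hd hg hu
    · simp [(hPR _ _).symm, (hQR _ _).symm, hRv] at hi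
    · simp only [mem_insert, (hPR _ _).symm, mem_singleton, hR.eq_iff, false_or] at hi
      subst hi
      exact absurd rfl (hne j l hjm.symm hlm.symm hjl)
  · exact .inl hu'
  · exact .inr hu'
  · obtain ⟨j, rfl⟩ := h.eq_spoke hd hg hu
    simp [(hPR _ _).symm, (hQR _ _).symm, hRv] at hi

/-- If the vertices `R i` form an edge, we have the third construction. -/
lemma isConstruction₃ (h : IsPrismSystem H P Q R v) (hH : IsDense 3 1 H) (hd : ∀ u, deg H u = 3)
    (hRe : {R 0, R 1, R 2} ∈ H) : IsConstruction₃ H := by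
  obtain ⟨hP, hQ, hR, hPQ, hPR, hQR, hPv, hQv, hRv⟩ := h.inj
  have hRmem : ∀ i, R i ∈ ({R 0, R 1, R 2} : Finset V) := by
    intro i; fin_cases i <;> simp
  have hidx : ∀ i : Fin 3, i ≠ i + 1 ∧ i ≠ i + 2 ∧ i + 1 ≠ i + 2 := by decide
  -- Besides `{R 0, R 1, R 2}` and an extended side there is a third edge at `R i`. It contains no
  -- other `R j` by linearity, so its other two vertices are among the `Q j`.
  have hext : ∀ i, ∃ j, {Q (j + 1), Q (j + 2), R i} ∈ H := by
    intro i
    obtain ⟨i1, i2, i3⟩ := hidx i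
    obtain ⟨g, hg, hig, hg1, hg2⟩ := exists_other_edge (e₁ := {R 0, R 1, R 2})
      (e₂ := {P (i + 1), P (i + 2), R i}) (hd (R i))
    have hside : ∀ j l, i ≠ j → i ≠ l → j ≠ l → g ≠ {P j, P l, R i} := by
      rintro j l hij hil hjl rfl
      have : ∀ i j l : Fin 3, i ≠ j → i ≠ l → j ≠ l → (j = i + 1 ∧ l = i + 2) ∨
        (j = i + 2 ∧ l = i + 1) := by decide
      obtain ⟨rfl, rfl⟩ | ⟨rfl, rfl⟩ := this i j l hij hil hjl
      · exact hg2 rfl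
      · exact hg2 (insert_comm _ _ _)
    have hmemQ : ∀ u ∈ g, u ≠ R i → ∃ j, u = Q j := by
      intro u hu hui
      obtain hu' | ⟨j, rfl⟩ := h.mem_cases hd hg hig hside hu
      · exact hu'
      · exact absurd (hH.eq_of_mem hg hRe hui hu hig (hRmem j) (hRmem i)) hg1
    obtain ⟨u, hu, hui⟩ := exists_mem_ne (by rw [hH.uniform g hg]; norm_num : 1 < g.card) (R i)
    obtain ⟨w, hwu, hwi, rfl⟩ := exists_third (hH.uniform g hg) hu hig hui
    obtain ⟨j, rfl⟩ := hmemQ u hu hui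
    obtain ⟨l, rfl⟩ := hmemQ w (by simp) hwi
    have : ∀ j l : Fin 3, l ≠ j → ∃ m, (m + 1 = j ∧ m + 2 = l) ∨ (m + 1 = l ∧ m + 2 = j) := by
      decide
    obtain ⟨m, ⟨rfl, rfl⟩ | ⟨rfl, rfl⟩⟩ := this j l fun h => hwu (h ▸ rfl)
    · exact ⟨m, by rwa [pair_comm (Q _) (R i)]⟩
    · refine ⟨m, ?_⟩
      have : ({Q (m + 1), Q (m + 2), R i} : Finset V) = {Q (m + 2), R i, Q (m + 1)} := by
        ext; simp; tauto
      rwa [this]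
  choose t ht using hext
  have htinj : Function.Injective t := by
    intro i j hij
    have h1 := ht i
    have h2 := ht j
    rw [← hij] at h2
    have h3 := hH.eq_of_mem h1 h2 (hQ.ne (hidx (t i)).2.2) (by simp) (by simp) (by simp) (by simp)
    have : R i ∈ ({Q (t i + 1), Q (t i + 2), R j} : Finset V) := by rw [← h3]; simp
    simpa [(hQR _ _).symm, hR.eq_iff] using this
  set r := Equiv.ofBijective t (Finite.injective_iff_bijective.1 htinj) with hr
  have htr : ∀ i, t (r.symm i) = i := (Equiv.ofBijective t _).apply_symm_apply
  -- The edges found so far form a copy of the model, which has as many edges as `H`, namely ten.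
  have hmodel : H = relabel (Equiv.ofBijective _ h.bij) (modelThree r.symm) := by
    refine (eq_of_subset_of_card_le ?_ ?_).symm
    · intro e he
      rw [mem_relabel_modelThree] at he
      have hRE : ∀ i : Fin 3, Equiv.ofBijective _ h.bij (.inr i.castSucc) = R i := by
        intro i; fin_cases i <;> rfl
      simp only [hRE] at he
      obtain ⟨i, rfl⟩ | ⟨i, rfl⟩ | ⟨i, rfl⟩ | rfl := he
      · exact h.spoke i
      · exact h.side _ _ _ (hidx i).2.2 (hidx i).1.symm (hidx i).2.1.symm
      · have := ht (r.symm i)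
        rw [htr] at this
        exact this
      · exact hRe
    · rw [card_relabel, (isLinearFree_modelThree _ r.symm.injective).2, hH.card_edges]
      norm_num
  rw [hmodel]
  exact isConstruction₃_of_model _ _ r.symm.injective

/-- Two edges `{R 0, R 2, Q b}` and `{R 0, R 1, Q a}` give the fourth construction. -/
lemma isConstruction₄ (h : IsPrismSystem H P Q R v) (hH : IsDense 3 1 H) {a b c : Fin 3}
    (h₁ : {R 2, R 0, Q b} ∈ H) (h₂ : {R 0, R 1, Q a} ∈ H) (h₃ : {Q c, Q a, R 2} ∈ H)
    (h₄ : {Q c, Q b, R 1} ∈ H) (hab : a ≠ b) (hac : a ≠ c) (hbc : b ≠ c) : IsConstruction₄ H := by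
  obtain ⟨hP, hQ, hR, hPQ, hPR, hQR, hPv, hQv, hRv⟩ := h.inj
  -- `R 0` and `R 1` are neighbours of `P 2` through sides and `Q 2` through a spoke, so `{R 0, R 1,
  -- Q 2}` would miss the far set of `P 2`. The next claim is the same at `P 1`. Only three
  -- arrangements of `a, b, c` survive, and they give the three possible matchings.
  have ha2 : a ≠ 2 := by
    rintro rfl
    obtain ⟨u, hu⟩ := hH.inter_far (P 2) _ h₂
    simp only [mem_inter, mem_insert, mem_singleton] at hu
    obtain ⟨rfl | rfl | rfl, hu⟩ := hu
    · exact not_mem_far_of_mem (h.side 2 1 0 (by decide) (by decide) (by decide)) (by simp)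
        (by simp) (hPR _ _).symm hu
    · exact not_mem_far_of_mem (h.side 2 0 1 (by decide) (by decide) (by decide)) (by simp)
        (by simp) (hPR _ _).symm hu
    · exact not_mem_far_of_mem (h.spoke 2) (by simp) (by simp) (hPQ _ _).symm hu
  have hb1 : b ≠ 1 := by
    rintro rfl
    obtain ⟨u, hu⟩ := hH.inter_far (P 1) _ h₁
    simp only [mem_inter, mem_insert, mem_singleton] at hu
    obtain ⟨rfl | rfl | rfl, hu⟩ := hu
    · exact not_mem_far_of_mem (h.side 1 0 2 (by decide) (by decide) (by decide)) (by simp)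
        (by simp) (hPR _ _).symm hu
    · exact not_mem_far_of_mem (h.side 1 2 0 (by decide) (by decide) (by decide)) (by simp)
        (by simp) (hPR _ _).symm hu
    · exact not_mem_far_of_mem (h.spoke 1) (by simp) (by simp) (hPQ _ _).symm hu
  set ρ : Fin 3 → Fin 3 := ![c, a, b] with hρ
  have hρ3 : ρ = ![0, 1, 2] ∨ ρ = ![1, 0, 2] ∨ ρ = ![2, 1, 0] := by
    have : ∀ a b c : Fin 3, a ≠ b → a ≠ c → b ≠ c → a ≠ 2 → b ≠ 1 →
      ![c, a, b] = ![0, 1, 2] ∨ ![c, a, b] = ![1, 0, 2] ∨ ![c, a, b] = ![2, 1, 0] := by decide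
    exact this a b c hab hac hbc ha2 hb1
  have hρρ : ∀ i, ρ (ρ i) = i := by
    obtain h | h | h := hρ3 <;> rw [h] <;> decide
  have hρb : Function.Bijective ρ := Function.Involutive.bijective hρρ
  -- The vertices `a, b, c` of the construction are `R 2, R 0, R 1`, so that `b` is the vertex
  -- common to the two special edges, and `y₁, y₂, y₃` are `Q c, Q a, Q b`.
  have hbij : Function.Bijective (Sum.elim (Sum.elim P (Q ∘ ρ)) ![R 2, R 0, R 1, v]) := by
    have h1 : Sum.elim (Sum.elim P (Q ∘ ρ)) ![R 2, R 0, R 1, v] =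
        Sum.elim (Sum.elim P Q) ![R 0, R 1, R 2, v] ∘
        Sum.map (Sum.map id ρ) ![2, 0, 1, 3] := by
      funext u
      obtain (u | u) | i := u
      · rfl
      · rfl
      · fin_cases i <;> rfl
    rw [h1]
    exact h.bij.comp (Sum.map_bijective.2 ⟨Sum.map_bijective.2 ⟨Function.bijective_id, hρb⟩,
      Finite.injective_iff_bijective.1 (by decide)⟩)
  rw [isConstruction₄_iff]
  refine ⟨Equiv.ofBijective _ hbij, ρ, hρ3, (eq_of_subset_of_card_le ?_ ?_).symm⟩
  · intro e he
    simp only [mem_relabel, modelFour, mem_union, mem_image, mem_univ, true_and, mem_insert,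
      mem_singleton] at he
    obtain ⟨f, (⟨i, rfl⟩ | rfl | rfl | rfl | rfl | rfl | rfl | rfl), rfl⟩ := he <;>
      simp only [map_insert, map_singleton, Equiv.toEmbedding_apply]
    · change {P i, Q (ρ (ρ i)), v} ∈ H
      rw [hρρ]; exact h.spoke i
    · exact h₃
    · exact h.side 0 1 2 (by decide) (by decide) (by decide)
    · exact h.side 1 2 0 (by decide) (by decide) (by decide)
    · exact h₄
    · exact h.side 0 2 1 (by decide) (by decide) (by decide)
    · exact h₁
    · exact h₂
  · rw [card_relabel, (isLinearFree_modelFour _ hρ3).2, hH.card_edges]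
    norm_num

/-- The far set of `v` is `{R 0, R 1, R 2, v}`, and edges through `v` are spokes, which meet it in
`v` alone. So an excess edge has two vertices `R i`, `R j`, and a third `R l` is excluded by
assumption. -/
lemma exists_eq_of_mem_excessEdges (h : IsPrismSystem H P Q R v) (hH : IsDense 3 1 H)
    (hd : ∀ u, deg H u = 3) (hRe : {R 0, R 1, R 2} ∉ H) {g : Finset V}
    (hg : g ∈ excessEdges H v) : ∃ i j b, i ≠ j ∧ g = {R i, R j, Q b} := by
  obtain ⟨hP, hQ, hR, hPQ, hPR, hQR, hPv, hQv, hRv⟩ := h.inj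
  obtain ⟨hg, hc⟩ := mem_excessEdges.1 hg
  have hfar : ∀ u ∈ far H v, (∃ i, u = R i) ∨ u = v := by
    intro u hu
    obtain ⟨i, rfl⟩ | ⟨i, rfl⟩ | hu' := h.cases u
    · exact absurd hu (not_mem_far_of_mem (h.spoke i) (by simp) (by simp) (hPv i))
    · exact absurd hu (not_mem_far_of_mem (h.spoke i) (by simp) (by simp) (hQv i))
    · exact hu'
  have hv : v ∉ g := by
    intro hv
    obtain ⟨i, rfl⟩ := h.eq_spoke hd hg hv
    obtain ⟨u, hu, huv⟩ := exists_mem_ne hc v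
    rw [mem_inter] at hu
    obtain ⟨j, rfl⟩ := (hfar u hu.2).resolve_right huv
    simp [(hPR _ _).symm, (hQR _ _).symm, hRv] at hu
  obtain ⟨u, hu, u', hu', huu'⟩ := one_lt_card.1 hc
  rw [mem_inter] at hu hu'
  obtain ⟨i, rfl⟩ := (hfar u hu.2).resolve_right fun h' => hv (h' ▸ hu.1)
  obtain ⟨j, rfl⟩ := (hfar u' hu'.2).resolve_right fun h' => hv (h' ▸ hu'.1)
  obtain ⟨w, hwi, hwj, rfl⟩ := exists_third (hH.uniform g hg) hu.1 hu'.1 huu'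
  have hside : ∀ l m, i ≠ l → i ≠ m → l ≠ m → ({R i, R j, w} : Finset V) ≠ {P l, P m, R i} := by
    intro l m _ _ _ h'
    have : R j ∈ ({P l, P m, R i} : Finset V) := by rw [← h']; simp
    simp only [mem_insert, (hPR _ _).symm, mem_singleton, false_or] at this
    exact huu' this.symm
  obtain ⟨b, rfl⟩ | ⟨l, rfl⟩ := h.mem_cases hd hg hu.1 hside (u := w) (by simp)
  · exact ⟨i, j, b, fun h => huu' (h ▸ rfl), rfl⟩
  · have : ∀ i j l : Fin 3, i ≠ j → l ≠ i → l ≠ j → ({i, j, l} : Finset (Fin 3)) = {0, 1, 2} := by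
      decide
    have := congr_arg (Finset.image R) (this i j l (fun h => huu' (h ▸ rfl))
      (fun h => hwi (h ▸ rfl)) (fun h => hwj (h ▸ rfl)))
    simp only [image_insert, image_singleton] at this
    exact absurd (this ▸ hg) hRe

/-- The third edge through a vertex `R α` that lies on an edge `{R α, R β, Q b}`. -/
lemma third_edge (h : IsPrismSystem H P Q R v) (hH : IsDense 3 1 H) (hd : ∀ u, deg H u = 3)
    {α β γ a b c : Fin 3} (hαβ : α ≠ β) (hαγ : α ≠ γ) (hβγ : β ≠ γ) (hab : a ≠ b) (hac : a ≠ c)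
    (hbc : b ≠ c) (h₁ : {R α, R β, Q b} ∈ H)
    (hex : ∀ e ∈ H, R α ∈ e → e ≠ {R α, R β, Q b} → ∀ l, l ≠ α → R l ∉ e) :
    {Q c, Q a, R α} ∈ H := by
  obtain ⟨hP, hQ, hR, hPQ, hPR, hQR, hPv, hQv, hRv⟩ := h.inj
  obtain ⟨e, he, hαe, he₁, he₂⟩ := exists_other_edge (e₁ := {R α, R β, Q b})
    (e₂ := {P β, P γ, R α}) (hd (R α))
  have hside : ∀ j l, α ≠ j → α ≠ l → j ≠ l → e ≠ {P j, P l, R α} := by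
    rintro j l hij hil hjl rfl
    have : ∀ α β γ j l : Fin 3, α ≠ β → α ≠ γ → β ≠ γ → α ≠ j → α ≠ l → j ≠ l →
      (j = β ∧ l = γ) ∨ (j = γ ∧ l = β) := by decide
    obtain ⟨rfl, rfl⟩ | ⟨rfl, rfl⟩ := this α β γ j l hαβ hαγ hβγ hij hil hjl
    · exact he₂ rfl
    · exact he₂ (insert_comm _ _ _)
  have hmemQ : ∀ u ∈ e, u ≠ R α → ∃ j, j ≠ b ∧ u = Q j := by
    intro u hu hui
    obtain ⟨j, rfl⟩ | ⟨j, rfl⟩ := h.mem_cases hd he hαe hside hu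
    · refine ⟨j, ?_, rfl⟩
      rintro rfl
      exact he₁ (hH.eq_of_mem he h₁ hui hu hαe (by simp) (by simp))
    · exact absurd hu (hex e he hαe he₁ j fun h => hui (h ▸ rfl))
  obtain ⟨u, hu, hui⟩ := exists_mem_ne (by rw [hH.uniform e he]; norm_num : 1 < e.card) (R α)
  obtain ⟨w, hwu, hwi, rfl⟩ := exists_third (hH.uniform e he) hu hαe hui
  obtain ⟨j, hj, rfl⟩ := hmemQ u hu hui
  obtain ⟨l, hl, rfl⟩ := hmemQ w (by simp) hwi
  have : ∀ a b c j l : Fin 3, a ≠ b → a ≠ c → b ≠ c → j ≠ b → l ≠ b → l ≠ j →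
    (j = c ∧ l = a) ∨ (j = a ∧ l = c) := by decide
  obtain ⟨rfl, rfl⟩ | ⟨rfl, rfl⟩ := this a b c j l hab hac hbc hj hl fun h => hwu (h ▸ rfl)
  · rwa [pair_comm (Q _) (R α)]
  · convert he using 1
    ext; simp; tauto

/-- For `k = 3` the total defect is 0, so all degrees are 3. If the `R i` do not form an edge, the
surplus 2 at `v` comes from exactly two edges, each with a pair of the `R i`. Two different pairs
from three indices share one index, which is moved to position 0. -/
lemma isConstruction₃_or_isConstruction₄ (h : IsPrismSystem H P Q R v) (hH : IsDense 3 1 H) :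
    IsConstruction₃ H ∨ IsConstruction₄ H := by
  obtain ⟨hP, hQ, hR, hPQ, hPR, hQR, hPv, hQv, hRv⟩ := h.inj
  have hdef : ∀ u, defect 3 H u = 0 := fun u => by
    have h1 := hH.sum_defect
    have h2 := single_le_sum (f := defect 3 H) (fun _ _ => Nat.zero_le _) (mem_univ u)
    omega
  have hd : ∀ u, deg H u = 3 := fun u => hH.deg_eq_of_defect (hdef u)
  by_cases hRe : {R 0, R 1, R 2} ∈ H
  · exact .inl (h.isConstruction₃ hH hd hRe)
  right
  have hform := fun g => h.exists_eq_of_mem_excessEdges hH hd hRe (g := g)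
  have hsum := hH.sum_excess_of_centre (hdef v) fun u _ => hdef u
  have hQfar : ∀ i, Q i ∉ far H v := fun i =>
    not_mem_far_of_mem (h.spoke i) (by simp) (by simp) (hQv i)
  have hcard : (excessEdges H v).card = 2 := by
    rw [← hsum, card_eq_sum_ones]
    refine sum_congr rfl fun g hg => ?_
    have h2 := (mem_excessEdges.1 hg).2
    obtain ⟨i, j, b, -, rfl⟩ := hform g hg
    have : (({R i, R j, Q b} : Finset V) ∩ far H v) ⊆ {R i, R j} := by
      intro u hu
      simp only [mem_inter, mem_insert, mem_singleton] at hu ⊢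
      obtain ⟨rfl | rfl | rfl, hu⟩ := hu
      · simp
      · simp
      · exact absurd hu (hQfar b)
    have := (card_le_card this).trans card_le_two
    omega
  have hmem : ∀ g ∈ H, ∀ i j, i ≠ j → R i ∈ g → R j ∈ g → g ∈ excessEdges H v :=
    fun g hg i j hij hi hj => excess_of_mem hg (hR.ne hij) hi hj (h.mem_far i) (h.mem_far j)
  have key : ∀ α β γ a b : Fin 3, α ≠ β → α ≠ γ → β ≠ γ →
      excessEdges H v = {{R α, R β, Q b}, {R β, R γ, Q a}} → IsConstruction₄ H := by
    intro α β γ a b hαβ hαγ hβγ hexc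
    have h₁ : {R α, R β, Q b} ∈ H := (mem_excessEdges.1 (hexc ▸ mem_insert_self _ _)).1
    have h₂ : {R β, R γ, Q a} ∈ H :=
      (mem_excessEdges.1 (hexc ▸ mem_insert_of_mem (mem_singleton_self _))).1
    have hα : R α ∉ ({R β, R γ, Q a} : Finset V) := by
      simp [hR.eq_iff, (hQR _ _).symm, hαβ, hαγ]
    have hγ : R γ ∉ ({R α, R β, Q b} : Finset V) := by
      simp [hR.eq_iff, (hQR _ _).symm, hαγ.symm, hβγ.symm]
    have hab : a ≠ b := by
      rintro rfl
      have := hH.eq_of_mem h₁ h₂ (hQR a β) (by simp) (by simp) (by simp) (by simp)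
      exact hα (this ▸ mem_insert_self _ _)
    obtain ⟨c, hac, hbc⟩ : ∃ c, a ≠ c ∧ b ≠ c := by
      have : ∀ a b : Fin 3, ∃ c, a ≠ c ∧ b ≠ c := by decide
      exact this a b
    have h₃ := h.third_edge hH hd hαβ hαγ hβγ hab hac hbc h₁ (by
      intro e he hαe hne l hl hle
      have := hmem e he l α hl hle hαe
      rw [hexc, mem_insert, mem_singleton] at this
      exact this.elim hne fun h' => hα (h' ▸ hαe))
    have h₂' : {R γ, R β, Q a} ∈ H := by rwa [insert_comm]
    have h₄ := h.third_edge hH hd hβγ.symm hαγ.symm hαβ.symm hab.symm hbc hac h₂' (by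
      intro e he hγe hne l hl hle
      have := hmem e he l γ hl hle hγe
      rw [hexc, mem_insert, mem_singleton, insert_comm (R β)] at this
      exact this.elim (fun h' => hγ (h' ▸ hγe)) hne)
    have hp := h.perm ![β, γ, α] (injective_vec_three hβγ hαβ.symm hαγ.symm)
    have hsurj := (Finite.injective_iff_bijective.1
      (injective_vec_three hβγ hαβ.symm hαγ.symm)).surjective
    obtain ⟨a, rfl⟩ := hsurj a
    obtain ⟨b, rfl⟩ := hsurj b
    obtain ⟨c, rfl⟩ := hsurj c
    exact hp.isConstruction₄ hH h₁ h₂ h₃ h₄ (fun h => hab (h ▸ rfl)) (fun h => hac (h ▸ rfl))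
      (fun h => hbc (h ▸ rfl))
  obtain ⟨g₁, g₂, hne, hexc⟩ := card_eq_two.1 hcard
  obtain ⟨i, j, b, hij, rfl⟩ := hform g₁ (by simp [hexc])
  obtain ⟨i', j', a, hij', rfl⟩ := hform g₂ (by simp [hexc])
  have : ∀ i j i' j' : Fin 3, i ≠ j → i' ≠ j' → (i = i' ∧ j ≠ j') ∨ (i = j' ∧ j ≠ i') ∨
    (j = i' ∧ i ≠ j') ∨ (j = j' ∧ i ≠ i') ∨ (i = i' ∧ j = j') ∨ (i = j' ∧ j = i') := by decide
  have hH₁ : {R i, R j, Q b} ∈ H := (mem_excessEdges.1 (hexc ▸ mem_insert_self _ _)).1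
  have hH₂ : {R i', R j', Q a} ∈ H :=
    (mem_excessEdges.1 (hexc ▸ mem_insert_of_mem (mem_singleton_self _))).1
  obtain ⟨rfl, h'⟩ | ⟨rfl, h'⟩ | ⟨rfl, h'⟩ | ⟨rfl, h'⟩ | ⟨rfl, rfl⟩ | ⟨rfl, rfl⟩ :=
    this i j i' j' hij hij'
  · exact key j i j' a b hij.symm h' hij' (by rw [hexc, insert_comm (R i) (R j)])
  · exact key j i i' a b hij.symm h' hij'.symm
      (by rw [hexc, insert_comm (R i) (R j), insert_comm (R i') (R i)])
  · exact key i j j' a b hij h' hij' hexc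
  · exact key i j i' a b hij h' hij'.symm (by rw [hexc, insert_comm (R j) (R i')])
  · exact absurd (hH.eq_of_mem hH₁ hH₂ (hR.ne hij) (by simp) (by simp) (by simp) (by simp)) hne
  · exact absurd (hH.eq_of_mem hH₁ hH₂ (hR.ne hij) (by simp) (by simp) (by simp) (by simp)) hne

end IsPrismSystem
end PrismCompletion
end SailTuran

namespace SailTuran
open Finset

/-! ### Cell colourings of a square and the hypergraphs they define. -/

section Colouring

/-- The vertices of the first two constructions: the parts `X` and `Y`, and the colours. -/
abbrev ColourVertices (k : ℕ) : Type := (Fin k ⊕ Fin k) ⊕ (Fin (k - 2) ⊕ Fin 3)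

/-- A colouring of the cells `(i, j)` such that no colour repeats in a row or in a column, and all
colours `inl t` occur in every row and column. -/
structure IsCellColouring {k : ℕ} (κ : Fin k → Fin k → Fin (k - 2) ⊕ Fin 3) : Prop where
  three_le : 3 ≤ k
  row_inj : ∀ i, Function.Injective (κ i)
  col_inj : ∀ j, Function.Injective fun i => κ i j
  row_surj : ∀ i t, ∃ j, κ i j = .inl t
  col_surj : ∀ j t, ∃ i, κ i j = .inl t

variable {k : ℕ} {κ : Fin k → Fin k → Fin (k - 2) ⊕ Fin 3}

namespace IsCellColouring

lemma transpose (h : IsCellColouring κ) : IsCellColouring fun i j => κ j i :=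
  ⟨h.three_le, h.col_inj, h.row_inj, h.col_surj, h.row_surj⟩

/-- A row has `k` cells and there are `k + 1` colours, so exactly one colour is missing, and it is
one of the three special ones. `row_or` expresses that no two are missing. -/
lemma exists_row_ne (h : IsCellColouring κ) (i : Fin k) : ∃ α, ∀ j, κ i j ≠ .inr α := by
  by_contra! hno
  have hs : Function.Surjective (κ i) := by
    rintro (t | α)
    exacts [h.row_surj i t, hno α]
  have h1 := Fintype.card_le_of_surjective _ hs
  have := h.three_le
  simp only [Fintype.card_sum, Fintype.card_fin] at h1
  omega

lemma row_or (h : IsCellColouring κ) (i : Fin k) {α β : Fin 3} (hαβ : α ≠ β) :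
    (∃ j, κ i j = .inr α) ∨ ∃ j, κ i j = .inr β := by
  by_contra! hno
  have h1 : (univ.image (κ i)) ⊆ (univ.erase (.inr α)).erase (.inr β) := by
    intro c hc
    obtain ⟨j, -, rfl⟩ := mem_image.1 hc
    simp [hno.1 j, hno.2 j]
  have h2 := card_le_card h1
  have := h.three_le
  rw [card_image_of_injective _ (h.row_inj i), card_erase_of_mem (by simp [hαβ.symm]),
    card_erase_of_mem (by simp)] at h2
  simp only [card_univ, Fintype.card_sum, Fintype.card_fin] at h2
  omega

lemma exists_col_ne (h : IsCellColouring κ) (j : Fin k) : ∃ α, ∀ i, κ i j ≠ .inr α :=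
  h.transpose.exists_row_ne j

lemma col_or (h : IsCellColouring κ) (j : Fin k) {α β : Fin 3} (hαβ : α ≠ β) :
    (∃ i, κ i j = .inr α) ∨ ∃ i, κ i j = .inr β :=
  h.transpose.row_or j hαβ

/-- A row with two of the colours `inr α` does not contain the third. -/
lemma row_ne (h : IsCellColouring κ) {i : Fin k} {α β γ : Fin 3} (hαβ : α ≠ β) (hαγ : α ≠ γ)
    (hβγ : β ≠ γ) {j j' : Fin k} (hj : κ i j = .inr α) (hj' : κ i j' = .inr β) (l : Fin k) :
    κ i l ≠ .inr γ := by
  intro hl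
  obtain ⟨δ, hδ⟩ := h.exists_row_ne i
  have : ∀ α β γ δ : Fin 3, α ≠ β → α ≠ γ → β ≠ γ → δ = α ∨ δ = β ∨ δ = γ := by decide
  obtain rfl | rfl | rfl := this α β γ δ hαβ hαγ hβγ
  exacts [hδ j hj, hδ j' hj', hδ l hl]

end IsCellColouring

/-- The triple `{x i, y j, κ i j}`. -/
def cell (κ : Fin k → Fin k → Fin (k - 2) ⊕ Fin 3) (q : Fin k × Fin k) :
    Finset (ColourVertices k) :=
  {.inl (.inl q.1), .inl (.inr q.2), .inr (κ q.1 q.2)}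

lemma cell_injective : Function.Injective (cell κ) := by
  rintro ⟨i, j⟩ ⟨i', j'⟩ h
  have h1 : (.inl (.inl i) : ColourVertices k) ∈ cell κ (i', j') := by rw [← h]; simp [cell]
  have h2 : (.inl (.inr j) : ColourVertices k) ∈ cell κ (i', j') := by rw [← h]; simp [cell]
  simp only [cell, mem_insert, Sum.inl.injEq, Sum.inr.injEq, mem_singleton, reduceCtorEq,
    or_false, false_or] at h1 h2
  rw [h1, h2]

lemma card_cell (q : Fin k × Fin k) : (cell κ q).card = 3 :=
  card_eq_three.2 ⟨_, _, _, by simp, by simp, by simp, rfl⟩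

lemma IsCellColouring.eq_of_mem_cell (h : IsCellColouring κ) {q q' : Fin k × Fin k}
    {u w : ColourVertices k} (huw : u ≠ w) (hu : u ∈ cell κ q) (hw : w ∈ cell κ q)
    (hu' : u ∈ cell κ q') (hw' : w ∈ cell κ q') : q = q' := by
  obtain ⟨i, j⟩ := q
  obtain ⟨i', j'⟩ := q'
  have hr := @h.row_inj i' j j'
  have hc := @h.col_inj j' i i'
  simp only [cell, mem_insert, mem_singleton] at hu hw hu' hw'
  obtain rfl | rfl | rfl := hu <;> obtain rfl | rfl | rfl := hw <;> simp_all

/-- The triples `{x i, y j, κ i j}` and the triple of the three special colours. -/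
def closedModel (κ : Fin k → Fin k → Fin (k - 2) ⊕ Fin 3) : Finset (Finset (ColourVertices k)) :=
  univ.image (cell κ) ∪ {{.inr (.inr 0), .inr (.inr 1), .inr (.inr 2)}}

/-- The triples `{x i, y j, κ i j}` except the one with `(i, j) = (i₀, j₀)`, and two triples that
contain two of the three special colours. -/
def cornerModel (κ : Fin k → Fin k → Fin (k - 2) ⊕ Fin 3) (i₀ j₀ : Fin k) :
    Finset (Finset (ColourVertices k)) :=
  (univ.erase (i₀, j₀)).image (cell κ) ∪
    {{.inl (.inl i₀), .inr (.inr 1), .inr (.inr 2)}, {.inl (.inr j₀), .inr (.inr 0), .inr (.inr 1)}}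

/-- A cell and two further cells in its row and its column, coloured alike, do not have two of the
special colours. -/
structure IsClosedColouring (κ : Fin k → Fin k → Fin (k - 2) ⊕ Fin 3) : Prop
    extends IsCellColouring κ where
  -- Sail-freeness at the vertex `β`: the colours `α` and `β` are adjacent through the triple of
  -- special colours, so the row and the column of a cell of colour `α` cannot both contain `β`.
  no_path : ∀ i j i' j' α β, α ≠ β → κ i j = .inr α → κ i' j = .inr β → κ i j' ≠ .inr β

/-- The corner `(i₀, j₀)` has colour `1`, every other row contains `γ` and every other column
contains `α`, while the row and the column of the corner contain `α` and `γ`, respectively. -/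
structure IsCornerColouring (κ : Fin k → Fin k → Fin (k - 2) ⊕ Fin 3) (α γ : Fin 3)
    (i₀ j₀ : Fin k) : Prop extends IsCellColouring κ where
  ne : α ≠ γ
  left_ne : α ≠ 1
  right_ne : γ ≠ 1
  corner : κ i₀ j₀ = .inr 1
  row : ∀ i, i ≠ i₀ → ∃ j, κ i j = .inr γ
  col : ∀ j, j ≠ j₀ → ∃ i, κ i j = .inr α
  row_corner : ∃ j, κ i₀ j = .inr α
  col_corner : ∃ i, κ i j₀ = .inr γ
  no_path : ∀ i j i' j' δ, δ ≠ 1 → κ i j = .inr δ → κ i' j = .inr 1 → κ i j' ≠ .inr 1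

lemma IsClosedColouring.transpose (h : IsClosedColouring κ) :
    IsClosedColouring fun i j => κ j i where
  toIsCellColouring := h.toIsCellColouring.transpose
  no_path i j i' j' α β hαβ h1 h2 h3 := h.no_path j i j' i' α β hαβ h1 h3 h2

/-- Transposition exchanges the colours 0 and 2, which is why they are parameters of the structure.
-/
lemma IsCornerColouring.transpose {α γ : Fin 3} {i₀ j₀ : Fin k}
    (h : IsCornerColouring κ α γ i₀ j₀) : IsCornerColouring (fun i j => κ j i) γ α j₀ i₀ where
  toIsCellColouring := h.toIsCellColouring.transpose
  ne := h.ne.symm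
  left_ne := h.right_ne
  right_ne := h.left_ne
  corner := h.corner
  row := h.col
  col := h.row
  row_corner := h.col_corner
  col_corner := h.row_corner
  no_path i j i' j' δ hδ h1 h2 h3 := h.no_path j i j' i' δ hδ h1 h3 h2

end Colouring
end SailTuran

namespace SailTuran
open Finset

/-! ### The hypergraphs of closed and corner colourings are linear and sail-free. -/

section ColouringModels

variable {k : ℕ} {κ : Fin k → Fin k → Fin (k - 2) ⊕ Fin 3}

lemma mem_closedModel {e : Finset (ColourVertices k)} : e ∈ closedModel κ ↔
    (∃ i j, e = cell κ (i, j)) ∨ e = {.inr (.inr 0), .inr (.inr 1), .inr (.inr 2)} := by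
  simp only [closedModel, mem_union, mem_image, mem_univ, true_and, Prod.exists, mem_singleton,
    eq_comm]

lemma mem_cornerModel {i₀ j₀ : Fin k} {e : Finset (ColourVertices k)} :
    e ∈ cornerModel κ i₀ j₀ ↔
    (∃ i j, (i, j) ≠ (i₀, j₀) ∧ e = cell κ (i, j)) ∨
      e = {.inl (.inl i₀), .inr (.inr 1), .inr (.inr 2)} ∨
      e = {.inl (.inr j₀), .inr (.inr 0), .inr (.inr 1)} := by
  simp only [cornerModel, mem_union, mem_image, mem_univ, mem_erase, and_true, Prod.exists,
    mem_singleton, mem_insert, eq_comm]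

lemma mem_cell {i j : Fin k} {u : ColourVertices k} : u ∈ cell κ (i, j) ↔
    u = .inl (.inl i) ∨ u = .inl (.inr j) ∨ u = .inr (κ i j) := by
  simp [cell]

lemma card_closedModel (κ : Fin k → Fin k → Fin (k - 2) ⊕ Fin 3) :
    (closedModel κ).card = k ^ 2 + 1 := by
  rw [closedModel, card_union_of_disjoint, card_image_of_injective _ cell_injective]
  · simp [sq]
  · rw [disjoint_singleton_right]
    simp only [mem_image, mem_univ, true_and, Prod.exists, not_exists]
    intro i j h
    have : (.inl (.inl i) : ColourVertices k) ∈ cell κ (i, j) := mem_cell.2 (.inl rfl)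
    simp [h] at this

lemma card_cornerModel (κ : Fin k → Fin k → Fin (k - 2) ⊕ Fin 3) (i₀ j₀ : Fin k) :
    (cornerModel κ i₀ j₀).card = k ^ 2 + 1 := by
  rw [cornerModel, card_union_of_disjoint, card_image_of_injective _ cell_injective,
    card_erase_of_mem (mem_univ _), card_pair]
  · simp only [card_univ, Fintype.card_prod, Fintype.card_fin]
    have := Nat.mul_pos i₀.pos i₀.pos
    rw [sq]; omega
  · intro h
    have : (.inl (.inl i₀) : ColourVertices k) ∈
        ({.inl (.inr j₀), .inr (.inr 0), .inr (.inr 1)} : Finset (ColourVertices k)) := by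
      rw [← h]; simp
    simp at this
  · simp only [disjoint_left, mem_image, mem_erase, mem_univ, and_true, Prod.exists,
      mem_insert, mem_singleton, not_or]
    rintro e ⟨i, j, -, rfl⟩
    constructor <;> intro h
    · have : (.inl (.inr j) : ColourVertices k) ∈ cell κ (i, j) := mem_cell.2 (.inr (.inl rfl))
      simp [h] at this
    · have : (.inl (.inl i) : ColourVertices k) ∈ cell κ (i, j) := mem_cell.2 (.inl rfl)
      simp [h] at this

lemma isLinearFree_of_far {V : Type*} [DecidableEq V] [Fintype V] {H : Finset (Finset V)}
    (h₁ : ∀ e ∈ H, e.card = 3)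
    (h₂ : ∀ e ∈ H, ∀ f ∈ H, ∀ u w, u ≠ w → u ∈ e → w ∈ e → u ∈ f → w ∈ f → e = f)
    (h₃ : ∀ v, ∀ g ∈ H, ∃ u ∈ g, ∀ e ∈ H, v ∈ e → u ∈ e → u = v) : IsLinearFree 3 sail H := by
  refine ⟨h₁, isLinear_iff.2 h₂, not_containsCopy_sail fun v g hg => ?_⟩
  obtain ⟨u, hu, hu'⟩ := h₃ v g hg
  exact ⟨u, mem_inter.2 ⟨hu, mem_far.2 hu'⟩⟩

/-- For a row vertex, each cell has its own row vertex in the far set, and the special triple has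
the colour missing in that row; columns are alike. For a special colour `α` and a cell of another
special colour, `no_path` says that `α` is missing in the row or in the column of the cell. -/
lemma IsClosedColouring.isLinearFree (h : IsClosedColouring κ) :
    IsLinearFree 3 sail (closedModel κ) := by
  have hcell : ∀ i j, ∀ u w : ColourVertices k, u ≠ w → u ∈ cell κ (i, j) → w ∈ cell κ (i, j) →
      u ∈ ({.inr (.inr 0), .inr (.inr 1), .inr (.inr 2)} : Finset (ColourVertices k)) →
      w ∈ ({.inr (.inr 0), .inr (.inr 1), .inr (.inr 2)} : Finset (ColourVertices k)) → False := by
    intro i j u w huw hu hw hu' hw'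
    simp only [mem_insert, mem_singleton] at hu' hw'
    rw [mem_cell] at hu hw
    obtain rfl | rfl | rfl := hu' <;> obtain rfl | rfl | rfl := hw' <;> simp_all
  refine isLinearFree_of_far ?_ ?_ ?_
  · intro e he
    obtain ⟨i, j, rfl⟩ | rfl := mem_closedModel.1 he
    · exact card_cell _
    · exact card_eq_three.2 ⟨_, _, _, by simp, by simp, by simp, rfl⟩
  · intro e he f hf u w huw hu hw hu' hw'
    obtain ⟨i, j, rfl⟩ | rfl := mem_closedModel.1 he <;>
      obtain ⟨i', j', rfl⟩ | rfl := mem_closedModel.1 hf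
    · rw [h.eq_of_mem_cell huw hu hw hu' hw']
    · exact (hcell _ _ u w huw hu hw hu' hw').elim
    · exact (hcell _ _ u w huw hu' hw' hu hw).elim
    · rfl
  · rintro ((i | j) | t | α) g hg
    · obtain ⟨i', j', rfl⟩ | rfl := mem_closedModel.1 hg
      · refine ⟨.inl (.inl i'), mem_cell.2 (.inl rfl), fun e he => ?_⟩
        obtain ⟨i'', j'', rfl⟩ | rfl := mem_closedModel.1 he <;> simp +contextual [mem_cell]
      · obtain ⟨α, hα⟩ := h.exists_row_ne i
        refine ⟨.inr (.inr α), by fin_cases α <;> simp, fun e he => ?_⟩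
        obtain ⟨i'', j'', rfl⟩ | rfl := mem_closedModel.1 he
        · simp only [mem_cell, Sum.inl.injEq, reduceCtorEq, or_false, false_or, Sum.inr.injEq]
          rintro rfl h'
          exact hα _ h'.symm
        · simp
    · obtain ⟨i', j', rfl⟩ | rfl := mem_closedModel.1 hg
      · refine ⟨.inl (.inr j'), mem_cell.2 (.inr (.inl rfl)), fun e he => ?_⟩
        obtain ⟨i'', j'', rfl⟩ | rfl := mem_closedModel.1 he <;> simp +contextual [mem_cell]
      · obtain ⟨α, hα⟩ := h.exists_col_ne j
        refine ⟨.inr (.inr α), by fin_cases α <;> simp, fun e he => ?_⟩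
        obtain ⟨i'', j'', rfl⟩ | rfl := mem_closedModel.1 he
        · simp only [mem_cell, Sum.inl.injEq, reduceCtorEq, or_false, false_or, Sum.inr.injEq]
          rintro rfl h'
          exact hα _ h'.symm
        · simp
    · obtain ⟨s, hs⟩ : ∃ s, (.inr s : ColourVertices k) ∈ g := by
        obtain ⟨i', j', rfl⟩ | rfl := mem_closedModel.1 hg
        · exact ⟨_, mem_cell.2 (.inr (.inr rfl))⟩
        · exact ⟨.inr 0, by simp⟩
      refine ⟨_, hs, fun e he => ?_⟩
      obtain ⟨i'', j'', rfl⟩ | rfl := mem_closedModel.1 he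
      · simp +contextual [mem_cell]
      · simp
    · obtain ⟨i, j, rfl⟩ | rfl := mem_closedModel.1 hg
      · obtain ⟨t, ht⟩ | ⟨β, hβ⟩ : (∃ t, κ i j = .inl t) ∨ ∃ β, κ i j = .inr β := by
          cases κ i j <;> simp
        · refine ⟨.inr (.inl t), mem_cell.2 (.inr (.inr (by rw [ht]))), fun e he => ?_⟩
          obtain ⟨i'', j'', rfl⟩ | rfl := mem_closedModel.1 he
          · simp +contextual [mem_cell, eq_comm]
          · simp
        · by_cases hαβ : β = α
          · subst hαβ
            exact ⟨.inr (.inr β), mem_cell.2 (.inr (.inr (by rw [hβ]))), fun e he _ _ => rfl⟩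
          by_cases hcol : ∃ i', κ i' j = .inr α
          · obtain ⟨i', hi'⟩ := hcol
            refine ⟨.inl (.inl i), mem_cell.2 (.inl rfl), fun e he => ?_⟩
            obtain ⟨i'', j'', rfl⟩ | rfl := mem_closedModel.1 he
            · simp only [mem_cell, reduceCtorEq, Sum.inr.injEq, false_or, Sum.inl.injEq, or_false,
                imp_false]
              rintro h' rfl
              exact h.no_path _ _ _ _ _ _ hαβ hβ hi' h'.symm
            · simp
          · refine ⟨.inl (.inr j), mem_cell.2 (.inr (.inl rfl)), fun e he => ?_⟩
            obtain ⟨i'', j'', rfl⟩ | rfl := mem_closedModel.1 he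
            · simp only [mem_cell, reduceCtorEq, Sum.inr.injEq, false_or, Sum.inl.injEq, or_false,
                imp_false]
              rintro h' rfl
              exact hcol ⟨_, h'.symm⟩
            · simp
      · exact ⟨.inr (.inr α), by fin_cases α <;> simp, fun e he _ _ => rfl⟩

namespace IsCornerColouring

variable {i₀ j₀ : Fin k}

lemma row_corner_ne (h : IsCornerColouring κ 0 2 i₀ j₀) {j : Fin k} (hj : j ≠ j₀) :
    κ i₀ j ≠ .inr 1 ∧ κ i₀ j ≠ .inr 2 := by
  obtain ⟨ja, hja⟩ := h.row_corner
  exact ⟨fun h' => hj (h.row_inj _ (h'.trans h.corner.symm)),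
    h.row_ne (by decide) (by decide) (by decide) h.corner hja j⟩

lemma col_corner_ne (h : IsCornerColouring κ 0 2 i₀ j₀) {i : Fin k} (hi : i ≠ i₀) :
    κ i j₀ ≠ .inr 0 ∧ κ i j₀ ≠ .inr 1 := by
  obtain ⟨ic, hic⟩ := h.col_corner
  exact ⟨h.transpose.row_ne (by decide) (by decide) (by decide) h.corner hic i,
    fun h' => hi (h.col_inj j₀ (h'.trans h.corner.symm))⟩

lemma not_mem_of_mem_cell_left (h : IsCornerColouring κ 0 2 i₀ j₀) {i j : Fin k}
    (hij : (i, j) ≠ (i₀, j₀)) {u w : ColourVertices k} (huw : u ≠ w) (hu : u ∈ cell κ (i, j))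
    (hw : w ∈ cell κ (i, j))
    (hu' : u ∈ ({.inl (.inl i₀), .inr (.inr 1), .inr (.inr 2)} : Finset (ColourVertices k))) :
    w ∉ ({.inl (.inl i₀), .inr (.inr 1), .inr (.inr 2)} : Finset (ColourVertices k)) := by
  intro hw'
  have h1 : i = i₀ → κ i j ≠ .inr 1 ∧ κ i j ≠ .inr 2 := by
    rintro rfl
    exact h.row_corner_ne fun h' => hij (h' ▸ rfl)
  rw [mem_cell] at hu hw
  obtain rfl | rfl | rfl := hu <;> obtain rfl | rfl | rfl := hw <;>
    simp only [mem_insert, mem_singleton, Sum.inl.injEq, Sum.inr.injEq, reduceCtorEq, or_false,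
      false_or, ne_eq, not_true] at huw hu' hw'
  · exact hw'.elim (h1 hu').1 (h1 hu').2
  · exact hu'.elim (h1 hw').1 (h1 hw').2

lemma not_mem_of_mem_cell_right (h : IsCornerColouring κ 0 2 i₀ j₀) {i j : Fin k}
    (hij : (i, j) ≠ (i₀, j₀)) {u w : ColourVertices k} (huw : u ≠ w) (hu : u ∈ cell κ (i, j))
    (hw : w ∈ cell κ (i, j))
    (hu' : u ∈ ({.inl (.inr j₀), .inr (.inr 0), .inr (.inr 1)} : Finset (ColourVertices k))) :
    w ∉ ({.inl (.inr j₀), .inr (.inr 0), .inr (.inr 1)} : Finset (ColourVertices k)) := by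
  intro hw'
  have h1 : j = j₀ → κ i j ≠ .inr 0 ∧ κ i j ≠ .inr 1 := by
    rintro rfl
    exact h.col_corner_ne fun h' => hij (h' ▸ rfl)
  rw [mem_cell] at hu hw
  obtain rfl | rfl | rfl := hu <;> obtain rfl | rfl | rfl := hw <;>
    simp only [mem_insert, mem_singleton, Sum.inl.injEq, Sum.inr.injEq, reduceCtorEq, or_false,
      false_or, ne_eq, not_true] at huw hu' hw'
  · exact hw'.elim (h1 hu').1 (h1 hu').2
  · exact hu'.elim (h1 hw').1 (h1 hw').2

lemma eq_of_mem (h : IsCornerColouring κ 0 2 i₀ j₀) :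
    ∀ e ∈ cornerModel κ i₀ j₀, ∀ f ∈ cornerModel κ i₀ j₀, ∀ u w, u ≠ w → u ∈ e → w ∈ e →
      u ∈ f → w ∈ f → e = f := by
  have hXY : ∀ u w : ColourVertices k, u ≠ w →
      u ∈ ({.inl (.inl i₀), .inr (.inr 1), .inr (.inr 2)} : Finset (ColourVertices k)) →
      w ∈ ({.inl (.inl i₀), .inr (.inr 1), .inr (.inr 2)} : Finset (ColourVertices k)) →
      u ∈ ({.inl (.inr j₀), .inr (.inr 0), .inr (.inr 1)} : Finset (ColourVertices k)) →
      w ∈ ({.inl (.inr j₀), .inr (.inr 0), .inr (.inr 1)} : Finset (ColourVertices k)) → False := by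
    intro u w huw hu hw hu' hw'
    simp only [mem_insert, mem_singleton] at hu hw
    obtain rfl | rfl | rfl := hu <;> obtain rfl | rfl | rfl := hw <;> simp at huw hu' hw'
  intro e he f hf u w huw hu hw hu' hw'
  obtain ⟨i, j, hij, rfl⟩ | rfl | rfl := mem_cornerModel.1 he <;>
    obtain ⟨i', j', hij', rfl⟩ | rfl | rfl := mem_cornerModel.1 hf
  · rw [h.eq_of_mem_cell huw hu hw hu' hw']
  · exact absurd hw' (h.not_mem_of_mem_cell_left hij huw hu hw hu')
  · exact absurd hw' (h.not_mem_of_mem_cell_right hij huw hu hw hu')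
  · exact absurd hw (h.not_mem_of_mem_cell_left hij' huw hu' hw' hu)
  · rfl
  · exact (hXY u w huw hu hw hu' hw').elim
  · exact absurd hw (h.not_mem_of_mem_cell_right hij' huw hu' hw' hu)
  · exact (hXY u w huw hu' hw' hu hw).elim
  · rfl

lemma mem_far_of_forall {v u : ColourVertices k}
    (h₁ : ∀ i j, (i, j) ≠ (i₀, j₀) → v ∈ cell κ (i, j) → u ∈ cell κ (i, j) → u = v)
    (h₂ : v ∈ ({.inl (.inl i₀), .inr (.inr 1), .inr (.inr 2)} : Finset (ColourVertices k)) →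
      u ∈ ({.inl (.inl i₀), .inr (.inr 1), .inr (.inr 2)} : Finset (ColourVertices k)) → u = v)
    (h₃ : v ∈ ({.inl (.inr j₀), .inr (.inr 0), .inr (.inr 1)} : Finset (ColourVertices k)) →
      u ∈ ({.inl (.inr j₀), .inr (.inr 0), .inr (.inr 1)} : Finset (ColourVertices k)) → u = v) :
    u ∈ far (cornerModel κ i₀ j₀) v := by
  rw [mem_far]
  intro e he
  obtain ⟨i, j, hij, rfl⟩ | rfl | rfl := mem_cornerModel.1 he
  exacts [h₁ i j hij, h₂, h₃]

lemma left_mem_far (i i' : Fin k) :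
    (.inl (.inl i') : ColourVertices k) ∈ far (cornerModel κ i₀ j₀) (.inl (.inl i)) := by
  apply mem_far_of_forall <;> simp +contextual [mem_cell]

lemma right_mem_far (j j' : Fin k) :
    (.inl (.inr j') : ColourVertices k) ∈ far (cornerModel κ i₀ j₀) (.inl (.inr j)) := by
  apply mem_far_of_forall <;> simp +contextual [mem_cell]

lemma colour_mem_far {c d : Fin (k - 2) ⊕ Fin 3} (hc : c = .inr 1 → d ≠ .inr 0 ∧ d ≠ .inr 2)
    (hd : d = .inr 1 → c ≠ .inr 0 ∧ c ≠ .inr 2) :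
    (.inr d : ColourVertices k) ∈ far (cornerModel κ i₀ j₀) (.inr c) := by
  apply mem_far_of_forall
  · simp +contextual [mem_cell]
  · simp only [mem_insert, mem_singleton, reduceCtorEq, false_or, Sum.inr.injEq]
    grind
  · simp only [mem_insert, mem_singleton, reduceCtorEq, false_or, Sum.inr.injEq]
    grind

/-- The critical edge is the triple of `y j₀` with the colours 0 and 1. A row other than `i₀`
contains 2, so it misses 0 or 1; for `i = i₀` the vertex `y j₀` is far, since the corner cell
carries no edge. -/
lemma exists_mem_far_left (h : IsCornerColouring κ 0 2 i₀ j₀) (i : Fin k)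
    {g : Finset (ColourVertices k)} (hg : g ∈ cornerModel κ i₀ j₀) :
    ∃ u ∈ g, u ∈ far (cornerModel κ i₀ j₀) (.inl (.inl i)) := by
  obtain ⟨i', j', -, rfl⟩ | rfl | rfl := mem_cornerModel.1 hg
  · exact ⟨_, mem_cell.2 (.inl rfl), left_mem_far i i'⟩
  · exact ⟨_, by simp, left_mem_far i i₀⟩
  · by_cases hi : i = i₀
    · refine ⟨.inl (.inr j₀), by simp, mem_far_of_forall ?_ ?_ ?_⟩
      · simp only [mem_cell, Sum.inl.injEq, reduceCtorEq, or_false, false_or, Sum.inr.injEq]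
        rintro i' j' hij rfl rfl
        exact absurd (hi ▸ rfl) hij
      · simp
      · simp
    · obtain ⟨δ, hδ⟩ := h.exists_row_ne i
      obtain ⟨j, hj⟩ := h.row i hi
      have hδ2 : δ ≠ 2 := fun h' => hδ j (h' ▸ hj)
      refine ⟨.inr (.inr δ), by fin_cases δ <;> simp_all, mem_far_of_forall ?_ ?_ ?_⟩
      · simp only [mem_cell, Sum.inl.injEq, reduceCtorEq, or_false, false_or, Sum.inr.injEq]
        rintro i' j' - rfl h'
        exact hδ _ h'.symm
      · simp [hi]
      · simp

lemma exists_mem_far_right (h : IsCornerColouring κ 0 2 i₀ j₀) (j : Fin k)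
    {g : Finset (ColourVertices k)} (hg : g ∈ cornerModel κ i₀ j₀) :
    ∃ u ∈ g, u ∈ far (cornerModel κ i₀ j₀) (.inl (.inr j)) := by
  obtain ⟨i', j', -, rfl⟩ | rfl | rfl := mem_cornerModel.1 hg
  · exact ⟨_, mem_cell.2 (.inr (.inl rfl)), right_mem_far j j'⟩
  · by_cases hj : j = j₀
    · refine ⟨.inl (.inl i₀), by simp, mem_far_of_forall ?_ ?_ ?_⟩
      · simp only [mem_cell, Sum.inl.injEq, reduceCtorEq, or_false, false_or, Sum.inr.injEq]
        rintro i' j' hij rfl rfl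
        exact absurd (hj ▸ rfl) hij
      · simp
      · simp
    · obtain ⟨δ, hδ⟩ := h.exists_col_ne j
      obtain ⟨i, hi⟩ := h.col j hj
      have hδ2 : δ ≠ 0 := fun h' => hδ i (h' ▸ hi)
      refine ⟨.inr (.inr δ), by fin_cases δ <;> simp_all, mem_far_of_forall ?_ ?_ ?_⟩
      · simp only [mem_cell, Sum.inl.injEq, reduceCtorEq, or_false, false_or, Sum.inr.injEq]
        rintro i' j' - rfl h'
        exact hδ _ h'.symm
      · simp
      · simp [hj]
  · exact ⟨_, by simp, right_mem_far j j₀⟩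

/-- Different colours are adjacent only if one is 1 and the other is 0 or 2; in all other cases the
colour of the cell is far from `c`. If `c = 1`, the row or the column of the cell misses it by
`no_path`. If the cell has colour 1, its row also contains 2 and hence misses 0, and its column
contains 0 and hence misses 2. -/
lemma exists_mem_far_colour (h : IsCornerColouring κ 0 2 i₀ j₀) (c : Fin (k - 2) ⊕ Fin 3)
    {g : Finset (ColourVertices k)} (hg : g ∈ cornerModel κ i₀ j₀) :
    ∃ u ∈ g, u ∈ far (cornerModel κ i₀ j₀) (.inr c) := by
  obtain ⟨i, j, hij, rfl⟩ | rfl | rfl := mem_cornerModel.1 hg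
  · by_cases hc : c = .inr 1 ∧ (κ i j = .inr 0 ∨ κ i j = .inr 2)
    · obtain ⟨rfl, hκ⟩ := hc
      obtain ⟨δ, hδ, hκ⟩ : ∃ δ, δ ≠ 1 ∧ κ i j = .inr δ := by
        obtain h' | h' := hκ
        exacts [⟨0, by decide, h'⟩, ⟨2, by decide, h'⟩]
      by_cases hcol : ∃ i', κ i' j = .inr 1
      · obtain ⟨i', hi'⟩ := hcol
        have hno := fun j' => h.no_path i j i' j' δ hδ hκ hi'
        have hi : i ≠ i₀ := fun h' => hno j₀ (h' ▸ h.corner)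
        refine ⟨.inl (.inl i), mem_cell.2 (.inl rfl), mem_far_of_forall ?_ ?_ ?_⟩
        · simp only [mem_cell, Sum.inl.injEq, reduceCtorEq, or_false, false_or, Sum.inr.injEq]
          rintro i' j' - h' rfl
          exact hno _ h'.symm
        · simp [hi]
        · simp
      · have hj : j ≠ j₀ := fun h' => hcol ⟨i₀, h' ▸ h.corner⟩
        refine ⟨.inl (.inr j), mem_cell.2 (.inr (.inl rfl)), mem_far_of_forall ?_ ?_ ?_⟩
        · simp only [mem_cell, Sum.inl.injEq, reduceCtorEq, or_false, false_or, Sum.inr.injEq]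
          rintro i' j' - h' rfl
          exact hcol ⟨_, h'.symm⟩
        · simp
        · simp [hj]
    by_cases hκ : κ i j = .inr 1 ∧ (c = .inr 0 ∨ c = .inr 2)
    · obtain ⟨hκ, hc⟩ := hκ
      have hi : i ≠ i₀ := by
        rintro rfl
        exact (h.row_corner_ne (j := j) fun h' => hij (h' ▸ rfl)).1 hκ
      have hj : j ≠ j₀ := by
        rintro rfl
        exact (h.col_corner_ne (i := i) fun h' => hij (h' ▸ rfl)).2 hκ
      obtain rfl | rfl := hc
      · obtain ⟨j', hj'⟩ := h.row i hi
        refine ⟨.inl (.inl i), mem_cell.2 (.inl rfl), mem_far_of_forall ?_ ?_ ?_⟩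
        · simp only [mem_cell, Sum.inl.injEq, reduceCtorEq, or_false, false_or, Sum.inr.injEq]
          rintro i' j'' - h' rfl
          exact (h.row_ne (by decide) (by decide) (by decide) hκ hj' _ h'.symm).elim
        · simp
        · simp
      · obtain ⟨i', hi'⟩ := h.col j hj
        refine ⟨.inl (.inr j), mem_cell.2 (.inr (.inl rfl)), mem_far_of_forall ?_ ?_ ?_⟩
        · simp only [mem_cell, Sum.inl.injEq, reduceCtorEq, or_false, false_or, Sum.inr.injEq]
          rintro i'' j' - h' rfl
          exact (h.transpose.row_ne (by decide) (by decide) (by decide) hκ hi' _ h'.symm).elim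
        · simp
        · simp
    · refine ⟨_, mem_cell.2 (.inr (.inr rfl)), colour_mem_far ?_ ?_⟩
      · intro h'
        exact ⟨fun h'' => hc ⟨h', .inl h''⟩, fun h'' => hc ⟨h', .inr h''⟩⟩
      · intro h'
        exact ⟨fun h'' => hκ ⟨h', .inl h''⟩, fun h'' => hκ ⟨h', .inr h''⟩⟩
  · by_cases hc : c = .inr 1
    · exact ⟨.inr (.inr 1), by simp, hc ▸ mem_far_self _ _⟩
    · exact ⟨.inr (.inr 2), by simp, colour_mem_far (fun h' => absurd h' hc) (by simp)⟩
  · by_cases hc : c = .inr 1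
    · exact ⟨.inr (.inr 1), by simp, hc ▸ mem_far_self _ _⟩
    · exact ⟨.inr (.inr 0), by simp, colour_mem_far (fun h' => absurd h' hc) (by simp)⟩

lemma isLinearFree (h : IsCornerColouring κ 0 2 i₀ j₀) :
    IsLinearFree 3 sail (cornerModel κ i₀ j₀) := by
  refine ⟨?_, isLinear_iff.2 h.eq_of_mem, not_containsCopy_sail fun v g hg => ?_⟩
  · intro e he
    obtain ⟨i, j, -, rfl⟩ | rfl | rfl := mem_cornerModel.1 he
    · exact card_cell _
    · exact card_eq_three.2 ⟨_, _, _, by simp, by simp, by simp, rfl⟩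
    · exact card_eq_three.2 ⟨_, _, _, by simp, by simp, by simp, rfl⟩
  · obtain ⟨u, hu, hu'⟩ : ∃ u ∈ g, u ∈ far (cornerModel κ i₀ j₀) v := by
      obtain (i | j) | c := v
      exacts [h.exists_mem_far_left i hg, h.exists_mem_far_right j hg,
        h.exists_mem_far_colour c hg]
    exact ⟨u, mem_inter.2 ⟨hu, hu'⟩⟩

end IsCornerColouring
end ColouringModels
end SailTuran

namespace SailTuran
open Finset

/-! ### Hypergraphs in which no edge has two vertices in `X` or two in `Y`. -/

section Tripartite

variable {V : Type*} [DecidableEq V] [Fintype V] {k : ℕ} {H : Finset (Finset V)}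

/-- The vertices outside `far H v` have full degree and fall into two parts `X` and `Y`, neither of
which contains two vertices of an edge. -/
structure IsTripartite (k : ℕ) (H : Finset (Finset V)) (v : V) (X Y : Finset V) : Prop where
  dense : IsDense k 1 H
  defect_centre : defect k H v = 0
  defect_compl : ∀ u, u ∉ far H v → defect k H u = 0
  not_mem_left : ∀ u ∈ X, u ∉ far H v
  not_mem_right : ∀ u ∈ Y, u ∉ far H v
  cover : ∀ u, u ∉ far H v → u ∈ X ∨ u ∈ Y
  disj : Disjoint X Y
  card_left : X.card = k
  card_right : Y.card = k
  inter_left : ∀ g ∈ H, (g ∩ X).card ≤ 1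
  inter_right : ∀ g ∈ H, (g ∩ Y).card ≤ 1

namespace IsTripartite

variable {v : V} {X Y : Finset V}

lemma symm (h : IsTripartite k H v X Y) : IsTripartite k H v Y X where
  dense := h.dense
  defect_centre := h.defect_centre
  defect_compl := h.defect_compl
  not_mem_left := h.not_mem_right
  not_mem_right := h.not_mem_left
  cover := fun u hu => (h.cover u hu).symm
  disj := h.disj.symm
  card_left := h.card_right
  card_right := h.card_left
  inter_left := h.inter_right
  inter_right := h.inter_left

/-- The degrees in `X` add up to `k²`, every edge contributes at most one, and there are `k² + 1`
edges. -/
lemma exists_avoiding (h : IsTripartite k H v X Y) :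
    ∃ e ∈ H, e ∩ X = ∅ ∧ ∀ g ∈ H, g ≠ e → (g ∩ X).card = 1 := by
  have h1 := sum_deg H X
  rw [sum_const_nat fun u hu => h.dense.deg_eq_of_defect (h.defect_compl u (h.not_mem_left u hu)),
    h.card_left] at h1
  have h2 : ∑ g ∈ H, (g ∩ X).card + (H.filter fun g => g ∩ X = ∅).card = H.card := by
    rw [card_filter, card_eq_sum_ones, ← sum_add_distrib]
    refine sum_congr rfl fun g hg => ?_
    have := h.inter_left g hg
    split_ifs with h'
    · rw [h']; rfl
    · have := (nonempty_iff_ne_empty.2 h').card_pos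
      omega
  rw [← h1, h.dense.card_edges, sq] at h2
  obtain ⟨e, he⟩ := card_eq_one.1 (show (H.filter fun g => g ∩ X = ∅).card = 1 by omega)
  have hmem : ∀ g, g ∈ H ∧ g ∩ X = ∅ ↔ g = e := fun g => by
    rw [← mem_filter (p := fun g => g ∩ X = ∅), he, mem_singleton]
  refine ⟨e, ((hmem e).2 rfl).1, ((hmem e).2 rfl).2, fun g hg hne => ?_⟩
  have h3 := (nonempty_iff_ne_empty.2 fun h' => hne ((hmem g).1 ⟨hg, h'⟩)).card_pos
  have := h.inter_left g hg
  omega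

lemma exists_eq (h : IsTripartite k H v X Y) {g : Finset V} (hg : g ∈ H) (hX : (g ∩ X).card = 1)
    (hY : (g ∩ Y).card = 1) : ∃ x ∈ X, ∃ y ∈ Y, ∃ t ∈ far H v, g = {x, y, t} := by
  obtain ⟨x, hx⟩ := card_pos.1 (hX ▸ one_pos)
  obtain ⟨y, hy⟩ := card_pos.1 (hY ▸ one_pos)
  obtain ⟨t, ht⟩ := h.dense.inter_far v g hg
  rw [mem_inter] at hx hy ht
  have hxy : x ≠ y := fun h' => disjoint_left.1 h.disj hx.2 (h' ▸ hy.2)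
  have hxt : x ≠ t := fun h' => h.not_mem_left x hx.2 (h' ▸ ht.2)
  have hyt : y ≠ t := fun h' => h.not_mem_right y hy.2 (h' ▸ ht.2)
  refine ⟨x, hx.2, y, hy.2, t, ht.2, (eq_of_subset_of_card_le ?_ ?_).symm⟩
  · simp [insert_subset_iff, hx.1, hy.1, ht.1]
  · rw [h.dense.uniform g hg, card_eq_three.2 ⟨x, y, t, hxy, hxt, hyt, rfl⟩]

lemma eq_left (h : IsTripartite k H v X Y) {g : Finset V} (hg : g ∈ H) {x x' : V} (hx : x ∈ X)
    (hx' : x' ∈ X) (hxg : x ∈ g) (hxg' : x' ∈ g) : x = x' :=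
  card_le_one.1 (h.inter_left g hg) x (mem_inter.2 ⟨hxg, hx⟩) _ (mem_inter.2 ⟨hxg', hx'⟩)

/-- An edge through `x` and `y` that meets both parts. -/
lemma exists_eq_of_mem (h : IsTripartite k H v X Y) {g : Finset V} (hg : g ∈ H)
    (hX : (g ∩ X).card = 1) (hY : (g ∩ Y).card = 1) {x y : V} (hx : x ∈ X) (hy : y ∈ Y)
    (hxg : x ∈ g) (hyg : y ∈ g) : ∃ t ∈ far H v, {x, y, t} ∈ H := by
  obtain ⟨x', hx', y', hy', t, ht, rfl⟩ := h.exists_eq hg hX hY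
  obtain rfl := h.eq_left hg hx hx' hxg (by simp)
  obtain rfl := h.symm.eq_left hg hy hy' hyg (by simp)
  exact ⟨t, ht, hg⟩

/-- An edge through `x` and `t` that meets both parts. -/
lemma exists_eq_of_mem_far (h : IsTripartite k H v X Y) {g : Finset V} (hg : g ∈ H)
    (hX : (g ∩ X).card = 1) (hY : (g ∩ Y).card = 1) {x t : V} (hx : x ∈ X) (ht : t ∈ far H v)
    (hxg : x ∈ g) (htg : t ∈ g) : ∃ y ∈ Y, {x, y, t} ∈ H := by
  obtain ⟨x', hx', y', hy', t', ht', rfl⟩ := h.exists_eq hg hX hY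
  obtain rfl := h.eq_left hg hx hx' hxg (by simp)
  have htx : t ≠ x := fun h' => h.not_mem_left x hx (h' ▸ ht)
  have hty : t ≠ y' := fun h' => h.not_mem_right y' hy' (h' ▸ ht)
  simp only [mem_insert, htx, hty, mem_singleton, false_or] at htg
  exact ⟨y', hy', htg ▸ hg⟩

lemma left_subset_far (h : IsTripartite k H v X Y) {x : V} (hx : x ∈ X) : X ⊆ far H x :=
  fun _ hx' => mem_far.2 fun _ he hxe hxe' => h.eq_left he hx' hx hxe' hxe

/-- The `k` edges at `x` lead to `k` different vertices of `Y`, which are all of them. -/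
lemma right_not_mem_far (h : IsTripartite k H v X Y) {x : V} (hx : x ∈ X)
    (hxY : ∀ g ∈ H, x ∈ g → (g ∩ Y).card = 1) {y : V} (hy : y ∈ Y) : y ∉ far H x := by
  have h1 := card_sdiff_far h.dense.linear x Y
  have hxn : x ∉ Y := disjoint_left.1 h.disj hx
  rw [sum_const_nat (m := 1) fun g hg => ?_] at h1
  · have h2 : (H.filter (x ∈ ·)).card = k :=
      h.dense.deg_eq_of_defect (h.defect_compl x (h.not_mem_left x hx))
    rw [h2, mul_one, ← h.card_right] at h1
    have h3 := eq_of_subset_of_card_le sdiff_subset h1.ge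
    rw [← h3] at hy
    exact (mem_sdiff.1 hy).2
  · rw [mem_filter] at hg
    rw [erase_eq_of_notMem (by simp [hxn]), hxY g hg.1 hg.2]

/-- The far set has `k + 1` elements and contains `X`; the additional one is not in `Y`, as `x` is
adjacent to all of `Y`. -/
lemma far_left (h : IsTripartite k H v X Y) {x : V} (hx : x ∈ X)
    (hxY : ∀ g ∈ H, x ∈ g → (g ∩ Y).card = 1) : ∃ τ ∈ far H v, far H x = insert τ X := by
  have h1 := h.dense.card_far_of_defect (h.defect_compl x (h.not_mem_left x hx))
  have h2 := card_sdiff_of_subset (h.left_subset_far hx)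
  rw [h1, h.card_left, Nat.add_sub_cancel_left] at h2
  obtain ⟨τ, hτ⟩ := card_eq_one.1 h2
  have hτm : τ ∈ far H x \ X := by simp [hτ]
  rw [mem_sdiff] at hτm
  refine ⟨τ, ?_, ?_⟩
  · by_contra hτv
    obtain h' | h' := h.cover τ hτv
    · exact hτm.2 h'
    · exact h.right_not_mem_far hx hxY h' hτm.1
  · rw [insert_eq, ← hτ, sdiff_union_of_subset (h.left_subset_far hx)]

lemma exists_equiv (h : IsTripartite k H v X Y) {a b c : V} (ha : a ∈ far H v) (hb : b ∈ far H v)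
    (hc : c ∈ far H v) (hab : a ≠ b) (hac : a ≠ c) (hbc : b ≠ c) :
    ∃ E : ColourVertices k ≃ V, (∀ i, E (.inl (.inl i)) ∈ X) ∧ (∀ j, E (.inl (.inr j)) ∈ Y) ∧
      (∀ d, E (.inr d) ∈ far H v) ∧ E (.inr (.inr 0)) = a ∧ E (.inr (.inr 1)) = b ∧
      E (.inr (.inr 2)) = c ∧ (∀ t, E (.inr (.inl t)) ∉ ({a, b, c} : Finset V)) ∧
      (∀ x ∈ X, ∃ i, E (.inl (.inl i)) = x) ∧ ∀ y ∈ Y, ∃ j, E (.inl (.inr j)) = y := by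
  have hk := h.dense.three_le
  have hT : (far H v \ {a, b, c}).card = k - 2 := by
    rw [card_sdiff_of_subset (by simp [insert_subset_iff, ha, hb, hc]),
      h.dense.card_far_of_defect h.defect_centre, card_eq_three.2 ⟨a, b, c, hab, hac, hbc, rfl⟩]
    omega
  let eX := X.equivFinOfCardEq h.card_left
  let eY := Y.equivFinOfCardEq h.card_right
  let eT := (far H v \ {a, b, c}).equivFinOfCardEq hT
  have hX : ∀ i, (eX.symm i : V) ∈ X := fun i => (eX.symm i).2
  have hY : ∀ i, (eY.symm i : V) ∈ Y := fun i => (eY.symm i).2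
  have hT' : ∀ i, (eT.symm i : V) ∈ far H v \ {a, b, c} := fun i => (eT.symm i).2
  let f : ColourVertices k → V := Sum.elim (Sum.elim (fun i => eX.symm i) fun j => eY.symm j)
    (Sum.elim (fun t => eT.symm t) ![a, b, c])
  have hfd : ∀ d, f (.inr d) ∈ far H v := by
    rintro (t | α)
    · exact (mem_sdiff.1 (hT' t)).1
    · fin_cases α
      exacts [ha, hb, hc]
  have habc : ∀ α, ![a, b, c] α ∈ ({a, b, c} : Finset V) := by
    intro α; fin_cases α <;> simp
  have hf : Function.Injective f := by
    refine Function.Injective.sumElim (Function.Injective.sumElim ?_ ?_ ?_)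
      (Function.Injective.sumElim ?_ (injective_vec_three hab hac hbc) ?_) ?_
    · exact Subtype.val_injective.comp eX.symm.injective
    · exact Subtype.val_injective.comp eY.symm.injective
    · exact fun i j h' => disjoint_left.1 h.disj (hX i) (h' ▸ hY j)
    · exact Subtype.val_injective.comp eT.symm.injective
    · exact fun t α h' => (mem_sdiff.1 (hT' t)).2 (h' ▸ habc α)
    · rintro (i | j) d h'
      · exact h.not_mem_left _ (hX i) (by rw [show (eX.symm i : V) = _ from h']; exact hfd d)
      · exact h.not_mem_right _ (hY j) (by rw [show (eY.symm j : V) = _ from h']; exact hfd d)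
  have hfb : Function.Bijective f := by
    refine (Fintype.bijective_iff_injective_and_card f).2 ⟨hf, ?_⟩
    simp only [Fintype.card_sum, Fintype.card_fin, h.dense.card_vertices]
    omega
  refine ⟨Equiv.ofBijective f hfb, hX, hY, hfd, rfl, rfl, rfl, fun t => (mem_sdiff.1 (hT' t)).2,
    fun x hx => ⟨eX ⟨x, hx⟩, ?_⟩, fun y hy => ⟨eY ⟨y, hy⟩, ?_⟩⟩
  · change (eX.symm (eX ⟨x, hx⟩) : V) = x
    simp
  · change (eY.symm (eY ⟨y, hy⟩) : V) = y
    simp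

end IsTripartite
end Tripartite
end SailTuran

namespace SailTuran
open Finset

/-! ### From tripartite hypergraphs to cell colourings. -/

section TripartiteColouring

variable {k : ℕ}

lemma map_cell {V : Type*} [DecidableEq V] {κ : Fin k → Fin k → Fin (k - 2) ⊕ Fin 3}
    (E : ColourVertices k ≃ V) (i j : Fin k) : (cell κ (i, j)).map E.toEmbedding =
      {E (.inl (.inl i)), E (.inl (.inr j)), E (.inr (κ i j))} := by
  simp [cell]

variable {V : Type*} [DecidableEq V] [Fintype V] {H : Finset (Finset V)}

lemma IsDense.colour_unique (hH : IsDense k 1 H) (E : ColourVertices k ≃ V) {i j : Fin k}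
    {d d' : Fin (k - 2) ⊕ Fin 3} (h : {E (.inl (.inl i)), E (.inl (.inr j)), E (.inr d)} ∈ H)
    (h' : {E (.inl (.inl i)), E (.inl (.inr j)), E (.inr d')} ∈ H) : d = d' := by
  have := hH.eq_of_mem h h' (u := E (.inl (.inl i))) (w := E (.inl (.inr j)))
    (E.injective.ne (by simp)) (by simp) (by simp) (by simp) (by simp)
  have h2 : E (.inr d) ∈
    ({E (.inl (.inl i)), E (.inl (.inr j)), E (.inr d')} : Finset V) := by rw [← this]; simp
  simpa using h2

lemma IsDense.row_unique (hH : IsDense k 1 H) (E : ColourVertices k ≃ V) {i j j' : Fin k}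
    {d : Fin (k - 2) ⊕ Fin 3} (h : {E (.inl (.inl i)), E (.inl (.inr j)), E (.inr d)} ∈ H)
    (h' : {E (.inl (.inl i)), E (.inl (.inr j')), E (.inr d)} ∈ H) : j = j' := by
  have := hH.eq_of_mem h h' (u := E (.inl (.inl i))) (w := E (.inr d))
    (E.injective.ne (by simp)) (by simp) (by simp) (by simp) (by simp)
  have h2 : E (.inl (.inr j)) ∈
    ({E (.inl (.inl i)), E (.inl (.inr j')), E (.inr d)} : Finset V) := by rw [← this]; simp
  simpa using h2

lemma IsDense.col_unique (hH : IsDense k 1 H) (E : ColourVertices k ≃ V) {i i' j : Fin k}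
    {d : Fin (k - 2) ⊕ Fin 3} (h : {E (.inl (.inl i)), E (.inl (.inr j)), E (.inr d)} ∈ H)
    (h' : {E (.inl (.inl i')), E (.inl (.inr j)), E (.inr d)} ∈ H) : i = i' := by
  have := hH.eq_of_mem h h' (u := E (.inl (.inr j))) (w := E (.inr d))
    (E.injective.ne (by simp)) (by simp) (by simp) (by simp) (by simp)
  have h2 : E (.inl (.inl i)) ∈
    ({E (.inl (.inl i')), E (.inl (.inr j)), E (.inr d)} : Finset V) := by rw [← this]; simp
  simpa using h2

namespace IsTripartite

variable {v : V} {X Y : Finset V}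

/-- Since `e` meets `far H x = X ∪ {τ}` but avoids `X`, the exceptional vertex `τ` is in `e`. So `x`
is adjacent to every vertex of `far H v` outside `e`. -/
lemma exists_cell_of_closed (h : IsTripartite k H v X Y) {e : Finset V} (he : e ∈ H)
    (heX : e ∩ X = ∅) (hX : ∀ g ∈ H, g ≠ e → (g ∩ X).card = 1)
    (hY : ∀ g ∈ H, g ≠ e → (g ∩ Y).card = 1) {x : V} (hx : x ∈ X) :
    (∀ y ∈ Y, ∃ t ∈ far H v, {x, y, t} ∈ H) ∧
      ∀ t ∈ far H v, t ∉ e → ∃ y ∈ Y, {x, y, t} ∈ H := by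
  have hxe : ∀ g, x ∈ g → g ≠ e := by
    rintro g hg rfl
    have : x ∈ g ∩ X := mem_inter.2 ⟨hg, hx⟩
    simp [heX] at this
  have hxY : ∀ g ∈ H, x ∈ g → (g ∩ Y).card = 1 := fun g hg hxg => hY g hg (hxe g hxg)
  refine ⟨fun y hy => ?_, fun t ht hte => ?_⟩
  · obtain ⟨-, g, hg, hxg, hyg⟩ := not_mem_far.1 (h.right_not_mem_far hx hxY hy)
    exact h.exists_eq_of_mem hg (hX g hg (hxe g hxg)) (hxY g hg hxg) hx hy hxg hyg
  · obtain ⟨τ, hτ, hfar⟩ := h.far_left hx hxY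
    have hτe : τ ∈ e := by
      obtain ⟨u, hu⟩ := h.dense.inter_far x e he
      rw [hfar, mem_inter, mem_insert] at hu
      obtain ⟨hue, rfl | huX⟩ := hu
      · exact hue
      · have : u ∈ e ∩ X := mem_inter.2 ⟨hue, huX⟩
        simp [heX] at this
    have htx : t ∉ far H x := by
      rw [hfar, mem_insert, not_or]
      exact ⟨fun h' => hte (h' ▸ hτe), fun h' => h.not_mem_left t h' ht⟩
    obtain ⟨-, g, hg, hxg, htg⟩ := not_mem_far.1 htx
    exact h.exists_eq_of_mem_far hg (hX g hg (hxe g hxg)) (hxY g hg hxg) hx ht hxg htg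

/-- If one edge avoids both parts, we obtain a closed colouring. -/
lemma exists_closedModel (h : IsTripartite k H v X Y) {e : Finset V} (he : e ∈ H)
    (heX : e ∩ X = ∅) (heY : e ∩ Y = ∅) (hX : ∀ g ∈ H, g ≠ e → (g ∩ X).card = 1)
    (hY : ∀ g ∈ H, g ≠ e → (g ∩ Y).card = 1) :
    ∃ (E : ColourVertices k ≃ V) (κ : _), IsClosedColouring κ ∧ H = relabel E (closedModel κ) := by
  have heT : ∀ u ∈ e, u ∈ far H v := by
    intro u hu
    by_contra huv
    obtain h' | h' := h.cover u huv
    · have : u ∈ e ∩ X := mem_inter.2 ⟨hu, h'⟩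
      simp [heX] at this
    · have : u ∈ e ∩ Y := mem_inter.2 ⟨hu, h'⟩
      simp [heY] at this
  obtain ⟨a, b, c, hab, hac, hbc, rfl⟩ := card_eq_three.1 (h.dense.uniform e he)
  obtain ⟨E, hEX, hEY, hET, h0, h1, h2, hEz, -, -⟩ := h.exists_equiv (heT a (by simp))
    (heT b (by simp)) (heT c (by simp)) hab hac hbc
  have hα : ∀ α, E (.inr (.inr α)) ∈ ({a, b, c} : Finset V) := by
    intro α; fin_cases α <;> simp [h0, h1, h2]
  have hκ : ∀ i j, ∃ d, {E (.inl (.inl i)), E (.inl (.inr j)), E (.inr d)} ∈ H := by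
    intro i j
    obtain ⟨t, ht, htH⟩ := (h.exists_cell_of_closed he heX hX hY (hEX i)).1 _ (hEY j)
    obtain ⟨(i' | j') | d, rfl⟩ := E.surjective t
    · exact absurd ht (h.not_mem_left _ (hEX i'))
    · exact absurd ht (h.not_mem_right _ (hEY j'))
    · exact ⟨d, htH⟩
  choose κ hκ using hκ
  have huniq : ∀ i j d, {E (.inl (.inl i)), E (.inl (.inr j)), E (.inr d)} ∈ H → κ i j = d :=
    fun i j d hd => h.dense.colour_unique E (hκ i j) hd
  have hcol : IsClosedColouring κ := by
    refine ⟨⟨h.dense.three_le, fun i j j' hj => ?_, fun j i i' hi => ?_, fun i t => ?_,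
      fun j t => ?_⟩, fun i j i' j' α β hαβ hκα hκβ hκβ' => ?_⟩
    · exact h.dense.row_unique E (hκ i j) (hj ▸ hκ i j')
    · have hi : κ i j = κ i' j := hi
      exact h.dense.col_unique E (hκ i j) (hi ▸ hκ i' j)
    · obtain ⟨y, hy, hyH⟩ := (h.exists_cell_of_closed he heX hX hY (hEX i)).2 _ (hET _) (hEz t)
      obtain ⟨(i' | j) | d, rfl⟩ := E.surjective y
      · exact absurd hy (disjoint_left.1 h.disj (hEX i'))
      · exact ⟨j, huniq i j _ hyH⟩
      · exact absurd (hET d) (h.not_mem_right _ hy)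
    · obtain ⟨y, hy, hyH⟩ := (h.symm.exists_cell_of_closed he heY hY hX (hEY j)).2 _ (hET _) (hEz t)
      obtain ⟨(i | j') | d, rfl⟩ := E.surjective y
      · exact ⟨i, huniq i j _ (by rwa [insert_comm])⟩
      · exact absurd (hEY j') (disjoint_left.1 h.disj hy)
      · exact absurd (hET d) (h.not_mem_left _ hy)
    · have e1 := hκ i j
      have e2 := hκ i' j
      have e3 := hκ i j'
      rw [hκα] at e1
      rw [hκβ] at e2
      rw [hκβ'] at e3
      -- If `β` occurred in the row and in the column, all vertices of the edge of the cell `(i, j)`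
      -- would be neighbours of `β`.
      obtain ⟨u, hu⟩ := h.dense.inter_far (E (.inr (.inr β))) _ e1
      simp only [mem_inter, mem_insert, mem_singleton] at hu
      obtain ⟨rfl | rfl | rfl, hu⟩ := hu
      · exact not_mem_far_of_mem e3 (by simp) (by simp) (E.injective.ne (by simp)) hu
      · exact not_mem_far_of_mem e2 (by simp) (by simp) (E.injective.ne (by simp)) hu
      · exact not_mem_far_of_mem he (hα β) (hα α) (E.injective.ne (by simpa using hαβ)) hu
  refine ⟨E, κ, hcol, (eq_of_subset_of_card_le ?_ ?_).symm⟩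
  · intro f hf
    obtain ⟨f', hf', rfl⟩ := mem_relabel.1 hf
    obtain ⟨i, j, rfl⟩ | rfl := mem_closedModel.1 hf'
    · rw [map_cell]; exact hκ i j
    · simpa [h0, h1, h2] using he
  · rw [card_relabel, card_closedModel, h.dense.card_edges]

/-- An edge that avoids `X` and an edge that avoids `Y`. -/
structure IsCorner (k : ℕ) (H : Finset (Finset V)) (v : V) (X Y : Finset V) (x₀ y₀ : V)
    (e f : Finset V) : Prop extends IsTripartite k H v X Y where
  mem_e : e ∈ H
  mem_f : f ∈ H
  ne : e ≠ f
  left_mem : x₀ ∈ X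
  right_mem : y₀ ∈ Y
  left_mem_e : x₀ ∈ e
  right_mem_f : y₀ ∈ f
  e_inter : e ∩ Y = ∅
  f_inter : f ∩ X = ∅
  card_left_eq : ∀ g ∈ H, g ≠ f → (g ∩ X).card = 1
  card_right_eq : ∀ g ∈ H, g ≠ e → (g ∩ Y).card = 1

namespace IsCorner

variable {x₀ y₀ : V} {e f : Finset V}

lemma symm (h : IsCorner k H v X Y x₀ y₀ e f) : IsCorner k H v Y X y₀ x₀ f e where
  toIsTripartite := h.toIsTripartite.symm
  mem_e := h.mem_f
  mem_f := h.mem_e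
  ne := h.ne.symm
  left_mem := h.right_mem
  right_mem := h.left_mem
  left_mem_e := h.right_mem_f
  right_mem_f := h.left_mem_e
  e_inter := h.f_inter
  f_inter := h.e_inter
  card_left_eq := h.card_right_eq
  card_right_eq := h.card_left_eq

lemma left_not_mem_f (h : IsCorner k H v X Y x₀ y₀ e f) {x : V} (hx : x ∈ X) : x ∉ f := by
  intro hxf
  have : x ∈ f ∩ X := mem_inter.2 ⟨hxf, hx⟩
  simp [h.f_inter] at this

lemma left_not_mem_e (h : IsCorner k H v X Y x₀ y₀ e f) {x : V} (hx : x ∈ X) (hne : x ≠ x₀) :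
    x ∉ e := fun hxe => hne (h.eq_left h.mem_e hx h.left_mem hxe h.left_mem_e)

lemma card_inter_right_of_left (h : IsCorner k H v X Y x₀ y₀ e f) {x : V} (hx : x ∈ X)
    (hne : x ≠ x₀) : ∀ g ∈ H, x ∈ g → (g ∩ Y).card = 1 := by
  intro g hg hxg
  refine h.card_right_eq g hg ?_
  rintro rfl
  exact h.left_not_mem_e hx hne hxg

lemma exists_pair_of_ne (h : IsCorner k H v X Y x₀ y₀ e f) {x y : V} (hx : x ∈ X) (hy : y ∈ Y)
    (hne : x ≠ x₀) : ∃ t ∈ far H v, {x, y, t} ∈ H := by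
  have hxY := h.card_inter_right_of_left hx hne
  obtain ⟨-, g, hg, hxg, hyg⟩ := not_mem_far.1 (h.right_not_mem_far hx hxY hy)
  exact h.exists_eq_of_mem hg (h.card_left_eq g hg fun h' => h.left_not_mem_f hx (h' ▸ hxg))
    (hxY g hg hxg) hx hy hxg hyg

lemma exists_pair (h : IsCorner k H v X Y x₀ y₀ e f) {x y : V} (hx : x ∈ X) (hy : y ∈ Y)
    (hne : x ≠ x₀ ∨ y ≠ y₀) : ∃ t ∈ far H v, {x, y, t} ∈ H := by
  obtain hne | hne := hne
  · exact h.exists_pair_of_ne hx hy hne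
  · obtain ⟨t, ht, htH⟩ := h.symm.exists_pair_of_ne hy hx hne
    exact ⟨t, ht, by rwa [insert_comm]⟩

lemma exists_colour_of_ne (h : IsCorner k H v X Y x₀ y₀ e f) {x t : V} (hx : x ∈ X)
    (hne : x ≠ x₀) (ht : t ∈ far H v) (htf : t ∉ f) : ∃ y ∈ Y, {x, y, t} ∈ H := by
  have hxY := h.card_inter_right_of_left hx hne
  obtain ⟨τ, hτ, hfar⟩ := h.far_left hx hxY
  have hτe : τ ∈ f := by
    obtain ⟨u, hu⟩ := h.dense.inter_far x f h.mem_f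
    rw [hfar, mem_inter, mem_insert] at hu
    obtain ⟨huf, rfl | huX⟩ := hu
    · exact huf
    · exact absurd huf (h.left_not_mem_f huX)
  have htx : t ∉ far H x := by
    rw [hfar, mem_insert, not_or]
    exact ⟨fun h' => htf (h' ▸ hτe), fun h' => h.not_mem_left t h' ht⟩
  obtain ⟨-, g, hg, hxg, htg⟩ := not_mem_far.1 htx
  exact h.exists_eq_of_mem_far hg (h.card_left_eq g hg fun h' => h.left_not_mem_f hx (h' ▸ hxg))
    (hxY g hg hxg) hx ht hxg htg

/-- Of the `k` edges at `x₀` only `e` avoids `Y`, so exactly one vertex of `Y` is not adjacent to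
`x₀`. By `exists_pair` it can only be `y₀`. -/
lemma far_corner (h : IsCorner k H v X Y x₀ y₀ e f) : far H x₀ = insert y₀ X := by
  have hx := h.left_mem
  have hxn : x₀ ∉ Y := disjoint_left.1 h.disj hx
  have h1 := card_sdiff_far h.dense.linear x₀ Y
  have hdeg : (H.filter (x₀ ∈ ·)).card = k :=
    h.dense.deg_eq_of_defect (h.defect_compl x₀ (h.not_mem_left x₀ hx))
  have he : e ∈ H.filter (x₀ ∈ ·) := mem_filter.2 ⟨h.mem_e, h.left_mem_e⟩
  rw [← add_sum_erase _ _ he, h.e_inter, sum_const_nat (m := 1) fun g hg => ?_,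
    card_erase_of_mem he, hdeg] at h1
  · have hlt : (Y \ far H x₀).card < Y.card := by
      have := h.dense.three_le
      rw [h1, h.card_right]; simp; omega
    obtain ⟨y, hy, hyn⟩ := exists_mem_notMem_of_card_lt_card hlt
    have hyf : y ∈ far H x₀ := by simpa [hy] using hyn
    have hyy : y = y₀ := by
      by_contra hne
      obtain ⟨t, -, htH⟩ := h.exists_pair hx hy (.inr hne)
      exact not_mem_far_of_mem htH (by simp) (by simp) (ne_of_mem_of_not_mem hy hxn) hyf
    subst hyy
    refine (eq_of_subset_of_card_le (insert_subset hyf (h.left_subset_far hx)) ?_).symm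
    rw [card_insert_of_notMem fun h' => disjoint_left.1 h.disj h' hy, h.card_left,
      h.dense.card_far_of_defect (h.defect_compl x₀ (h.not_mem_left x₀ hx))]
  · rw [mem_erase, mem_filter] at hg
    rw [erase_eq_of_notMem (by simp [hxn]), h.card_right_eq g hg.2.1 hg.1]

lemma exists_colour_corner (h : IsCorner k H v X Y x₀ y₀ e f) {t : V} (ht : t ∈ far H v)
    (hte : t ∉ e) : ∃ y ∈ Y, {x₀, y, t} ∈ H := by
  have htx : t ∉ far H x₀ := by
    rw [h.far_corner, mem_insert, not_or]
    exact ⟨fun h' => h.not_mem_right _ h.right_mem (h' ▸ ht), fun h' => h.not_mem_left t h' ht⟩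
  obtain ⟨-, g, hg, hxg, htg⟩ := not_mem_far.1 htx
  exact h.exists_eq_of_mem_far hg
    (h.card_left_eq g hg fun h' => h.left_not_mem_f h.left_mem (h' ▸ hxg))
    (h.card_right_eq g hg fun h' => hte (h' ▸ htg)) h.left_mem ht hxg htg

lemma exists_eq_e (h : IsCorner k H v X Y x₀ y₀ e f) {b : V} (hb : b ∈ e) (hbx : b ≠ x₀) :
    b ∈ far H v ∧ ∃ c ∈ far H v, c ≠ x₀ ∧ c ≠ b ∧ e = {x₀, b, c} := by
  have hT : ∀ u ∈ e, u ≠ x₀ → u ∈ far H v := by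
    intro u hu hux
    by_contra huv
    obtain h' | h' := h.cover u huv
    · exact h.left_not_mem_e h' hux hu
    · exact h.symm.left_not_mem_f h' hu
  obtain ⟨c, hc, hcb, rfl⟩ := exists_third (h.dense.uniform e h.mem_e) h.left_mem_e hb hbx.symm
  exact ⟨hT b hb hbx, c, hT c (by simp) hc, hc, hcb, rfl⟩

lemma mem_of_two_far (h : IsCorner k H v X Y x₀ y₀ e f) {g : Finset V} (hg : g ∈ H)
    (h2 : 2 ≤ (g ∩ far H v).card) : g = e ∨ g = f := by
  by_contra! hne
  obtain ⟨x, hx, y, hy, t, -, rfl⟩ := h.exists_eq hg (h.card_left_eq g hg hne.2)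
    (h.card_right_eq g hg hne.1)
  have : (({x, y, t} : Finset V) ∩ far H v) ⊆ {t} := by
    intro u hu
    simp only [mem_inter, mem_insert, mem_singleton] at hu ⊢
    obtain ⟨rfl | rfl | rfl, hu⟩ := hu
    · exact absurd hu (h.not_mem_left _ hx)
    · exact absurd hu (h.not_mem_right _ hy)
    · rfl
  have := card_le_card this
  rw [card_singleton] at this
  omega

/-- Write `e = {x₀, z₁, z₂}`. If `z₁` and `z₂` were not in `f`, they would be adjacent to all of `X`
and so have full degree. As `e` and `f` are the only possible excess edges of `v`, the bound
`deg_le_excess` would then give `k ≤ 1 + 1`. -/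
lemma exists_common (h : IsCorner k H v X Y x₀ y₀ e f) : ∃ b, b ∈ e ∧ b ∈ f := by
  by_contra! hno
  have hk := h.dense.three_le
  obtain ⟨z₁, hz₁, hzx⟩ := exists_mem_ne
    (by rw [h.dense.uniform e h.mem_e]; norm_num : 1 < e.card) x₀
  obtain ⟨hz₁v, z₂, hz₂v, hz₂x, hz₂₁, rfl⟩ := h.exists_eq_e hz₁ hzx
  have hfull : ∀ z ∈ ({x₀, z₁, z₂} : Finset V), z ≠ x₀ → z ∈ far H v → defect k H z = 0 := by
    intro z hz hzx hzv
    have h1 := card_sdiff_far h.dense.linear z X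
    have h2 : X \ far H z = X := by
      refine sdiff_eq_self_of_disjoint (disjoint_left.2 fun x hx hxz => ?_)
      have hxz' : x ≠ z := fun h' => h.not_mem_left x hx (h' ▸ hzv)
      by_cases hxx : x = x₀
      · subst hxx
        exact not_mem_far_of_mem h.mem_e hz h.left_mem_e hxz' hxz
      · obtain ⟨y, -, hyH⟩ := h.exists_colour_of_ne hx hxx hzv (hno z hz)
        exact not_mem_far_of_mem hyH (by simp) (by simp) hxz' hxz
    rw [h2, h.card_left] at h1
    have h3 : k ≤ deg H z := by
      rw [h1, deg, card_eq_sum_ones]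
      exact sum_le_sum fun g hg => (card_erase_le).trans (h.inter_left g (mem_filter.1 hg).1)
    unfold defect; omega
  have hd₁ := hfull z₁ (by simp) hzx hz₁v
  have hd₂ := hfull z₂ (by simp) hz₂x hz₂v
  have h1 := h.dense.deg_le_excess h.defect_centre hd₁ hz₂v
    (not_mem_far_of_mem h.mem_e (by simp) (by simp) hz₂₁)
  rw [h.dense.deg_eq_of_defect hd₂] at h1
  have h2 : ((excessEdges H v).filter (z₂ ∈ ·)) ⊆ {{x₀, z₁, z₂}} := by
    intro g hg
    rw [mem_filter, mem_excessEdges] at hg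
    obtain rfl | rfl := h.mem_of_two_far hg.1.1 hg.1.2
    · simp
    · exact absurd hg.2 (hno z₂ (by simp))
  have h3 : far H v \ far H z₁ ⊆ {z₂} := by
    intro u hu
    rw [mem_sdiff, not_mem_far] at hu
    obtain ⟨huv, huz, g, hg, hzg, hug⟩ := hu
    obtain rfl | rfl := h.mem_of_two_far hg
      (one_lt_card.2 ⟨u, mem_inter.2 ⟨hug, huv⟩, z₁, mem_inter.2 ⟨hzg, hz₁v⟩, huz⟩)
    · have hux : u ≠ x₀ := fun h' => h.not_mem_left x₀ h.left_mem (h' ▸ huv)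
      simpa [hux, huz] using hug
    · exact absurd hzg (hno z₁ (by simp))
  have h4 := card_le_card h2
  have h5 := card_le_card h3
  rw [card_singleton] at h4 h5
  omega

/-- An edge that avoids `X` and another one that avoids `Y` give a corner colouring. -/
lemma exists_cornerModel (h : IsCorner k H v X Y x₀ y₀ e f) :
    ∃ (E : ColourVertices k ≃ V) (κ : _) (i₀ j₀ : Fin k), IsCornerColouring κ 0 2 i₀ j₀ ∧
      H = relabel E (cornerModel κ i₀ j₀) := by
  obtain ⟨b, hbe, hbf⟩ := h.exists_common
  have hbx : b ≠ x₀ := fun h' => h.left_not_mem_f h.left_mem (h' ▸ hbf)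
  have hby : b ≠ y₀ := fun h' => h.symm.left_not_mem_f h.right_mem (h' ▸ hbe)
  obtain ⟨hb, c, hc, -, hcb, he⟩ := h.exists_eq_e hbe hbx
  obtain ⟨-, a, ha, -, hab, hf⟩ := h.symm.exists_eq_e hbf hby
  have hac : a ≠ c := by
    rintro rfl
    refine h.ne (h.dense.eq_of_mem h.mem_e h.mem_f hab ?_ hbe ?_ hbf)
    · simp [he]
    · simp [hf]
  obtain ⟨E, hEX, hEY, hET, h0, h1, h2, hEz, hsX, hsY⟩ := h.exists_equiv ha hb hc hab hac hcb.symm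
  obtain ⟨i₀, rfl⟩ := hsX x₀ h.left_mem
  obtain ⟨j₀, rfl⟩ := hsY y₀ h.right_mem
  subst h0 h1 h2
  have hEz' : ∀ t, E (.inr (.inl t)) ∉ e ∧ E (.inr (.inl t)) ∉ f := fun t => by simp [he, hf]
  have hnocorner : ∀ d, {E (.inl (.inl i₀)), E (.inl (.inr j₀)), E (.inr d)} ∉ H := by
    intro d hd
    refine not_mem_far_of_mem hd (v := E (.inl (.inl i₀))) (u := E (.inl (.inr j₀))) (by simp)
      (by simp) (E.injective.ne (by simp)) ?_
    rw [h.far_corner]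
    exact mem_insert_self _ _
  -- The corner carries no edge but receives the colour 1 of `b`. The colouring stays injective: `b`
  -- is already joined to `x₀` by `e` and to `y₀` by `f`, so the colour 1 occurs nowhere else in
  -- this row and column.
  have hκ : ∀ i j, ∃ d, ((i, j) = (i₀, j₀) ∧ d = .inr 1) ∨
      ((i, j) ≠ (i₀, j₀) ∧ {E (.inl (.inl i)), E (.inl (.inr j)), E (.inr d)} ∈ H) := by
    intro i j
    by_cases hij : (i, j) = (i₀, j₀)
    · exact ⟨.inr 1, .inl ⟨hij, rfl⟩⟩
    obtain ⟨t, ht, htH⟩ := h.exists_pair (hEX i) (hEY j) (by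
      by_contra! h'
      exact hij (Prod.ext (by simpa using h'.1) (by simpa using h'.2)))
    obtain ⟨(i' | j') | d, rfl⟩ := E.surjective t
    · exact absurd ht (h.not_mem_left _ (hEX i'))
    · exact absurd ht (h.not_mem_right _ (hEY j'))
    · exact ⟨d, .inr ⟨hij, htH⟩⟩
  choose κ hκ using hκ
  have hcorner : κ i₀ j₀ = .inr 1 := by
    obtain h' | h' := hκ i₀ j₀
    exacts [h'.2, absurd rfl h'.1]
  have hκH : ∀ i j, (i, j) ≠ (i₀, j₀) →
      {E (.inl (.inl i)), E (.inl (.inr j)), E (.inr (κ i j))} ∈ H := fun i j hij =>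
    ((hκ i j).resolve_left fun h' => hij h'.1).2
  have huniq : ∀ i j d, {E (.inl (.inl i)), E (.inl (.inr j)), E (.inr d)} ∈ H → κ i j = d := by
    intro i j d hd
    refine h.dense.colour_unique E (hκH i j fun h' => ?_) hd
    obtain ⟨rfl, rfl⟩ := Prod.mk.inj h'
    exact hnocorner d hd
  have hrow1 : ∀ j, κ i₀ j = .inr 1 → j = j₀ := by
    intro j hj
    by_contra hne
    have h3 := hκH i₀ j fun h' => hne (Prod.mk.inj h').2
    rw [hj] at h3
    have := h.dense.eq_of_mem h3 h.mem_e hbx (by simp) (by simp) hbe h.left_mem_e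
    exact h.symm.left_not_mem_f (hEY j) (this ▸ by simp)
  have hcol1 : ∀ i, κ i j₀ = .inr 1 → i = i₀ := by
    intro i hi
    by_contra hne
    have h3 := hκH i j₀ fun h' => hne (Prod.mk.inj h').1
    rw [hi] at h3
    have := h.dense.eq_of_mem h3 h.mem_f hby (by simp) (by simp) hbf h.right_mem_f
    exact h.left_not_mem_f (hEX i) (this ▸ by simp)
  have hcell_row : ∀ i d, (∃ y ∈ Y, {E (.inl (.inl i)), y, E (.inr d)} ∈ H) → ∃ j, κ i j = d := by
    rintro i d ⟨y, hy, hyH⟩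
    obtain ⟨j, rfl⟩ := hsY y hy
    exact ⟨j, huniq i j d hyH⟩
  have hcell_col : ∀ j d, (∃ x ∈ X, {E (.inl (.inr j)), x, E (.inr d)} ∈ H) → ∃ i, κ i j = d := by
    rintro j d ⟨x, hx, hxH⟩
    obtain ⟨i, rfl⟩ := hsX x hx
    exact ⟨i, huniq i j d (by rwa [insert_comm])⟩
  have hcf : E (.inr (.inr 2)) ∉ f := by simp [hf]
  have hae : E (.inr (.inr 0)) ∉ e := by simp [he]
  refine ⟨E, κ, i₀, j₀, ⟨⟨h.dense.three_le, fun i j j' hj => ?_, fun j i i' hi => ?_,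
    fun i t => ?_, fun j t => ?_⟩, by decide, by decide, by decide, hcorner, fun i hi => ?_,
    fun j hj => ?_, hcell_row _ _ (h.exists_colour_corner ha hae),
    hcell_col _ _ (h.symm.exists_colour_corner hc hcf),
    fun i j i' j' δ hδ hκδ hκ1 hκ1' => ?_⟩, ?_⟩
  · by_cases hij : (i, j) = (i₀, j₀)
    · obtain ⟨rfl, rfl⟩ := Prod.mk.inj hij
      exact (hrow1 j' (hj ▸ hcorner)).symm
    by_cases hij' : (i, j') = (i₀, j₀)
    · obtain ⟨rfl, rfl⟩ := Prod.mk.inj hij'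
      exact hrow1 j (hj ▸ hcorner)
    exact h.dense.row_unique E (hκH i j hij) (hj ▸ hκH i j' hij')
  · have hi : κ i j = κ i' j := hi
    by_cases hij : (i, j) = (i₀, j₀)
    · obtain ⟨rfl, rfl⟩ := Prod.mk.inj hij
      exact (hcol1 i' (hi ▸ hcorner)).symm
    by_cases hij' : (i', j) = (i₀, j₀)
    · obtain ⟨rfl, rfl⟩ := Prod.mk.inj hij'
      exact hcol1 i (hi ▸ hcorner)
    exact h.dense.col_unique E (hκH i j hij) (hi ▸ hκH i' j hij')
  · refine hcell_row _ _ ?_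
    by_cases hi : i = i₀
    · subst hi
      exact h.exists_colour_corner (hET _) (hEz' t).1
    · exact h.exists_colour_of_ne (hEX i) (E.injective.ne (by simpa using hi)) (hET _) (hEz' t).2
  · refine hcell_col _ _ ?_
    by_cases hj : j = j₀
    · subst hj
      exact h.symm.exists_colour_corner (hET _) (hEz' t).2
    · exact h.symm.exists_colour_of_ne (hEY j) (E.injective.ne (by simpa using hj)) (hET _)
        (hEz' t).1
  · exact hcell_row _ _ (h.exists_colour_of_ne (hEX i) (E.injective.ne (by simpa using hi)) hc hcf)
  · exact hcell_col _ _
      (h.symm.exists_colour_of_ne (hEY j) (E.injective.ne (by simpa using hj)) ha hae)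
  · have hij : (i, j) ≠ (i₀, j₀) := by
      intro h'
      obtain ⟨rfl, rfl⟩ := Prod.mk.inj h'
      rw [hcorner] at hκδ
      exact hδ (Sum.inr_injective hκδ).symm
    -- The edge of the cell `(i, j)` would consist of neighbours of `b`, because `b` is adjacent to
    -- `a` through `f` and to `c` through `e`.
    obtain ⟨u, hu⟩ := h.dense.inter_far (E (.inr (.inr 1))) _ (hκH i j hij)
    simp only [mem_inter, mem_insert, mem_singleton] at hu
    obtain ⟨rfl | rfl | rfl, hu⟩ := hu
    · by_cases hij' : (i, j') = (i₀, j₀)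
      · obtain ⟨rfl, rfl⟩ := Prod.mk.inj hij'
        exact not_mem_far_of_mem h.mem_e hbe h.left_mem_e (E.injective.ne (by simp)) hu
      · have h3 := hκH i j' hij'
        rw [hκ1'] at h3
        exact not_mem_far_of_mem h3 (by simp) (by simp) (E.injective.ne (by simp)) hu
    · by_cases hij' : (i', j) = (i₀, j₀)
      · obtain ⟨rfl, rfl⟩ := Prod.mk.inj hij'
        exact not_mem_far_of_mem h.mem_f hbf h.right_mem_f (E.injective.ne (by simp)) hu
      · have h3 := hκH i' j hij'
        rw [hκ1] at h3
        exact not_mem_far_of_mem h3 (by simp) (by simp) (E.injective.ne (by simp)) hu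
    · rw [hκδ] at hu
      fin_cases δ
      · exact not_mem_far_of_mem h.mem_f hbf (by simp [hf]) (E.injective.ne (by simp)) hu
      · exact hδ rfl
      · exact not_mem_far_of_mem h.mem_e hbe (by simp [he]) (E.injective.ne (by simp)) hu
  · refine (eq_of_subset_of_card_le ?_ ?_).symm
    · intro g hg
      obtain ⟨g', hg', rfl⟩ := mem_relabel.1 hg
      obtain ⟨i, j, hij, rfl⟩ | rfl | rfl := mem_cornerModel.1 hg'
      · rw [map_cell]; exact hκH i j hij
      · have := h.mem_e
        rw [he] at this
        simpa using this
      · have := h.mem_f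
        rw [hf, pair_comm] at this
        simpa using this
    · rw [card_relabel, card_cornerModel, h.dense.card_edges]

end IsCorner

lemma exists_model (h : IsTripartite k H v X Y) :
    (∃ (E : ColourVertices k ≃ V) (κ : _), IsClosedColouring κ ∧
      H = relabel E (closedModel κ)) ∨
    ∃ (E : ColourVertices k ≃ V) (κ : _) (i₀ j₀ : Fin k), IsCornerColouring κ 0 2 i₀ j₀ ∧
      H = relabel E (cornerModel κ i₀ j₀) := by
  obtain ⟨f, hf, hfX, hX⟩ := h.exists_avoiding
  obtain ⟨e, he, heY, hY⟩ := h.symm.exists_avoiding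
  by_cases hef : e = f
  · subst hef
    exact .inl (h.exists_closedModel he hfX heY hX hY)
  · obtain ⟨x₀, hx₀⟩ := card_pos.1 (hX e he hef ▸ one_pos)
    obtain ⟨y₀, hy₀⟩ := card_pos.1 (hY f hf (Ne.symm hef) ▸ one_pos)
    rw [mem_inter] at hx₀ hy₀
    exact .inr (IsCorner.exists_cornerModel
      ⟨h, he, hf, hef, hx₀.2, hy₀.2, hx₀.1, hy₀.1, heY, hfX, hX, hY⟩)

end IsTripartite

/-- The structure of hypergraphs with more than `k²` edges. -/
theorem IsDense.exists_model (hH : IsDense k 1 H) :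
    (∃ (E : ColourVertices k ≃ V) (κ : _), IsClosedColouring κ ∧
      H = relabel E (closedModel κ)) ∨
    (∃ (E : ColourVertices k ≃ V) (κ : _) (i₀ j₀ : Fin k), IsCornerColouring κ 0 2 i₀ j₀ ∧
      H = relabel E (cornerModel κ i₀ j₀)) ∨
    (k = 3 ∧ (IsConstruction₃ H ∨ IsConstruction₄ H)) := by
  obtain ⟨-, v, hv, hQ⟩ := hH.exists_centre
  obtain ⟨w, w', t, t', X, Y, hS⟩ := hH.exists_isSplit hv hQ
  by_cases hXY : (∀ g ∈ H, (g ∩ X).card ≤ 1) ∧ ∀ g ∈ H, (g ∩ Y).card ≤ 1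
  · have := IsTripartite.exists_model (H := H) ⟨hH, hv, hQ, hS.not_mem_left, hS.not_mem_right,
      hS.cover, hS.disj, hS.card_left, hS.card_right, hXY.1, hXY.2⟩
    exact this.imp_right .inl
  right; right
  have hk : k = 3 := by
    by_contra hne
    have := hH.three_le
    have hk : 4 ≤ k := by omega
    exact hXY ⟨fun g hg => hH.card_inter_right_le hk hS.symm hg,
      fun g hg => hH.card_inter_right_le hk hS hg⟩
  subst hk
  refine ⟨rfl, ?_⟩
  obtain ⟨P, Q, R, h⟩ : ∃ P Q R, IsPrismSystem H P Q R v := by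
    rw [not_and_or] at hXY
    push Not at hXY
    obtain ⟨g, hg, h⟩ | ⟨g, hg, h⟩ := hXY
    · exact hH.exists_isPrismSystem hS.symm hg h
    · exact hH.exists_isPrismSystem hS hg h
  exact h.isConstruction₃_or_isConstruction₄ hH

end TripartiteColouring
end SailTuran

namespace SailTuran
open Finset

/-! ### Cell colourings as 2-factors with matching decompositions. -/

section CellGraph

variable {k : ℕ}

/-- The subgraph of `K_{k,k}` whose edges are the cells in `S`. -/
def cellGraph (S : Fin k → Fin k → Prop) : SimpleGraph (Fin k ⊕ Fin k) where
  Adj u w := (∃ i j, S i j ∧ u = .inl i ∧ w = .inr j) ∨ ∃ i j, S i j ∧ u = .inr j ∧ w = .inl i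
  symm := ⟨by
    rintro u w (⟨i, j, h, rfl, rfl⟩ | ⟨i, j, h, rfl, rfl⟩)
    exacts [.inr ⟨i, j, h, rfl, rfl⟩, .inl ⟨i, j, h, rfl, rfl⟩]⟩
  loopless := ⟨by
    rintro u (⟨i, j, -, rfl, h⟩ | ⟨i, j, -, rfl, h⟩) <;> simp at h⟩

@[simp] lemma cellGraph_inl_inr {S : Fin k → Fin k → Prop} {i j : Fin k} :
    (cellGraph S).Adj (.inl i) (.inr j) ↔ S i j := by simp [cellGraph]

@[simp] lemma cellGraph_inr_inl {S : Fin k → Fin k → Prop} {i j : Fin k} :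
    (cellGraph S).Adj (.inr j) (.inl i) ↔ S i j := by simp [cellGraph]

@[simp] lemma cellGraph_inl_inl {S : Fin k → Fin k → Prop} {i i' : Fin k} :
    ¬ (cellGraph S).Adj (.inl i) (.inl i') := by simp [cellGraph]

@[simp] lemma cellGraph_inr_inr {S : Fin k → Fin k → Prop} {j j' : Fin k} :
    ¬ (cellGraph S).Adj (.inr j) (.inr j') := by simp [cellGraph]

lemma cellGraph_le (S : Fin k → Fin k → Prop) : cellGraph S ≤ Kkk k := by
  rintro u w (⟨i, j, h, rfl, rfl⟩ | ⟨i, j, h, rfl, rfl⟩) <;> simp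

/-- The edge colouring of `K_{k,k}` given by `f`. -/
def cellColour {V : Type*} (f : Fin k → Fin k → V) (v : V) : Sym2 (Fin k ⊕ Fin k) → V :=
  Sym2.lift ⟨fun u w => match u, w with
    | .inl i, .inr j => f i j
    | .inr j, .inl i => f i j
    -- A default value: pairs within one part are not edges.
    | _, _ => v, by rintro (i | i) (j | j) <;> rfl⟩

lemma cellColour_inl_inr {V : Type*} (f : Fin k → Fin k → V) (v : V) (i j : Fin k) :
    cellColour f v s(.inl i, .inr j) = f i j := rfl

lemma cellColour_inr_inl {V : Type*} (f : Fin k → Fin k → V) (v : V) (i j : Fin k) :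
    cellColour f v s(.inr j, .inl i) = f i j := rfl

lemma exists_of_mem_edgeSet {e : Sym2 (Fin k ⊕ Fin k)} (he : e ∈ (Kkk k).edgeSet) :
    ∃ i j, e = s(.inl i, .inr j) := by
  induction e using Sym2.ind with
  | _ u w =>
    rw [SimpleGraph.mem_edgeSet] at he
    obtain i | j := u <;> obtain i' | j' := w
    · simp at he
    · exact ⟨i, j', rfl⟩
    · exact ⟨i', j, Sym2.eq_swap⟩
    · simp at he

lemma cell_edge_eq {i j i' j' : Fin k} :
    (s(.inl i, .inr j) : Sym2 (Fin k ⊕ Fin k)) = s(.inl i', .inr j') ↔ i = i' ∧ j = j' := by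
  simp

lemma mem_addVertex_cells {V : Type*} [DecidableEq V] {p : Fin k ⊕ Fin k → V}
    {S : Set (Sym2 (Fin k ⊕ Fin k))} (hS : S ⊆ (Kkk k).edgeSet) {w : V} {e : Finset V} :
    e ∈ addVertex p S w ↔
      ∃ i j, s(.inl i, .inr j) ∈ S ∧ e = {p (.inl i), p (.inr j), w} := by
  constructor
  · rintro ⟨u, u', hu, rfl⟩
    obtain ⟨i, j, h⟩ := exists_of_mem_edgeSet (hS hu)
    refine ⟨i, j, h ▸ hu, ?_⟩
    obtain ⟨rfl, rfl⟩ | ⟨rfl, rfl⟩ := Sym2.eq_iff.1 h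
    · rfl
    · exact insert_comm _ _ _
  · rintro ⟨i, j, h, rfl⟩
    exact ⟨_, _, h, rfl⟩

variable {κ : Fin k → Fin k → Fin (k - 2) ⊕ Fin 3}

/-- The cells with special colours. -/
abbrev specialGraph (κ : Fin k → Fin k → Fin (k - 2) ⊕ Fin 3) : SimpleGraph (Fin k ⊕ Fin k) :=
  cellGraph fun i j => ∃ α, κ i j = .inr α

/-- The cells of colour `t`. -/
def colourMatching (κ : Fin k → Fin k → Fin (k - 2) ⊕ Fin 3) (t : Fin (k - 2)) :
    (Kkk k \ specialGraph κ).Subgraph where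
  verts := Set.univ
  Adj := (cellGraph fun i j => κ i j = .inl t).Adj
  adj_sub := by
    rintro u w (⟨i, j, h, rfl, rfl⟩ | ⟨i, j, h, rfl, rfl⟩) <;> simp [h]
  edge_vert _ := Set.mem_univ _
  symm := (cellGraph _).symm

lemma mem_colourMatching {t : Fin (k - 2)} {i j : Fin k} :
    s(.inl i, .inr j) ∈ (colourMatching κ t).edgeSet ↔ κ i j = .inl t := by
  rw [SimpleGraph.Subgraph.mem_edgeSet]
  exact cellGraph_inl_inr

namespace IsCellColouring

/-- Each of the `k - 2` ordinary colours occupies exactly one cell of the row. -/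
lemma card_special_row (h : IsCellColouring κ) (i : Fin k) :
    {j | ∃ α, κ i j = .inr α}.ncard = 2 := by
  have hk := h.three_le
  have h1 : (κ i '' {j | ∃ α, κ i j = .inr α}ᶜ) = Set.range Sum.inl := by
    ext c
    constructor
    · rintro ⟨j, hj, rfl⟩
      cases hc : κ i j with
      | inl t => exact ⟨t, rfl⟩
      | inr α => exact absurd ⟨α, hc⟩ hj
    · rintro ⟨t, rfl⟩
      obtain ⟨j, hj⟩ := h.row_surj i t
      exact ⟨j, by simp [hj], hj⟩
  have h2 := congr_arg Set.ncard h1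
  rw [Set.ncard_image_of_injective _ (h.row_inj i), ← Set.image_univ,
    Set.ncard_image_of_injective _ Sum.inl_injective, Set.ncard_univ, Nat.card_fin] at h2
  have h3 := Set.ncard_add_ncard_compl {j | ∃ α, κ i j = .inr α}
  rw [Nat.card_fin] at h3
  omega

lemma isTwoFactor (h : IsCellColouring κ) : IsTwoFactor (specialGraph κ) := by
  refine ⟨cellGraph_le _, ?_⟩
  rintro (i | j)
  · have : (specialGraph κ).neighborSet (.inl i) = Sum.inr '' {j | ∃ α, κ i j = .inr α} := by
      ext (u | u) <;> simp
    rw [this, Set.ncard_image_of_injective _ Sum.inr_injective, h.card_special_row i]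
  · have : (specialGraph κ).neighborSet (.inr j) = Sum.inl '' {i | ∃ α, κ i j = .inr α} := by
      ext (u | u) <;> simp
    rw [this, Set.ncard_image_of_injective _ Sum.inl_injective, h.transpose.card_special_row j]

lemma isMatchingDecomposition (h : IsCellColouring κ) :
    IsMatchingDecomposition (Kkk k \ specialGraph κ) (colourMatching κ) := by
  refine ⟨fun t => ⟨?_, fun _ => Set.mem_univ _⟩, fun e he => ?_⟩
  · rintro (i | j) -
    · obtain ⟨j, hj⟩ := h.row_surj i t
      refine ⟨.inr j, cellGraph_inl_inr.2 hj, ?_⟩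
      rintro (i' | j') hj'
      · exact absurd hj' cellGraph_inl_inl
      · rw [h.row_inj i (hj.trans (cellGraph_inl_inr.1 hj').symm)]
    · obtain ⟨i, hi⟩ := h.col_surj j t
      refine ⟨.inl i, cellGraph_inr_inl.2 hi, ?_⟩
      rintro (i' | j') hj'
      · rw [h.col_inj j (hi.trans (cellGraph_inr_inl.1 hj').symm)]
      · exact absurd hj' cellGraph_inr_inr
  · obtain ⟨i, j, rfl⟩ := exists_of_mem_edgeSet (SimpleGraph.edgeSet_mono sdiff_le he)
    simp only [mem_colourMatching]
    cases hc : κ i j with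
    | inl t => exact ⟨t, rfl, fun t' ht' => (Sum.inl_injective ht').symm⟩
    | inr α => simp [hc] at he

end IsCellColouring

/-- A 2-factor with a proper edge colouring by three colours, and a decomposition of its complement,
form a colouring of the cells. -/
lemma exists_isCellColouring (hk : 3 ≤ k) {B : SimpleGraph (Fin k ⊕ Fin k)}
    {M : Fin (k - 2) → (Kkk k \ B).Subgraph}
    (hM : IsMatchingDecomposition (Kkk k \ B) M) (f : Fin k → Fin k → Fin 3)
    (hrow : ∀ i j j', B.Adj (.inl i) (.inr j) → B.Adj (.inl i) (.inr j') → f i j = f i j' → j = j')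
    (hcol : ∀ j i i', B.Adj (.inl i) (.inr j) → B.Adj (.inl i') (.inr j) → f i j = f i' j →
      i = i') :
    ∃ κ : Fin k → Fin k → Fin (k - 2) ⊕ Fin 3, IsCellColouring κ ∧
      (∀ i j, B.Adj (.inl i) (.inr j) → κ i j = .inr (f i j)) ∧
      (∀ i j, B.Adj (.inl i) (.inr j) ↔ ∃ α, κ i j = .inr α) ∧
      ∀ i j t, s(.inl i, .inr j) ∈ (M t).edgeSet ↔ κ i j = .inl t := by
  have hex : ∀ i j, ∃ c : Fin (k - 2) ⊕ Fin 3, (B.Adj (.inl i) (.inr j) ∧ c = .inr (f i j)) ∨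
      (¬ B.Adj (.inl i) (.inr j) ∧ ∃ t, c = .inl t ∧ s(.inl i, .inr j) ∈ (M t).edgeSet) := by
    intro i j
    by_cases hB : B.Adj (.inl i) (.inr j)
    · exact ⟨_, .inl ⟨hB, rfl⟩⟩
    · obtain ⟨t, ht, -⟩ := hM.2 s(.inl i, .inr j) (by simp [hB])
      exact ⟨_, .inr ⟨hB, t, rfl, ht⟩⟩
  choose κ hκ using hex
  have h1 : ∀ i j, B.Adj (.inl i) (.inr j) → κ i j = .inr (f i j) := by
    intro i j hB
    obtain h | h := hκ i j
    exacts [h.2, absurd hB h.1]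
  have hMB : ∀ i j t, s(.inl i, .inr j) ∈ (M t).edgeSet → ¬ B.Adj (.inl i) (.inr j) := by
    intro i j t ht hB
    have := (M t).edgeSet_subset ht
    simp [hB] at this
  have h2 : ∀ i j, B.Adj (.inl i) (.inr j) ↔ ∃ α, κ i j = .inr α := by
    refine fun i j => ⟨fun hB => ⟨_, h1 i j hB⟩, fun ⟨α, hα⟩ => ?_⟩
    obtain h | ⟨-, t, h, -⟩ := hκ i j
    · exact h.1
    · simp [h] at hα
  have h3 : ∀ i j t, s(.inl i, .inr j) ∈ (M t).edgeSet ↔ κ i j = .inl t := by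
    refine fun i j t => ⟨fun ht => ?_, fun ht => ?_⟩
    · obtain h | ⟨hB, t', h, ht'⟩ := hκ i j
      · exact absurd h.1 (hMB i j t ht)
      · rw [h, (hM.2 s(.inl i, .inr j) (by simp [hB])).unique ht ht']
    · obtain h | ⟨-, t', h, ht'⟩ := hκ i j
      · simp [h.2] at ht
      · rw [h] at ht
        exact Sum.inl_injective ht ▸ ht'
  refine ⟨κ, ⟨hk, fun i j j' hj => ?_, fun j i i' hi => ?_, fun i t => ?_, fun j t => ?_⟩,
    h1, h2, h3⟩
  · cases hc : κ i j with
    | inl t =>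
      have e1 := (h3 i j t).2 hc
      have e2 := (h3 i j' t).2 (hj ▸ hc)
      simpa using ((hM.1 t).1 ((hM.1 t).2 (.inl i))).unique e1 e2
    | inr α =>
      have e1 := (h2 i j).2 ⟨α, hc⟩
      have e2 := (h2 i j').2 ⟨α, hj ▸ hc⟩
      rw [h1 i j e1, h1 i j' e2] at hj
      exact hrow i j j' e1 e2 (Sum.inr_injective hj)
  · have hi : κ i j = κ i' j := hi
    cases hc : κ i j with
    | inl t =>
      have e1 := (h3 i j t).2 hc
      have e2 := (h3 i' j t).2 (hi ▸ hc)
      rw [Sym2.eq_swap] at e1 e2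
      simpa using ((hM.1 t).1 ((hM.1 t).2 (.inr j))).unique e1 e2
    | inr α =>
      have e1 := (h2 i j).2 ⟨α, hc⟩
      have e2 := (h2 i' j).2 ⟨α, hi ▸ hc⟩
      rw [h1 i j e1, h1 i' j e2] at hi
      exact hcol j i i' e1 e2 (Sum.inr_injective hi)
  · obtain ⟨u, hu, -⟩ := (hM.1 t).1 ((hM.1 t).2 (.inl i))
    have := (M t).adj_sub hu
    obtain i' | j := u
    · simp at this
    · exact ⟨j, (h3 i j t).1 hu⟩
  · obtain ⟨u, hu, -⟩ := (hM.1 t).1 ((hM.1 t).2 (.inr j))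
    have := (M t).adj_sub hu
    obtain i | j' := u
    · exact ⟨i, (h3 i j t).1 hu.symm⟩
    · simp at this

/-- The triples of the first two constructions that contain a vertex of `X` and a vertex of `Y`. -/
lemma iUnion_addVertex {V : Type*} [DecidableEq V] (E : ColourVertices k ≃ V)
    {B : SimpleGraph (Fin k ⊕ Fin k)} (hB : B ≤ Kkk k) {M : Fin (k - 2) → (Kkk k \ B).Subgraph}
    {col : Sym2 (Fin k ⊕ Fin k) → V} {Q : Sym2 (Fin k ⊕ Fin k) → Prop}
    (hadj : ∀ i j, B.Adj (.inl i) (.inr j) ↔ ∃ α, κ i j = .inr α)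
    (hM : ∀ i j t, s(.inl i, .inr j) ∈ (M t).edgeSet ↔ κ i j = .inl t)
    (hcol : ∀ i j α, Q s(.inl i, .inr j) → κ i j = .inr α →
      col s(.inl i, .inr j) = E (.inr (.inr α)))
    (hQ : ∀ i j t, κ i j = .inl t → Q s(.inl i, .inr j)) :
    (⋃ w ∈ ({E (.inr (.inr 0)), E (.inr (.inr 1)), E (.inr (.inr 2))} : Set V),
        addVertex (E ∘ .inl) {e | e ∈ B.edgeSet ∧ Q e ∧ col e = w} w) ∪
      (⋃ t, addVertex (E ∘ .inl) (M t).edgeSet (E (.inr (.inl t)))) =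
    {e | ∃ i j, Q s(.inl i, .inr j) ∧
      e = {E (.inl (.inl i)), E (.inl (.inr j)), E (.inr (κ i j))}} := by
  -- `Q` selects the cells that carry an edge: all cells in the second construction, all but the
  -- corner in the first.
  have hS : ∀ w, {e | e ∈ B.edgeSet ∧ Q e ∧ col e = w} ⊆ (Kkk k).edgeSet := fun w e he =>
    SimpleGraph.edgeSet_mono hB he.1
  have hMS : ∀ t, (M t).edgeSet ⊆ (Kkk k).edgeSet := fun t =>
    (M t).edgeSet_subset.trans (SimpleGraph.edgeSet_mono sdiff_le)
  have hα : ∀ α, E (.inr (.inr α)) ∈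
      ({E (.inr (.inr 0)), E (.inr (.inr 1)), E (.inr (.inr 2))} : Set V) := by
    intro α; fin_cases α <;> simp
  ext e
  simp only [Set.mem_union, Set.mem_iUnion, mem_addVertex_cells (hS _), mem_addVertex_cells (hMS _),
    Set.mem_ofPred_eq, exists_prop, hM, SimpleGraph.mem_edgeSet, hadj, Function.comp_apply]
  constructor
  · rintro (⟨w, -, i, j, ⟨⟨α, hα⟩, hq, rfl⟩, rfl⟩ | ⟨t, i, j, ht, rfl⟩)
    · exact ⟨i, j, hq, by rw [hα, hcol i j α hq hα]⟩
    · exact ⟨i, j, hQ i j t ht, by rw [ht]⟩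
  · rintro ⟨i, j, hq, rfl⟩
    cases hc : κ i j with
    | inl t => exact .inr ⟨t, i, j, hc, rfl⟩
    | inr α =>
      exact .inl ⟨_, hα α, i, j, ⟨⟨α, hc⟩, hq, hcol i j α hq hc⟩, rfl⟩

lemma ncard_sum {α β : Type*} [Finite α] [Finite β] (S : Set (α ⊕ β)) :
    S.ncard = (Sum.inl ⁻¹' S).ncard + (Sum.inr ⁻¹' S).ncard := by
  conv_lhs => rw [← Set.image_preimage_inl_union_image_preimage_inr S]
  rw [Set.ncard_union_eq, Set.ncard_image_of_injective _ Sum.inl_injective,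
    Set.ncard_image_of_injective _ Sum.inr_injective]
  rw [Set.disjoint_left]
  rintro _ ⟨a, -, rfl⟩ ⟨b, -, h⟩
  simp at h

end CellGraph
end SailTuran

namespace SailTuran
open Finset

/-! ### Closed colourings and Construction 2. -/

section ConstructionTwo

variable {k : ℕ} {κ : Fin k → Fin k → Fin (k - 2) ⊕ Fin 3}

namespace IsClosedColouring

/-- Sets of rows and columns that are closed under following cells with special colours. -/
lemma card_missing_le (h : IsClosedColouring κ) {A B : Finset (Fin k)}
    (hAB : ∀ i j α, κ i j = .inr α → (i ∈ A ↔ j ∈ B)) {α γ : Fin 3} (hαγ : α ≠ γ) :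
    (A.filter fun i => ∀ j, κ i j ≠ .inr α).card ≤
      (B.filter fun j => ∀ i, κ i j ≠ .inr γ).card := by
  obtain ⟨β, hβα, hβγ⟩ : ∃ β, β ≠ α ∧ β ≠ γ := by
    have : ∀ α γ : Fin 3, ∃ β, β ≠ α ∧ β ≠ γ := by decide
    exact this α γ
  -- A row missing `α` contains `β` and `γ`. The column of its `β`-cell cannot contain `γ`, by
  -- `no_path`, so `i` is sent to that column; this is injective since `β` occurs at most once in a
  -- column.
  have hex : ∀ i ∈ A.filter fun i => ∀ j, κ i j ≠ .inr α, ∃ j, κ i j = .inr β := by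
    intro i hi
    obtain ⟨j, hj⟩ | h' := h.row_or i hβα.symm
    · exact absurd hj ((mem_filter.1 hi).2 j)
    · exact h'
  by_cases hk : Nonempty (Fin k)
  · choose! f hf using hex
    refine card_le_card_of_injOn f (fun i hi => ?_) fun i hi i' hi' hii' => ?_
    · have hi2 := mem_filter.1 hi
      refine mem_coe.2 (mem_filter.2 ⟨(hAB i _ β (hf i hi)).1 hi2.1, fun i' hi' => ?_⟩)
      obtain ⟨j, hj⟩ | ⟨j, hj⟩ := h.row_or i hαγ
      · exact hi2.2 j hj
      · exact h.no_path i (f i) i' j β γ hβγ (hf i hi) hi' hj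
    · exact h.col_inj (f i) ((hf i hi).trans (hii' ▸ (hf i' hi').symm))
  · have := h.three_le
    exact absurd ⟨⟨0, by omega⟩⟩ hk

lemma card_eq_sum_missing (h : IsClosedColouring κ) (A : Finset (Fin k)) :
    A.card = ∑ α, (A.filter fun i => ∀ j, κ i j ≠ .inr α).card := by
  choose m hm using h.exists_row_ne
  rw [card_eq_sum_card_fiberwise (f := m) (t := univ) (fun _ _ => mem_univ _)]
  refine sum_congr rfl fun α _ => congr_arg card (filter_congr fun i _ => ?_)
  refine ⟨fun h' => h' ▸ hm i, fun h' => ?_⟩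
  by_contra hne
  obtain ⟨j, hj⟩ | ⟨j, hj⟩ := h.row_or i hne
  exacts [hm i j hj, h' j hj]

/-- Let `r α` be the number of rows of `A`, and `c α` that of columns of `B`, missing the colour
`α`. Then `r α ≤ c γ` and `c α ≤ r γ` whenever `α ≠ γ`, which forces all six numbers to be equal;
`|A|` and `|B|` are the sums over the three colours. -/
lemma exists_card_eq (h : IsClosedColouring κ) {A B : Finset (Fin k)}
    (hAB : ∀ i j α, κ i j = .inr α → (i ∈ A ↔ j ∈ B)) :
    ∃ n, A.card = 3 * n ∧ B.card = 3 * n := by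
  have h1 := h.card_eq_sum_missing A
  have h2 := h.transpose.card_eq_sum_missing B
  have hle := fun α γ hαγ => h.card_missing_le hAB (α := α) (γ := γ) hαγ
  have hge := fun α γ hαγ => h.transpose.card_missing_le (A := B) (B := A)
    (fun i j α h' => (hAB j i α h').symm) (α := α) (γ := γ) hαγ
  simp only [Fin.sum_univ_three] at h1 h2
  have := hle 0 1 (by decide)
  have := hle 0 2 (by decide)
  have := hle 1 0 (by decide)
  have := hle 1 2 (by decide)
  have := hle 2 0 (by decide)
  have := hle 2 1 (by decide)
  have := hge 0 1 (by decide)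
  have := hge 0 2 (by decide)
  have := hge 1 0 (by decide)
  have := hge 1 2 (by decide)
  have := hge 2 0 (by decide)
  have := hge 2 1 (by decide)
  exact ⟨(A.filter fun i => ∀ j, κ i j ≠ .inr 0).card, by omega, by omega⟩

lemma six_dvd_supp (h : IsClosedColouring κ) (C : (specialGraph κ).ConnectedComponent) :
    6 ∣ C.supp.ncard := by
  classical
  obtain ⟨n, h1, h2⟩ := h.exists_card_eq (A := univ.filter fun i => .inl i ∈ C.supp)
    (B := univ.filter fun j => .inr j ∈ C.supp) (by
      intro i j α hα
      simp only [mem_filter, mem_univ, true_and]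
      exact C.mem_supp_congr_adj (cellGraph_inl_inr.2 ⟨α, hα⟩))
  rw [ncard_sum]
  have e1 : (Sum.inl ⁻¹' C.supp).ncard = 3 * n := by
    rw [← h1, ← Set.ncard_coe_finset]; congr 1; ext; simp
  have e2 : (Sum.inr ⁻¹' C.supp).ncard = 3 * n := by
    rw [← h2, ← Set.ncard_coe_finset]; congr 1; ext; simp
  rw [e1, e2]
  exact ⟨n, by ring⟩

lemma three_dvd (h : IsClosedColouring κ) : 3 ∣ k := by
  obtain ⟨n, h1, -⟩ := h.exists_card_eq (A := univ) (B := univ) (by simp)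
  rw [card_univ, Fintype.card_fin] at h1
  exact ⟨n, h1⟩

end IsClosedColouring

variable {V : Type*} [DecidableEq V] {H : Finset (Finset V)}

lemma coe_relabel_closedModel (E : ColourVertices k ≃ V) :
    (relabel E (closedModel κ) : Set (Finset V)) =
      {e | ∃ i j, True ∧ e = {E (.inl (.inl i)), E (.inl (.inr j)), E (.inr (κ i j))}} ∪
      {{E (.inr (.inr 0)), E (.inr (.inr 1)), E (.inr (.inr 2))}} := by
  ext e
  simp only [mem_coe, mem_relabel, mem_closedModel, Set.mem_union, Set.mem_ofPred_eq,
    Set.mem_singleton_iff, true_and]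
  constructor
  · rintro ⟨f, ⟨i, j, rfl⟩ | rfl, rfl⟩
    · exact .inl ⟨i, j, map_cell E i j⟩
    · exact .inr (by simp)
  · rintro (⟨i, j, rfl⟩ | rfl)
    · exact ⟨_, .inl ⟨i, j, rfl⟩, map_cell E i j⟩
    · exact ⟨_, .inr rfl, by simp⟩

lemma isVertexPartition {V : Type*} (E : ColourVertices k ≃ V) :
    IsVertexPartition (E ∘ .inl) (E ∘ .inr ∘ .inl) (E (.inr (.inr 0))) (E (.inr (.inr 1)))
      (E (.inr (.inr 2))) := by
  have : Sum.elim (E ∘ .inl) (Sum.elim (E ∘ .inr ∘ .inl)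
      ![E (.inr (.inr 0)), E (.inr (.inr 1)), E (.inr (.inr 2))]) = E := by
    funext u
    obtain u | t | α := u
    · rfl
    · rfl
    · fin_cases α <;> rfl
  rw [IsVertexPartition, this]
  exact E.bijective

lemma IsClosedColouring.isConstruction₂ (h : IsClosedColouring κ) (E : ColourVertices k ≃ V) :
    IsConstruction₂ k (relabel E (closedModel κ)) := by
  set col := cellColour (fun i j => E (.inr (κ i j))) (E (.inr (.inr 0))) with hcol
  refine ⟨h.three_le, h.three_dvd, E ∘ .inl, E ∘ .inr ∘ .inl, E (.inr (.inr 0)),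
    E (.inr (.inr 1)), E (.inr (.inr 2)), specialGraph κ, col, colourMatching κ, ?_, h.isTwoFactor,
    h.six_dvd_supp, ?_, ?_, h.isMatchingDecomposition, ?_⟩
  · exact isVertexPartition E
  · intro e he
    obtain ⟨i, j, rfl⟩ := exists_of_mem_edgeSet (SimpleGraph.edgeSet_mono (cellGraph_le _) he)
    rw [SimpleGraph.mem_edgeSet, cellGraph_inl_inr] at he
    obtain ⟨α, hα⟩ := he
    rw [hcol, cellColour_inl_inr, hα]
    fin_cases α <;> simp
  · have hr : ∀ {i j j'}, j ≠ j' → E (.inr (κ i j)) ≠ E (.inr (κ i j')) := fun hj =>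
      E.injective.ne (Sum.inr_injective.ne ((h.row_inj _).ne hj))
    have hc : ∀ {i i' j}, i ≠ i' → E (.inr (κ i j)) ≠ E (.inr (κ i' j)) := fun {i i' j} hi =>
      E.injective.ne (Sum.inr_injective.ne ((h.col_inj j).ne hi))
    -- The outer edges of a path of length three: equal colours there are forbidden by `no_path`
    -- applied to the middle cell `(i, j')`.
    have hp : ∀ {i i' j j'}, (∃ α, κ i j = .inr α) → (∃ α, κ i' j' = .inr α) →
        (∃ α, κ i j' = .inr α) → i ≠ i' → E (.inr (κ i j)) ≠ E (.inr (κ i' j')) := by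
      rintro i i' j j' ⟨α, hα⟩ ⟨β, hβ⟩ ⟨γ, hγ⟩ hi h'
      have h' : κ i j = κ i' j' := by simpa using h'
      rw [hα, hβ] at h'
      obtain rfl := Sum.inr_injective h'
      refine h.no_path i j' i' j γ α ?_ hγ hβ hα
      rintro rfl
      exact hi (h.col_inj j' (hγ.trans hβ.symm))
    rintro (i₀ | j₀) (i₁ | j₁) (i₂ | j₂) (i₃ | j₃) h1 h2 h3 h02 h13 <;>
      simp only [cellGraph_inl_inr, cellGraph_inr_inl, cellGraph_inl_inl, cellGraph_inr_inr]
        at h1 h2 h3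
    · have h02 : i₀ ≠ i₂ := fun h => h02 (h ▸ rfl)
      have h13 : j₁ ≠ j₃ := fun h => h13 (h ▸ rfl)
      simp only [hcol, cellColour_inl_inr, cellColour_inr_inl]
      exact ⟨hc h02, hr h13, (hp h3 h1 h2 h02.symm).symm⟩
    · have h02 : j₀ ≠ j₂ := fun h => h02 (h ▸ rfl)
      have h13 : i₁ ≠ i₃ := fun h => h13 (h ▸ rfl)
      simp only [hcol, cellColour_inl_inr, cellColour_inr_inl]
      exact ⟨hr h02, hc h13, hp h1 h3 h2 h13⟩
  · rw [coe_relabel_closedModel]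
    have := iUnion_addVertex (κ := κ) E (cellGraph_le _) (M := colourMatching κ) (col := col)
      (Q := fun _ => True) (fun i j => cellGraph_inl_inr) (fun i j t => mem_colourMatching)
      (fun i j α _ hα => by rw [hcol, cellColour_inl_inr, hα]) (fun _ _ _ _ => trivial)
    rw [← this]
    simp only [true_and]
    rfl

lemma IsConstruction₂.exists_model (h : IsConstruction₂ k H) :
    ∃ (E : ColourVertices k ≃ V) (κ : _), IsClosedColouring κ ∧
      H = relabel E (closedModel κ) := by
  obtain ⟨hk, -, p, z, a, b, c, B, col, M, hpart, hB, -, habc, hcol, hM, hH⟩ := h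
  let E : ColourVertices k ≃ V := Equiv.ofBijective _ hpart
  have hE : ∀ i j, ∃ α, B.Adj (.inl i) (.inr j) → col s(.inl i, .inr j) = E (.inr (.inr α)) := by
    intro i j
    by_cases hij : B.Adj (.inl i) (.inr j)
    · obtain h | h | h := habc _ ((SimpleGraph.mem_edgeSet _).2 hij)
      exacts [⟨0, fun _ => h⟩, ⟨1, fun _ => h⟩, ⟨2, fun _ => h⟩]
    · exact ⟨0, fun h => absurd h hij⟩
  choose f hf using hE
  have hother : ∀ u w, ∃ w', B.Adj u w' ∧ w' ≠ w := by
    intro u w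
    obtain ⟨w', hw', hne⟩ := Set.exists_ne_of_one_lt_ncard (by rw [hB.2 u]; norm_num) w
    exact ⟨w', hw', hne⟩
  have hne : ∀ u w w', B.Adj u w → B.Adj u w' → w ≠ w' → col s(w, u) ≠ col s(u, w') := by
    intro u w w' h1 h2 hww'
    obtain ⟨q, hq, hqu⟩ := hother w' u
    exact (hcol w u w' q h1.symm h2 hq hww' hqu.symm).1
  obtain ⟨κ, hκ, h1, h2, h3⟩ := exists_isCellColouring hk hM f (by
    intro i j j' hj hj' hf'
    by_contra hjj'
    refine hne _ _ _ hj hj' (by simpa using hjj') ?_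
    rw [Sym2.eq_swap, hf i j hj, hf i j' hj', hf']) (by
    intro j i i' hi hi' hf'
    by_contra hii'
    refine hne _ _ _ hi.symm hi'.symm (by simpa using hii') ?_
    rw [hf i j hi, Sym2.eq_swap, hf i' j hi', hf'])
  refine ⟨E, κ, ⟨hκ, fun i j i' j' α β hαβ hα hβ hβ' => ?_⟩, ?_⟩
  · have e1 := (h2 i j).2 ⟨α, hα⟩
    have e2 := (h2 i' j).2 ⟨β, hβ⟩
    have e3 := (h2 i j').2 ⟨β, hβ'⟩
    have hii' : (.inl i' : Fin k ⊕ Fin k) ≠ .inl i := by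
      intro h
      obtain rfl := Sum.inl_injective h
      exact hαβ (Sum.inr_injective (hα.symm.trans hβ))
    have hjj' : (.inr j : Fin k ⊕ Fin k) ≠ .inr j' := by
      intro h
      obtain rfl := Sum.inr_injective h
      exact hαβ (Sum.inr_injective (hα.symm.trans hβ'))
    -- The cells `(i', j)`, `(i, j)`, `(i, j')` are three consecutive edges of a cycle.
    refine (hcol _ _ _ _ e2 e1.symm e3 hii' hjj').2.2 ?_
    rw [h1 _ _ e2] at hβ
    rw [h1 _ _ e3] at hβ'
    rw [hf _ _ e2, hf _ _ e3, Sum.inr_injective hβ, Sum.inr_injective hβ']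
  · rw [← coe_inj, coe_relabel_closedModel, hH]
    have := iUnion_addVertex (κ := κ) E hB.1 (M := M) (col := col)
      (Q := fun _ => True) h2 h3
      (fun i j α _ hα => by
        have e := (h2 i j).2 ⟨α, hα⟩
        rw [h1 _ _ e] at hα
        rw [hf _ _ e, Sum.inr_injective hα]) (fun _ _ _ _ => trivial)
    rw [← this]
    simp only [true_and]
    rfl

end ConstructionTwo
end SailTuran

namespace SailTuran
open Finset

/-! ### Corner colourings and Construction 1. -/

section ConstructionOne

variable {k : ℕ} {κ : Fin k → Fin k → Fin (k - 2) ⊕ Fin 3} {i₀ j₀ : Fin k}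

/-- The `γ`-cells of the columns in `B` lie in different rows of `A`, and never in the row `i₀`. -/
lemma IsCellColouring.card_lt (h : IsCellColouring κ) {A B : Finset (Fin k)} {γ : Fin 3}
    (hAB : ∀ i j, κ i j = .inr γ → j ∈ B → i ∈ A) (hi₀ : i₀ ∈ A) (hrow : ∀ j, κ i₀ j ≠ .inr γ)
    (hB : ∀ j ∈ B, ∃ i, κ i j = .inr γ) : B.card < A.card := by
  have : Nonempty (Fin k) := ⟨i₀⟩
  choose! f hf using hB
  have h1 : B.card ≤ (A.erase i₀).card := by
    refine card_le_card_of_injOn f (fun j hj => ?_) fun j hj j' hj' hjj' => ?_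
    · refine mem_coe.2 (mem_erase.2 ⟨fun h' => hrow j (h' ▸ hf j hj), hAB _ _ (hf j hj) hj⟩)
    · exact h.row_inj (f j) ((hf j hj).trans (hjj' ▸ (hf j' hj').symm))
  rw [card_erase_of_mem hi₀] at h1
  have := card_pos.2 ⟨_, hi₀⟩
  omega

namespace IsCornerColouring

lemma row_corner_ne_two (h : IsCornerColouring κ 0 2 i₀ j₀) (j : Fin k) : κ i₀ j ≠ .inr 2 := by
  obtain ⟨ja, hja⟩ := h.row_corner
  exact h.row_ne (by decide) (by decide) (by decide) h.corner hja j

lemma col_corner_ne_zero (h : IsCornerColouring κ 0 2 i₀ j₀) (i : Fin k) : κ i j₀ ≠ .inr 0 := by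
  obtain ⟨ic, hic⟩ := h.col_corner
  exact h.transpose.row_ne (by decide) (by decide) (by decide) h.corner hic i

/-- Besides the corner there is exactly one cell of colour `1`. -/
lemma exists_middle (h : IsCornerColouring κ 0 2 i₀ j₀) :
    ∃ i₁ j₁, i₁ ≠ i₀ ∧ j₁ ≠ j₀ ∧ κ i₁ j₁ = .inr 1 ∧
      ∀ i j, κ i j = .inr 1 → (i = i₀ ∧ j = j₀) ∨ (i = i₁ ∧ j = j₁) := by
  -- The column `j₀` has no colour 0, so at most `k - 1` cells have this colour and some row lacks
  -- it.
  obtain ⟨i₁, hi₁⟩ : ∃ i₁, ∀ j, κ i₁ j ≠ .inr 0 := by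
    by_contra! hno
    exact lt_irrefl _ (h.toIsCellColouring.transpose.card_lt (A := univ) (B := univ) (γ := 0)
      (fun _ _ _ _ => mem_univ _) (mem_univ j₀) h.col_corner_ne_zero fun i _ => hno i)
  have hi₁₀ : i₁ ≠ i₀ := by
    rintro rfl
    obtain ⟨j, hj⟩ := h.row_corner
    exact hi₁ j hj
  obtain ⟨j₁, hj₁⟩ : ∃ j₁, κ i₁ j₁ = .inr 1 := by
    obtain ⟨j, hj⟩ | h' := h.row_or i₁ (α := 0) (β := 1) (by decide)
    · exact absurd hj (hi₁ j)
    · exact h'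
  have hj₁₀ : j₁ ≠ j₀ := by
    rintro rfl
    exact hi₁₀ (h.col_inj j₁ (hj₁.trans h.corner.symm))
  refine ⟨i₁, j₁, hi₁₀, hj₁₀, hj₁, fun i j hij => ?_⟩
  by_cases hi : i = i₀
  · subst hi
    exact .inl ⟨rfl, h.row_inj i (hij.trans h.corner.symm)⟩
  by_cases hii₁ : i = i₁
  · subst hii₁
    exact .inr ⟨rfl, h.row_inj i (hij.trans hj₁.symm)⟩
  -- otherwise two rows lack the colour `0`, but only one column does
  obtain ⟨j', hj'⟩ := h.row i hi
  have hi0 : ∀ l, κ i l ≠ .inr 0 :=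
    h.row_ne (by decide) (by decide) (by decide) hij hj'
  have := h.toIsCellColouring.card_lt (A := univ.erase i₁) (B := univ.erase j₀) (γ := 0) (i₀ := i)
    (fun i' j' hij' _ => mem_erase.2 ⟨fun h' => hi₁ j' (h' ▸ hij'), mem_univ _⟩)
    (mem_erase.2 ⟨hii₁, mem_univ _⟩) hi0 fun j hj => h.col j (mem_erase.1 hj).1
  simp at this

variable {i₁ j₁ : Fin k}

/-- With `not_special_right` this says that the two chords between the edges coloured 1 are not in
the 2-factor; a special cell there would complete a path forbidden by `no_path`. -/
lemma not_special_left (h : IsCornerColouring κ 0 2 i₀ j₀) (hj : j₁ ≠ j₀) (h₁ : κ i₁ j₁ = .inr 1) :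
    ¬ ∃ α, κ i₀ j₁ = .inr α := by
  rintro ⟨α, hα⟩
  by_cases hα1 : α = 1
  · subst hα1
    exact hj (h.row_inj i₀ (hα.trans h.corner.symm))
  · exact h.no_path i₀ j₁ i₁ j₀ α hα1 hα h₁ h.corner

lemma not_special_right (h : IsCornerColouring κ 0 2 i₀ j₀) (hi : i₁ ≠ i₀)
    (h₁ : κ i₁ j₁ = .inr 1) : ¬ ∃ α, κ i₁ j₀ = .inr α := by
  rintro ⟨α, hα⟩
  by_cases hα1 : α = 1
  · subst hα1
    exact hi (h.col_inj j₀ (hα.trans h.corner.symm))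
  · exact h.no_path i₁ j₀ i₀ j₁ α hα1 hα h.corner h₁

/-- Otherwise the corner is the only cell of colour 1 in its component, so there all rows contain 0
and all columns contain 2. As the row `i₀` has no 2 and the column `j₀` has no 0, `card_lt` shows
that the component has fewer columns than rows and fewer rows than columns. -/
lemma mem_supp (h : IsCornerColouring κ 0 2 i₀ j₀) (h₁ : κ i₁ j₁ = .inr 1)
    (huniq : ∀ i j, κ i j = .inr 1 → (i = i₀ ∧ j = j₀) ∨ (i = i₁ ∧ j = j₁)) :
    .inl i₁ ∈ ((specialGraph κ).connectedComponentMk (.inl i₀)).supp := by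
  classical
  set C := (specialGraph κ).connectedComponentMk (.inl i₀) with hC
  have hadj : ∀ i j α, κ i j = .inr α → (.inl i ∈ C.supp ↔ .inr j ∈ C.supp) :=
    fun i j α hα => C.mem_supp_congr_adj (cellGraph_inl_inr.2 ⟨α, hα⟩)
  have hi₀ : .inl i₀ ∈ C.supp := by simp [hC]
  have hj₀ := (hadj _ _ _ h.corner).1 hi₀
  by_contra hi₁
  have hj₁ : .inr j₁ ∉ C.supp := fun h' => hi₁ ((hadj _ _ _ h₁).2 h')
  have hA : ∀ i, .inl i ∈ C.supp → ∃ j, κ i j = .inr 0 := by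
    intro i hi
    by_cases hii : i = i₀
    · exact hii ▸ h.row_corner
    obtain h' | ⟨j, hj⟩ := h.row_or i (α := 0) (β := 1) (by decide)
    · exact h'
    · obtain ⟨rfl, -⟩ | ⟨rfl, -⟩ := huniq i j hj
      exacts [absurd rfl hii, absurd hi hi₁]
  have hB : ∀ j, .inr j ∈ C.supp → ∃ i, κ i j = .inr 2 := by
    intro j hj
    by_cases hjj : j = j₀
    · exact hjj ▸ h.col_corner
    obtain h' | ⟨i, hi⟩ := h.col_or j (α := 2) (β := 1) (by decide)
    · exact h'
    · obtain ⟨-, rfl⟩ | ⟨-, rfl⟩ := huniq i j hi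
      exacts [absurd rfl hjj, absurd hj hj₁]
  have h1 := h.toIsCellColouring.card_lt (A := univ.filter fun i => .inl i ∈ C.supp)
    (B := univ.filter fun j => .inr j ∈ C.supp) (γ := 2) (i₀ := i₀)
    (fun i j hij hj => mem_filter.2 ⟨mem_univ _, (hadj i j _ hij).2 (mem_filter.1 hj).2⟩)
    (by simpa using hi₀)
    h.row_corner_ne_two (fun j hj => hB j (mem_filter.1 hj).2)
  have h2 := h.toIsCellColouring.transpose.card_lt (B := univ.filter fun i => .inl i ∈ C.supp)
    (A := univ.filter fun j => .inr j ∈ C.supp) (γ := 0) (i₀ := j₀)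
    (fun j i hij hi => mem_filter.2 ⟨mem_univ _, (hadj i j _ hij).1 (mem_filter.1 hi).2⟩)
    (by simpa using hj₀)
    h.col_corner_ne_zero (fun i hi => hA i (mem_filter.1 hi).2)
  omega

/-- Besides `i₀` and `i₁` the component contains the row of the colour 2 in the corner column, and
likewise for columns. These are new because the chords are not special. -/
lemma six_le_supp (h : IsCornerColouring κ 0 2 i₀ j₀) (hi : i₁ ≠ i₀) (hj : j₁ ≠ j₀)
    (h₁ : κ i₁ j₁ = .inr 1)
    (huniq : ∀ i j, κ i j = .inr 1 → (i = i₀ ∧ j = j₀) ∨ (i = i₁ ∧ j = j₁)) :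
    6 ≤ ((specialGraph κ).connectedComponentMk (.inl i₀)).supp.ncard := by
  have hi₁ := h.mem_supp h₁ huniq
  set C := (specialGraph κ).connectedComponentMk (.inl i₀) with hC
  have hadj : ∀ i j α, κ i j = .inr α → (.inl i ∈ C.supp ↔ .inr j ∈ C.supp) :=
    fun i j α hα => C.mem_supp_congr_adj (cellGraph_inl_inr.2 ⟨α, hα⟩)
  have hi₀ : .inl i₀ ∈ C.supp := by simp [hC]
  have hj₀ := (hadj _ _ _ h.corner).1 hi₀
  have hj₁ := (hadj _ _ _ h₁).1 hi₁
  obtain ⟨j₂, hj₂⟩ := h.row_corner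
  obtain ⟨i₂, hi₂⟩ := h.col_corner
  rw [ncard_sum]
  have hX : 2 < (Sum.inl ⁻¹' C.supp).ncard := by
    refine (Set.two_lt_ncard_iff).2 ⟨i₀, i₁, i₂, hi₀, hi₁, (hadj _ _ _ hi₂).2 hj₀, hi.symm, ?_, ?_⟩
    · rintro rfl
      simp [h.corner] at hi₂
    · rintro rfl
      exact h.not_special_right hi h₁ ⟨_, hi₂⟩
  have hY : 2 < (Sum.inr ⁻¹' C.supp).ncard := by
    refine (Set.two_lt_ncard_iff).2 ⟨j₀, j₁, j₂, hj₀, hj₁, (hadj _ _ _ hj₂).1 hi₀, hj.symm, ?_, ?_⟩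
    · rintro rfl
      simp [h.corner] at hj₂
    · rintro rfl
      exact h.not_special_left hj h₁ ⟨_, hj₂⟩
  omega

end IsCornerColouring

variable {V : Type*} [DecidableEq V] {H : Finset (Finset V)}

lemma coe_relabel_cornerModel (E : ColourVertices k ≃ V) :
    (relabel E (cornerModel κ i₀ j₀) : Set (Finset V)) =
      {e | ∃ i j, (s(.inl i, .inr j) : Sym2 (Fin k ⊕ Fin k)) ≠ s(.inl i₀, .inr j₀) ∧
        e = {E (.inl (.inl i)), E (.inl (.inr j)), E (.inr (κ i j))}} ∪
      {{E (.inl (.inl i₀)), E (.inr (.inr 1)), E (.inr (.inr 2))},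
        {E (.inl (.inr j₀)), E (.inr (.inr 0)), E (.inr (.inr 1))}} := by
  ext e
  simp only [mem_coe, mem_relabel, mem_cornerModel, Set.mem_union, Set.mem_ofPred_eq,
    Set.mem_singleton_iff, Set.mem_insert_iff, ne_eq, cell_edge_eq, Prod.mk.injEq]
  constructor
  · rintro ⟨f, ⟨i, j, hij, rfl⟩ | rfl | rfl, rfl⟩
    · exact .inl ⟨i, j, hij, map_cell E i j⟩
    · exact .inr (.inl (by simp))
    · exact .inr (.inr (by simp))
  · rintro (⟨i, j, hij, rfl⟩ | rfl | rfl)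
    · exact ⟨_, .inl ⟨i, j, hij, rfl⟩, map_cell E i j⟩
    · exact ⟨_, .inr (.inl rfl), by simp⟩
    · exact ⟨_, .inr (.inr rfl), by simp⟩

lemma IsCornerColouring.isConstruction₁ (h : IsCornerColouring κ 0 2 i₀ j₀)
    (E : ColourVertices k ≃ V) : IsConstruction₁ k (relabel E (cornerModel κ i₀ j₀)) := by
  obtain ⟨i₁, j₁, hi, hj, h₁, huniq⟩ := h.exists_middle
  set col := cellColour (fun i j => E (.inr (κ i j))) (E (.inr (.inr 0))) with hcol
  refine ⟨h.three_le, E ∘ .inl, E ∘ .inr ∘ .inl, E (.inr (.inr 0)),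
    E (.inr (.inr 1)), E (.inr (.inr 2)), specialGraph κ,
    (specialGraph κ).connectedComponentMk (.inl i₀), i₀, i₁, j₀, j₁, col, colourMatching κ,
    isVertexPartition E, h.isTwoFactor, h.six_le_supp hi hj h₁ huniq, by simp,
    cellGraph_inl_inr.2 ⟨_, h.corner⟩, h.mem_supp h₁ huniq, cellGraph_inl_inr.2 ⟨_, h₁⟩, hi.symm,
    hj.symm, fun h' => h.not_special_left hj h₁ (cellGraph_inl_inr.1 h'),
    fun h' => h.not_special_right hi h₁ (cellGraph_inl_inr.1 h'), ?_,
    by rw [hcol, cellColour_inl_inr, h₁], h.isMatchingDecomposition, ?_⟩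
  · have hG : ∀ i j, ((specialGraph κ).deleteEdges {s(.inl i₀, .inr j₀), s(.inl i₁, .inr j₁)}).Adj
        (.inl i) (.inr j) → ¬ (i = i₀ ∧ j = j₀) ∧ (κ i j = .inr 0 ∨ κ i j = .inr 2) := by
      intro i j hij
      rw [SimpleGraph.deleteEdges_adj, cellGraph_inl_inr, Set.mem_insert_iff,
        Set.mem_singleton_iff, cell_edge_eq, cell_edge_eq, not_or] at hij
      obtain ⟨⟨α, hα⟩, hij₀, hij₁⟩ := hij
      refine ⟨hij₀, ?_⟩
      fin_cases α
      · exact .inl hα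
      · exact absurd (huniq i j hα) (by tauto)
      · exact .inr hα
    have hle : (specialGraph κ).deleteEdges {s(.inl i₀, .inr j₀), s(.inl i₁, .inr j₁)} ≤ Kkk k :=
      (SimpleGraph.deleteEdges_le _).trans (cellGraph_le _)
    refine ⟨fun e he => ?_, ?_, ?_, ?_⟩
    · obtain ⟨i, j, rfl⟩ := exists_of_mem_edgeSet (SimpleGraph.edgeSet_mono hle he)
      rw [hcol, cellColour_inl_inr]
      obtain ⟨-, h' | h'⟩ := hG i j he <;> simp [h']
    · intro u w w' hw hw' hne
      have e1 := hle hw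
      have e2 := hle hw'
      obtain i | j := u <;> obtain i' | j' := w <;> obtain i'' | j'' := w' <;> simp at e1 e2
      · rw [hcol, cellColour_inl_inr, cellColour_inl_inr]
        exact E.injective.ne (Sum.inr_injective.ne ((h.row_inj i).ne fun h' => hne (h' ▸ rfl)))
      · rw [hcol, cellColour_inr_inl, cellColour_inr_inl]
        exact E.injective.ne (Sum.inr_injective.ne ((h.col_inj j).ne fun h' => hne (h' ▸ rfl)))
    · intro u hu
      have e1 := hle hu
      obtain i | j := u
      · simp at e1
      · obtain ⟨-, h' | h'⟩ := hG _ _ hu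
        · rw [hcol, cellColour_inl_inr, h']
        · exact absurd h' (h.row_corner_ne_two j)
    · intro u hu
      have e1 := hle hu
      obtain i | j := u
      · obtain ⟨-, h' | h'⟩ := hG _ _ hu.symm
        · exact absurd h' (h.col_corner_ne_zero i)
        · rw [hcol, cellColour_inr_inl, h']
      · simp at e1
  · rw [coe_relabel_cornerModel]
    have := iUnion_addVertex (κ := κ) E (cellGraph_le _) (M := colourMatching κ) (col := col)
      (Q := fun e => e ≠ s(.inl i₀, .inr j₀)) (fun i j => cellGraph_inl_inr)
      (fun i j t => mem_colourMatching)
      (fun i j α _ hα => by rw [hcol, cellColour_inl_inr, hα]) (fun i j t ht => by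
        rw [ne_eq, cell_edge_eq]
        rintro ⟨rfl, rfl⟩
        simp [h.corner] at ht)
    rw [← this]
    rfl

lemma IsConstruction₁.exists_model (h : IsConstruction₁ k H) :
    ∃ (E : ColourVertices k ≃ V) (κ : _) (i₀ j₀ : Fin k), IsCornerColouring κ 0 2 i₀ j₀ ∧
      H = relabel E (cornerModel κ i₀ j₀) := by
  obtain ⟨hk, p, z, a, b, c, B, -, i₀, i₁, j₀, j₁, col, M, hpart, hB, -, -, hB₀, -, hB₁, hi, hj,
    hn₁, hn₂, ⟨hac, hproper, hca, hcc⟩, hcb, hM, hH⟩ := h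
  let E : ColourVertices k ≃ V := Equiv.ofBijective _ hpart
  have hG : ∀ i j, (B.deleteEdges {s(.inl i₀, .inr j₀), s(.inl i₁, .inr j₁)}).Adj
      (.inl i) (.inr j) ↔ B.Adj (.inl i) (.inr j) ∧ ¬ (i = i₀ ∧ j = j₀) ∧ ¬ (i = i₁ ∧ j = j₁) := by
    intro i j
    rw [SimpleGraph.deleteEdges_adj, Set.mem_insert_iff, Set.mem_singleton_iff, cell_edge_eq,
      cell_edge_eq, not_or]
  -- The index `α` of the special colour. The edge `a'c'`, which has no colour in the construction,
  -- is given the index 1 of `b`, as is `x'y'`.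
  have hE : ∀ i j, ∃ α, B.Adj (.inl i) (.inr j) →
      (α = 1 ↔ (i = i₀ ∧ j = j₀) ∨ (i = i₁ ∧ j = j₁)) ∧
      (¬ (i = i₀ ∧ j = j₀) → col s(.inl i, .inr j) = E (.inr (.inr α))) := by
    intro i j
    by_cases h1 : (i = i₀ ∧ j = j₀) ∨ (i = i₁ ∧ j = j₁)
    · refine ⟨1, fun _ => ⟨by simp [h1], fun h2 => ?_⟩⟩
      obtain ⟨rfl, rfl⟩ := h1.resolve_left h2
      exact hcb
    by_cases hadj : B.Adj (.inl i) (.inr j)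
    · have h2 := (hG i j).2 ⟨hadj, not_or.1 h1⟩
      obtain h3 | h3 := hac _ ((SimpleGraph.mem_edgeSet _).2 h2)
      · exact ⟨0, fun _ => ⟨by simp [h1], fun _ => h3⟩⟩
      · exact ⟨2, fun _ => ⟨by simp [h1], fun _ => h3⟩⟩
    · exact ⟨0, fun h' => absurd h' hadj⟩
  choose f hf using hE
  obtain ⟨κ, hκ, h1, h2, h3⟩ := exists_isCellColouring hk hM f (by
    intro i j j' hadj hadj' hff
    by_contra hjj'
    by_cases hf1 : f i j = 1
    · have e1 := (hf i j hadj).1.1 hf1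
      have e2 := (hf i j' hadj').1.1 (hff ▸ hf1)
      grind
    · have e1 := mt (hf i j hadj).1.2 hf1
      have e2 := mt (hf i j' hadj').1.2 (hff ▸ hf1)
      rw [not_or] at e1 e2
      refine hproper _ _ _ ((hG i j).2 ⟨hadj, e1⟩) ((hG i j').2 ⟨hadj', e2⟩)
        (by simpa using hjj') ?_
      rw [(hf i j hadj).2 e1.1, (hf i j' hadj').2 e2.1, hff]) (by
    intro j i i' hadj hadj' hff
    by_contra hii'
    by_cases hf1 : f i j = 1
    · have e1 := (hf i j hadj).1.1 hf1
      have e2 := (hf i' j hadj').1.1 (hff ▸ hf1)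
      grind
    · have e1 := mt (hf i j hadj).1.2 hf1
      have e2 := mt (hf i' j hadj').1.2 (hff ▸ hf1)
      rw [not_or] at e1 e2
      refine hproper _ _ _ ((hG i j).2 ⟨hadj, e1⟩).symm ((hG i' j).2 ⟨hadj', e2⟩).symm
        (by simpa using hii') ?_
      rw [Sym2.eq_swap, (hf i j hadj).2 e1.1, Sym2.eq_swap, (hf i' j hadj').2 e2.1, hff])
  have hone : ∀ i j, κ i j = .inr 1 ↔ (i = i₀ ∧ j = j₀) ∨ (i = i₁ ∧ j = j₁) := by
    refine fun i j => ⟨fun h' => ?_, fun h' => ?_⟩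
    · have hadj := (h2 i j).2 ⟨_, h'⟩
      rw [h1 i j hadj] at h'
      exact (hf i j hadj).1.1 (Sum.inr_injective h')
    · have hadj : B.Adj (.inl i) (.inr j) := by
        obtain ⟨rfl, rfl⟩ | ⟨rfl, rfl⟩ := h'
        exacts [hB₀, hB₁]
      rw [h1 i j hadj, (hf i j hadj).1.2 h']
  have hcolκ : ∀ i j α, κ i j = .inr α → ¬ (i = i₀ ∧ j = j₀) →
      col s(.inl i, .inr j) = E (.inr (.inr α)) := by
    intro i j α hα hne
    have hadj := (h2 i j).2 ⟨_, hα⟩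
    rw [h1 i j hadj] at hα
    rw [(hf i j hadj).2 hne, Sum.inr_injective hα]
  have hcorner : κ i₀ j₀ = .inr 1 := (hone i₀ j₀).2 (.inl ⟨rfl, rfl⟩)
  have hrow2 : ∀ j, κ i₀ j ≠ .inr 2 := by
    intro j hj2
    have hne : ¬ ((i₀ = i₀ ∧ j = j₀) ∨ (i₀ = i₁ ∧ j = j₁)) := fun h' => by
      simp [(hone i₀ j).2 h'] at hj2
    rw [not_or] at hne
    have e1 := hca _ ((hG i₀ j).2 ⟨(h2 i₀ j).2 ⟨_, hj2⟩, hne⟩)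
    rw [hcolκ _ _ _ hj2 hne.1] at e1
    have : E (.inr (.inr 2)) = E (.inr (.inr 0)) := e1
    simp at this
  have hcol0 : ∀ i, κ i j₀ ≠ .inr 0 := by
    intro i hi0
    have hne : ¬ ((i = i₀ ∧ j₀ = j₀) ∨ (i = i₁ ∧ j₀ = j₁)) := fun h' => by
      simp [(hone i j₀).2 h'] at hi0
    rw [not_or] at hne
    have e1 := hcc _ ((hG i j₀).2 ⟨(h2 i j₀).2 ⟨_, hi0⟩, hne⟩).symm
    rw [Sym2.eq_swap, hcolκ _ _ _ hi0 hne.1] at e1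
    have : E (.inr (.inr 0)) = E (.inr (.inr 2)) := e1
    simp at this
  have hrow_corner : ∃ j, κ i₀ j = .inr 0 :=
    (hκ.row_or i₀ (α := 0) (β := 2) (by decide)).resolve_right fun ⟨j, hj⟩ => hrow2 j hj
  have hcol_corner : ∃ i, κ i j₀ = .inr 2 :=
    (hκ.col_or j₀ (α := 0) (β := 2) (by decide)).resolve_left fun ⟨i, hi⟩ => hcol0 i hi
  have hrow : ∀ i, i ≠ i₀ → i ≠ i₁ → ∀ j, κ i j ≠ .inr 1 := by
    intro i h0 h1 j h'
    obtain h' | h' := (hone i j).1 h'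
    exacts [h0 h'.1, h1 h'.1]
  have hcol : ∀ j, j ≠ j₀ → j ≠ j₁ → ∀ i, κ i j ≠ .inr 1 := by
    intro j h0 h1 i h'
    obtain h' | h' := (hone i j).1 h'
    exacts [h0 h'.2, h1 h'.2]
  refine ⟨E, κ, i₀, j₀, ⟨hκ, by decide, by decide, by decide, hcorner, fun i hi' => ?_,
    fun j hj' => ?_, hrow_corner, hcol_corner, fun i j i' j' δ hδ hκδ e1 e2 => ?_⟩, ?_⟩
  · by_cases hi₁ : i = i₁
    · subst hi₁
      -- All rows other than `i₁` contain the colour 0, while the column `j₀` does not. By counting,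
      -- the row `i₁` misses 0, so it contains 2. Columns are treated in the same way.
      refine (hκ.row_or i (α := 0) (β := 2) (by decide)).resolve_left fun h0 => ?_
      refine lt_irrefl _ (hκ.transpose.card_lt (A := univ) (B := univ) (γ := 0)
        (fun _ _ _ _ => mem_univ _) (mem_univ j₀) hcol0 fun l _ => ?_)
      by_cases hl : l = i₀
      · exact hl ▸ hrow_corner
      by_cases hl' : l = i
      · exact hl' ▸ h0
      exact (hκ.row_or l (α := 0) (β := 1) (by decide)).resolve_right
        fun ⟨j, hj⟩ => hrow l hl hl' j hj
    · exact (hκ.row_or i (α := 2) (β := 1) (by decide)).resolve_right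
        fun ⟨j, hj⟩ => hrow i hi' hi₁ j hj
  · by_cases hj₁ : j = j₁
    · subst hj₁
      refine (hκ.col_or j (α := 0) (β := 2) (by decide)).resolve_right fun h0 => ?_
      refine lt_irrefl _ (hκ.card_lt (A := univ) (B := univ) (γ := 2)
        (fun _ _ _ _ => mem_univ _) (mem_univ i₀) hrow2 fun l _ => ?_)
      by_cases hl : l = j₀
      · exact hl ▸ hcol_corner
      by_cases hl' : l = j
      · exact hl' ▸ h0
      exact (hκ.col_or l (α := 2) (β := 1) (by decide)).resolve_right
        fun ⟨j, hj⟩ => hcol l hl hl' j hj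
    · exact (hκ.col_or j (α := 0) (β := 1) (by decide)).resolve_right
        fun ⟨i, hi⟩ => hcol j hj' hj₁ i hi
  · have hadj := (h2 i j).2 ⟨_, hκδ⟩
    have hne : κ i j ≠ .inr 1 := by
      rw [hκδ]
      exact fun h' => hδ (Sum.inr_injective h')
    obtain ⟨rfl, rfl⟩ | ⟨rfl, rfl⟩ := (hone _ _).1 e1 <;>
      obtain ⟨rfl, rfl⟩ | ⟨rfl, rfl⟩ := (hone _ _).1 e2
    · exact hne hcorner
    · exact hn₂ hadj
    · exact hn₁ hadj
    · exact hne e1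
  · rw [← coe_inj, coe_relabel_cornerModel, hH]
    have := iUnion_addVertex (κ := κ) E hB.1 (M := M) (col := col)
      (Q := fun e => e ≠ s(.inl i₀, .inr j₀)) h2 h3
      (fun i j α hne hα => hcolκ i j α hα (by rwa [ne_eq, cell_edge_eq] at hne))
      (fun i j t ht => by
        rw [ne_eq, cell_edge_eq]
        rintro ⟨rfl, rfl⟩
        simp [hcorner] at ht)
    rw [← this]
    rfl

end ConstructionOne
end SailTuran

namespace SailTuran
open Finset

/-! ### A corner colouring for every `k ≥ 3`. -/

section Existence

variable {n : ℕ}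

/-- The special colours on the main diagonal. -/
def diagColour (i : Fin (n + 3)) : Fin 3 := if i = 0 then 1 else if i = 1 then 2 else 0

/-- The special colours next to the main diagonal. -/
def offColour (i : Fin (n + 3)) : Fin 3 := if i = 0 then 0 else if i = 1 then 1 else 2

/-- A cyclic Latin square, where two diagonals are coloured with the special colours. -/
def cyclicColouring (i j : Fin (n + 3)) : Fin (n + 3 - 2) ⊕ Fin 3 :=
  Fin.cases (motive := fun _ => Fin (n + 1) ⊕ Fin 3) (.inr (diagColour i))
    (Fin.cases (motive := fun _ => Fin (n + 1) ⊕ Fin 3) (.inr (offColour i)) .inl) (j - i)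

lemma cyclicColouring_eq_inl {i j : Fin (n + 3)} {t : Fin (n + 1)} :
    cyclicColouring i j = .inl t ↔ j - i = t.succ.succ := by
  unfold cyclicColouring
  generalize j - i = d
  induction d using Fin.cases with
  | zero => simp [eq_comm]
  | succ d =>
    induction d using Fin.cases with
    | zero =>
      exact iff_of_false Sum.inr_ne_inl fun h => Fin.succ_ne_zero _ (Fin.succ_injective _ h).symm
    | succ d => simp

lemma cyclicColouring_eq_inr {i j : Fin (n + 3)} {α : Fin 3} :
    cyclicColouring i j = .inr α ↔ (j = i ∧ diagColour i = α) ∨ (j = i + 1 ∧ offColour i = α) := by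
  rw [← sub_eq_zero (a := j), ← sub_eq_iff_eq_add']
  unfold cyclicColouring
  generalize j - i = d
  induction d using Fin.cases with
  | zero => simp
  | succ d =>
    induction d using Fin.cases with
    | zero =>
      change (.inr (offColour i) : Fin (n + 1) ⊕ Fin 3) = .inr α ↔ _
      simp
    | succ d =>
      refine iff_of_false Sum.inl_ne_inr ?_
      rintro (⟨h, -⟩ | ⟨h, -⟩)
      · exact Fin.succ_ne_zero _ h
      · exact Fin.succ_ne_zero _ (Fin.succ_injective _ h)

lemma one_add_one_ne_zero_fin : (1 : Fin (n + 3)) + 1 ≠ 0 := by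
  intro h
  have := congr_arg Fin.val h
  rw [Fin.val_add, Fin.val_one, Nat.mod_eq_of_lt (by omega)] at this
  simp at this

lemma diagColour_ne_offColour (i : Fin (n + 3)) : diagColour i ≠ offColour i := by
  unfold diagColour offColour
  split_ifs <;> decide

lemma offColour_ne_diagColour_add_one (i : Fin (n + 3)) : offColour i ≠ diagColour (i + 1) := by
  have h01 : (0 : Fin (n + 3)) ≠ 1 := by simp
  have h11 : (1 : Fin (n + 3)) + 1 ≠ 0 := one_add_one_ne_zero_fin
  unfold diagColour offColour
  by_cases h0 : i = 0
  · simp [h0, h01.symm]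
  by_cases h1 : i = 1
  · simp [h1, h01.symm, h11]
  · have : i + 1 ≠ 1 := by simpa using h0
    simp only [h0, h1, this, if_false]
    split_ifs <;> decide

/-- The cells with `j - i ∈ {0, 1}` form a single cycle through all rows and columns. Starting at
the corner `(0, 0)`, its colours are `1, 0, 2, 1` and then `0, 2` repeated; the second cell of
colour 1 is `(1, 2)`. -/
lemma isCornerColouring_cyclicColouring :
    IsCornerColouring (cyclicColouring (n := n)) 0 2 0 0 := by
  have h01 : (0 : Fin (n + 3)) ≠ 1 := by simp
  have h11 : (1 : Fin (n + 3)) + 1 ≠ 0 := one_add_one_ne_zero_fin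
  have hm1 : (-1 : Fin (n + 3)) ≠ 0 := by simp
  have hm2 : (-1 : Fin (n + 3)) ≠ 1 := fun h => h11 (by nth_rw 1 [← h]; exact neg_add_cancel 1)
  refine ⟨⟨by omega, fun i j j' hj => ?_, fun j i i' hi => ?_, fun i t => ?_, fun j t => ?_⟩,
    by decide, by decide, by decide, ?_, fun i hi => ?_, fun j hj => ?_, ⟨1, ?_⟩, ⟨-1, ?_⟩,
    fun i j i' j' δ hδ h1 h2 h3 => ?_⟩
  · cases hc : cyclicColouring i j with
    | inl t =>
      have h1 := cyclicColouring_eq_inl.1 hc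
      have h2 := cyclicColouring_eq_inl.1 (hj ▸ hc)
      exact sub_left_injective (h1.trans h2.symm)
    | inr α =>
      have h1 := cyclicColouring_eq_inr.1 hc
      have h2 := cyclicColouring_eq_inr.1 (hj ▸ hc)
      have := diagColour_ne_offColour i
      grind
  · have hi : cyclicColouring i j = cyclicColouring i' j := hi
    cases hc : cyclicColouring i j with
    | inl t =>
      have h1 := cyclicColouring_eq_inl.1 hc
      have h2 := cyclicColouring_eq_inl.1 (hi ▸ hc)
      exact sub_right_injective (h1.trans h2.symm)
    | inr α =>
      have h1 := cyclicColouring_eq_inr.1 hc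
      have h2 := cyclicColouring_eq_inr.1 (hi ▸ hc)
      obtain ⟨rfl, h1⟩ | ⟨rfl, h1⟩ := h1 <;> obtain ⟨h2, h3⟩ | ⟨h2, h3⟩ := h2
      · exact h2
      · subst h2
        exact absurd (h3.trans h1.symm) (offColour_ne_diagColour_add_one i')
      · subst h2
        exact absurd (h1.trans h3.symm) (offColour_ne_diagColour_add_one i)
      · exact add_right_cancel h2
  · exact ⟨i + Fin.succ (n := n + 2) (Fin.succ (n := n + 1) t),
      cyclicColouring_eq_inl.2 (add_sub_cancel_left _ _)⟩
  · exact ⟨j - Fin.succ (n := n + 2) (Fin.succ (n := n + 1) t),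
      cyclicColouring_eq_inl.2 (sub_sub_cancel _ _)⟩
  · exact cyclicColouring_eq_inr.2 (.inl ⟨rfl, by simp [diagColour]⟩)
  · by_cases h1 : i = 1
    · exact ⟨i, cyclicColouring_eq_inr.2 (.inl ⟨rfl, by simp [diagColour, h1]⟩)⟩
    · exact ⟨i + 1, cyclicColouring_eq_inr.2 (.inr ⟨rfl, by simp [offColour, hi, h1]⟩)⟩
  · by_cases h1 : j = 1
    · exact ⟨0, cyclicColouring_eq_inr.2 (.inr ⟨by simp [h1], by simp [offColour]⟩)⟩
    · exact ⟨j, cyclicColouring_eq_inr.2 (.inl ⟨rfl, by simp [diagColour, hj, h1]⟩)⟩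
  · exact cyclicColouring_eq_inr.2 (.inr ⟨by simp, by simp [offColour]⟩)
  · exact cyclicColouring_eq_inr.2 (.inr ⟨by simp, by simp [offColour, hm1, hm2]⟩)
  · have hone : ∀ {i j : Fin (n + 3)}, cyclicColouring i j = .inr 1 →
        (i = 0 ∧ j = 0) ∨ (i = 1 ∧ j = 1 + 1) := by
      intro i j hij
      obtain ⟨rfl, h⟩ | ⟨rfl, h⟩ := cyclicColouring_eq_inr.1 hij
      · unfold diagColour at h
        split_ifs at h with h0 h1
        · exact .inl ⟨h0, h0⟩
        · simp at h
        · simp at h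
      · unfold offColour at h
        split_ifs at h with h0 h1
        · simp at h
        · exact .inr ⟨h1, by rw [h1]⟩
        · simp at h
    have h4 : cyclicColouring i j ≠ .inr 1 := by
      rw [h1]
      exact fun h => hδ (Sum.inr_injective h)
    obtain ⟨-, rfl⟩ | ⟨rfl, rfl⟩ := hone h2 <;> obtain ⟨rfl, rfl⟩ | ⟨rfl, -⟩ := hone h3
    · exact h4 h3
    · obtain ⟨h, -⟩ | ⟨h, -⟩ := cyclicColouring_eq_inr.1 h1
      · exact h01 h
      · exact h11 h.symm
    · obtain ⟨h, -⟩ | ⟨h, -⟩ := cyclicColouring_eq_inr.1 h1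
      · exact h11 h
      · simp [h01.symm] at h
    · exact h4 h2

lemma exists_isCornerColouring {k : ℕ} (hk : 3 ≤ k) :
    ∃ κ i₀ j₀, IsCornerColouring (k := k) κ 0 2 i₀ j₀ := by
  obtain ⟨n, rfl⟩ := Nat.exists_eq_add_of_le' hk
  exact ⟨_, _, _, isCornerColouring_cyclicColouring⟩

end Existence

/-! ### The Turán number and the extremal hypergraphs. -/

section Extremal

variable {V : Type*} [Fintype V] [DecidableEq V] {k : ℕ} {H : Finset (Finset V)}

lemma IsLinearFree.isDense (h : IsLinearFree 3 sail H) (hk : 3 ≤ k)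
    (hV : Fintype.card V = 3 * k + 1) (hc : k ^ 2 < H.card) : IsDense k (H.card - k ^ 2) H :=
  ⟨hk, by omega, hV, by omega, h.1, h.2.1, inter_far_nonempty h.1 h.2.1 h.2.2⟩

/-- More than `k²` edges make the hypergraph dense with `m = |H| - k²`, and `exists_centre` forces
`m = 1`. -/
lemma IsLinearFree.card_le (h : IsLinearFree 3 sail H) (hk : 3 ≤ k)
    (hV : Fintype.card V = 3 * k + 1) : H.card ≤ k ^ 2 + 1 := by
  by_contra! hlt
  have := (h.isDense hk hV (by omega)).exists_centre.1
  omega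

lemma linearTuranNumber_sail (hk : 3 ≤ k) : linearTuranNumber 3 (3 * k + 1) sail = k ^ 2 + 1 := by
  obtain ⟨κ, i₀, j₀, h⟩ := exists_isCornerColouring hk
  have hcard : Fintype.card (ColourVertices k) = 3 * k + 1 := by
    simp only [Fintype.card_sum, Fintype.card_fin]
    omega
  have hmem : k ^ 2 + 1 ∈ {m | ∃ H : Finset (Finset (Fin (3 * k + 1))),
      IsLinearFree 3 sail H ∧ H.card = m} :=
    ⟨_, h.isLinearFree.relabel (Fintype.equivFinOfCardEq hcard),
      (card_relabel _ _).trans (card_cornerModel κ i₀ j₀)⟩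
  have hle : ∀ m ∈ {m | ∃ H : Finset (Finset (Fin (3 * k + 1))),
      IsLinearFree 3 sail H ∧ H.card = m}, m ≤ k ^ 2 + 1 := by
    rintro m ⟨H, hH, rfl⟩
    exact hH.card_le hk (Fintype.card_fin _)
  exact le_antisymm (csSup_le ⟨_, hmem⟩ hle) (le_csSup ⟨_, hle⟩ hmem)

lemma isExtremal_sail_iff (hk : 3 ≤ k) (hV : Fintype.card V = 3 * k + 1) :
    IsExtremal 3 sail H ↔
      IsConstruction₁ k H ∨ IsConstruction₂ k H ∨
        (k = 3 ∧ IsConstruction₃ H) ∨ (k = 3 ∧ IsConstruction₄ H) := by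
  rw [IsExtremal, hV, linearTuranNumber_sail hk]
  constructor
  · rintro ⟨hH, hc⟩
    have hd := hH.isDense hk hV (by omega)
    rw [hc, Nat.add_sub_cancel_left] at hd
    obtain ⟨E, κ, h, rfl⟩ | ⟨E, κ, i₀, j₀, h, rfl⟩ | ⟨hk3, h | h⟩ := hd.exists_model
    · exact .inr (.inl (h.isConstruction₂ E))
    · exact .inl (h.isConstruction₁ E)
    · exact .inr (.inr (.inl ⟨hk3, h⟩))
    · exact .inr (.inr (.inr ⟨hk3, h⟩))
  · rintro (h | h | ⟨rfl, h⟩ | ⟨rfl, h⟩)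
    · obtain ⟨E, κ, i₀, j₀, hκ, rfl⟩ := h.exists_model
      exact ⟨hκ.isLinearFree.relabel E, (card_relabel _ _).trans (card_cornerModel κ i₀ j₀)⟩
    · obtain ⟨E, κ, hκ, rfl⟩ := h.exists_model
      exact ⟨hκ.isLinearFree.relabel E, (card_relabel _ _).trans (card_closedModel κ)⟩
    · obtain ⟨E, s, hs, rfl⟩ := h.exists_model
      have := isLinearFree_modelThree s hs
      exact ⟨this.1.relabel E, by rw [card_relabel, this.2]; norm_num⟩
    · obtain ⟨E, s, hs, rfl⟩ := isConstruction₄_iff.1 h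
      have := isLinearFree_modelFour s hs
      exact ⟨this.1.relabel E, by rw [card_relabel, this.2]; norm_num⟩

end Extremal
end SailTuran

/-- For `n = 3k + 1` with `k ≥ 3`, the linear Turán number of the sail is `k² + 1`, and the
extremal hypergraphs are exactly those given by the four constructions. -/
theorem theorem1 (k : ℕ) (hk : 3 ≤ k) :
    SailTuran.linearTuranNumber 3 (3 * k + 1) SailTuran.sail = k ^ 2 + 1 ∧
    ∀ (V : Type*) [Fintype V] [DecidableEq V], Fintype.card V = 3 * k + 1 →
      ∀ H : Finset (Finset V),
        SailTuran.IsExtremal 3 SailTuran.sail H ↔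
          SailTuran.IsConstruction₁ k H ∨ SailTuran.IsConstruction₂ k H ∨
          (k = 3 ∧ SailTuran.IsConstruction₃ H) ∨ (k = 3 ∧ SailTuran.IsConstruction₄ H) := by
  exact ⟨SailTuran.linearTuranNumber_sail hk, fun _ _ _ hV _ => SailTuran.isExtremal_sail_iff hk hV⟩
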